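/- Let $a\neq b$ be positive real algebraic numbers. Suppose there are coprime integers $p,q$ with $p\neq 0$, $q\notin\{0,1,-1\}$ and $\frac pq\in\mathbb Z[b,b^{-1}]$. Suppose moreover that $a\neq 1$, or that $b^k\neq |q|^n$ for all nonzero integers $k,n$. Then there is no unital AF-algebra $\mathcal A$ with $2$-dimensional trace space such that $K_0(\mathcal A)$ embeds in $\mathbb R^2$ and $$F(\mathcal A)=\left\{\begin{pmatrix}a^n&0\\0&b^n\end{pmatrix}:n\in\mathbb Z\right\}.$$ Here an AF-algebra is the norm closure of an increasing sequence of finite-dimensional C*-subalgebras, and the trace space is the complex vector space of bounded linear functionals $\tau$ on $\mathcal A$ with $\tau(xy)=\tau(yx)$. Let $\varphi_1,\varphi_2$ be the extreme points of the set of normalized traces (tracial states) of $\mathcal A$, listed in any order. We say that $K_0(\mathcal A)$ embeds in $\mathbb R^2$ if $\Gamma(g)=(\varphi_1^*(g),\varphi_2^*(g))$ is an injective, positive, unit preserving group homomorphism from $(K_0(\mathcal A),K_0(\mathcal A)^+,[1_{\mathcal A}])$ to $(\mathbb R^2,\mathbb R^2_+,(1,1))$, where $\mathbb R^2_+$ is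 the set of vectors with nonnegative coordinates. The fundamental group $F(\mathcal A)$ is the set of matrices, with respect to the basis $\varphi_1,\varphi_2$, of the linear maps $T_{(k,p,\Phi)}:\tau\mapsto(\mathrm{Tr}_k\otimes\tau)\circ\Phi$ of the trace space, where $k$ runs over the natural numbers, $p$ over the full projections of $M_k(\mathcal A)$, and $\Phi$ over the $*$-isomorphisms of $\mathcal A$ onto $pM_k(\mathcal A)p$. -/

import Mathlib

namespace AFAlg

open scoped Matrix ComplexOrder

section Star

variable {A : Type*} [Ring A] [StarRing A]

/-- Murray-von Neumann equivalence of matrices over `A` (possibly of different sizes):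
`p = v v*` and `q = v* v` for some rectangular matrix `v`. -/
def MvN {m n : Type*} [Fintype m] [Fintype n] (p : Matrix m m A) (q : Matrix n n A) : Prop :=
  ∃ v : Matrix m n A, v * vᴴ = p ∧ vᴴ * v = q

theorem MvN.refl {m : Type*} [Fintype m] {p : Matrix m m A} (hp : IsStarProjection p) :
    MvN p p := by
  have h1 : pᴴ = p := hp.isSelfAdjoint
  have h2 : p * p = p := hp.isIdempotentElem
  exact ⟨p, by rw [h1, h2], by rw [h1, h2]⟩

theorem MvN.symm {m n : Type*} [Fintype m] [Fintype n] {p : Matrix m m A} {q : Matrix n n A}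
    (h : MvN p q) : MvN q p := by
  obtain ⟨v, h1, h2⟩ := h
  exact ⟨vᴴ, by rw [Matrix.conjTranspose_conjTranspose, h2],
    by rw [Matrix.conjTranspose_conjTranspose, h1]⟩

theorem MvN.trans {m n l : Type*} [Fintype m] [Fintype n] [Fintype l]
    {p : Matrix m m A} {q : Matrix n n A} {r : Matrix l l A}
    (hp : IsStarProjection p) (hr : IsStarProjection r)
    (h : MvN p q) (h' : MvN q r) : MvN p r := by
  obtain ⟨v, h1, h2⟩ := h
  obtain ⟨w, h3, h4⟩ := h'
  have hp2 : p * p = p := hp.isIdempotentElem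
  have hr2 : r * r = r := hr.isIdempotentElem
  refine ⟨v * w, ?_, ?_⟩
  · calc v * w * (v * w)ᴴ = v * (w * wᴴ) * vᴴ := by
          rw [Matrix.conjTranspose_mul]; simp only [Matrix.mul_assoc]
      _ = (v * vᴴ) * (v * vᴴ) := by rw [h3, ← h2]; simp only [Matrix.mul_assoc]
      _ = p := by rw [h1, hp2]
  · calc (v * w)ᴴ * (v * w) = wᴴ * (vᴴ * v) * w := by
          rw [Matrix.conjTranspose_mul]; simp only [Matrix.mul_assoc]
      _ = (wᴴ * w) * (wᴴ * w) := by rw [h2, ← h3]; simp only [Matrix.mul_assoc]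
      _ = r := by rw [h4, hr2]

theorem MvN.submatrix {m n : Type*} [Fintype m] [Fintype n]
    {p : Matrix m m A} (hp : IsStarProjection p) (e : n ≃ m) :
    MvN p (p.submatrix e e) := by
  have h1 : pᴴ = p := hp.isSelfAdjoint
  have h2 : p * p = p := hp.isIdempotentElem
  refine ⟨p.submatrix id e, ?_, ?_⟩
  · rw [Matrix.conjTranspose_submatrix, Matrix.submatrix_mul_equiv, h1, h2, Matrix.submatrix_id_id]
  · have := Matrix.submatrix_mul_equiv pᴴ p (e : n → m) (Equiv.refl m) (e : n → m)
    simp only [Equiv.coe_refl] at this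
    rw [Matrix.conjTranspose_submatrix, this, h1, h2]

variable (A) in
/-- Projections in the matrix algebras `M_k(A)`, `k = 0, 1, 2, …`. -/
structure Proj where
  size : ℕ
  mat : Matrix (Fin size) (Fin size) A
  isProj : IsStarProjection mat

variable (A) in
/-- Murray-von Neumann equivalence as a setoid on matrix projections. -/
instance projSetoid : Setoid (Proj A) where
  r p q := MvN p.mat q.mat
  iseqv :=
    { refl := fun p => MvN.refl p.isProj
      symm := MvN.symm
      trans := fun {p _ r} h h' => MvN.trans p.isProj r.isProj h h' }

theorem isStarProjection_fromBlocks {m n : Type*} [Fintype m] [Fintype n]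
    {p : Matrix m m A} {q : Matrix n n A} (hp : IsStarProjection p) (hq : IsStarProjection q) :
    IsStarProjection (Matrix.fromBlocks p 0 0 q) := by
  have h1 : pᴴ = p := hp.isSelfAdjoint
  have h2 : p * p = p := hp.isIdempotentElem
  have h3 : qᴴ = q := hq.isSelfAdjoint
  have h4 : q * q = q := hq.isIdempotentElem
  refine ⟨?_, ?_⟩
  · change _ * _ = _
    simp [Matrix.fromBlocks_multiply, h2, h4]
  · change Matrix.conjTranspose _ = _
    simp [Matrix.fromBlocks_conjTranspose, h1, h3]

theorem isStarProjection_submatrix {m n : Type*} [Fintype m] [Fintype n]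
    {p : Matrix m m A} (hp : IsStarProjection p) (e : n ≃ m) :
    IsStarProjection (p.submatrix e e) := by
  have h1 : pᴴ = p := hp.isSelfAdjoint
  have h2 : p * p = p := hp.isIdempotentElem
  refine ⟨?_, ?_⟩
  · change _ * _ = _
    rw [Matrix.submatrix_mul_equiv, h2]
  · change Matrix.conjTranspose _ = _
    rw [Matrix.conjTranspose_submatrix, h1]

/-- The block-diagonal sum `diag(p, q)`. -/
def Proj.add (p q : Proj A) : Proj A where
  size := p.size + q.size
  mat := (Matrix.fromBlocks p.mat 0 0 q.mat).submatrix finSumFinEquiv.symm finSumFinEquiv.symm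
  isProj := isStarProjection_submatrix (isStarProjection_fromBlocks p.isProj q.isProj) _

/-- The empty (`0 × 0`) projection. -/
def Proj.zero : Proj A where
  size := 0
  mat := 0
  isProj := IsStarProjection.zero _

theorem MvN.fromBlocks {m n m' n' : Type*} [Fintype m] [Fintype n] [Fintype m'] [Fintype n']
    {p : Matrix m m A} {q : Matrix n n A} {p' : Matrix m' m' A} {q' : Matrix n' n' A}
    (h : MvN p p') (h' : MvN q q') :
    MvN (Matrix.fromBlocks p 0 0 q) (Matrix.fromBlocks p' 0 0 q') := by
  obtain ⟨v, h1, h2⟩ := h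
  obtain ⟨w, h3, h4⟩ := h'
  refine ⟨Matrix.fromBlocks v 0 0 w, ?_, ?_⟩
  · simp [Matrix.fromBlocks_conjTranspose, Matrix.fromBlocks_multiply, h1, h3]
  · simp [Matrix.fromBlocks_conjTranspose, Matrix.fromBlocks_multiply, h2, h4]

theorem Proj.mvN_add (p q : Proj A) :
    MvN (Matrix.fromBlocks p.mat 0 0 q.mat) (p.add q).mat :=
  MvN.submatrix (isStarProjection_fromBlocks p.isProj q.isProj) _

theorem Proj.add_congr {p p' q q' : Proj A} (h : p ≈ p') (h' : q ≈ q') :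
    p.add q ≈ p'.add q' := by
  have hp := isStarProjection_fromBlocks p.isProj q.isProj
  exact MvN.trans (p.add q).isProj (p'.add q').isProj (Proj.mvN_add p q).symm
    (MvN.trans hp (p'.add q').isProj (MvN.fromBlocks h h') (Proj.mvN_add p' q'))

theorem Proj.add_comm' (p q : Proj A) : p.add q ≈ q.add p := by
  have hp := isStarProjection_fromBlocks p.isProj q.isProj
  have h : MvN (Matrix.fromBlocks p.mat 0 0 q.mat) (Matrix.fromBlocks q.mat 0 0 p.mat) := by
    have := MvN.submatrix hp (Equiv.sumComm (Fin q.size) (Fin p.size))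
    simpa using this
  exact MvN.trans (p.add q).isProj (q.add p).isProj (Proj.mvN_add p q).symm
    (MvN.trans hp (q.add p).isProj h (Proj.mvN_add q p))

theorem fromBlocks_empty {R n : Type*} [Zero R] (z : Matrix (Fin 0) (Fin 0) R) (q : Matrix n n R) :
    (Matrix.fromBlocks z 0 0 q).submatrix (Equiv.emptySum (Fin 0) n).symm
      (Equiv.emptySum (Fin 0) n).symm = q := by
  ext i j
  simp

theorem Proj.zero_add' (p : Proj A) : Proj.zero.add p ≈ p := by
  have hp := isStarProjection_fromBlocks (Proj.zero (A := A)).isProj p.isProj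
  have h : MvN (Matrix.fromBlocks (Proj.zero (A := A)).mat 0 0 p.mat) p.mat := by
    have := MvN.submatrix hp (Equiv.emptySum (Fin 0) (Fin p.size)).symm
    exact (fromBlocks_empty (Proj.zero (A := A)).mat p.mat) ▸ this
  exact MvN.trans (Proj.zero.add p).isProj p.isProj (Proj.mvN_add _ p).symm h

theorem Proj.add_assoc' (p q r : Proj A) : (p.add q).add r ≈ p.add (q.add r) := by
  have h0 := isStarProjection_fromBlocks p.isProj q.isProj
  have h0' := isStarProjection_fromBlocks q.isProj r.isProj
  have h1 := isStarProjection_fromBlocks h0 r.isProj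
  have h2 := isStarProjection_fromBlocks p.isProj h0'
  have a1 : MvN ((p.add q).add r).mat
      (Matrix.fromBlocks (Matrix.fromBlocks p.mat 0 0 q.mat) 0 0 r.mat) :=
    MvN.trans ((p.add q).add r).isProj h1 (Proj.mvN_add _ _).symm
      (MvN.fromBlocks (Proj.mvN_add p q).symm (MvN.refl r.isProj))
  have a2 : MvN (Matrix.fromBlocks p.mat 0 0 (Matrix.fromBlocks q.mat 0 0 r.mat))
      (p.add (q.add r)).mat :=
    MvN.trans h2 (p.add (q.add r)).isProj
      (MvN.fromBlocks (MvN.refl p.isProj) (Proj.mvN_add q r)) (Proj.mvN_add _ _)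
  have a3 : MvN (Matrix.fromBlocks (Matrix.fromBlocks p.mat 0 0 q.mat) 0 0 r.mat)
      (Matrix.fromBlocks p.mat 0 0 (Matrix.fromBlocks q.mat 0 0 r.mat)) := by
    have := MvN.submatrix h1 (Equiv.sumAssoc (Fin p.size) (Fin q.size) (Fin r.size)).symm
    have e : (Matrix.fromBlocks (Matrix.fromBlocks p.mat 0 0 q.mat) 0 0 r.mat).submatrix
        (Equiv.sumAssoc (Fin p.size) (Fin q.size) (Fin r.size)).symm
        (Equiv.sumAssoc (Fin p.size) (Fin q.size) (Fin r.size)).symm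
        = Matrix.fromBlocks p.mat 0 0 (Matrix.fromBlocks q.mat 0 0 r.mat) := by
      ext i j
      rcases i with i | i | i <;> rcases j with j | j | j <;> simp
    exact e ▸ this
  exact MvN.trans ((p.add q).add r).isProj (p.add (q.add r)).isProj
    (MvN.trans ((p.add q).add r).isProj h2 a1 a3) a2

variable (A) in
/-- The Murray-von Neumann semigroup `V(A)`: equivalence classes of matrix projections. -/
def V := Quotient (projSetoid A)

/-- The class of a matrix projection in `V(A)`. -/
def V.mk (p : Proj A) : V A := Quotient.mk _ p

instance : Zero (V A) := ⟨V.mk Proj.zero⟩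

instance : Add (V A) :=
  ⟨Quotient.map₂ Proj.add (fun _ _ h _ _ h' => Proj.add_congr h h')⟩

instance : AddCommMonoid (V A) where
  add_assoc := by
    rintro ⟨p⟩ ⟨q⟩ ⟨r⟩
    exact Quotient.sound (Proj.add_assoc' p q r)
  add_comm := by
    rintro ⟨p⟩ ⟨q⟩
    exact Quotient.sound (Proj.add_comm' p q)
  zero_add := by
    rintro ⟨p⟩
    exact Quotient.sound (Proj.zero_add' p)
  add_zero := by
    rintro ⟨p⟩
    exact Quotient.sound (Setoid.trans (Proj.add_comm' p Proj.zero) (Proj.zero_add' p))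
  nsmul := nsmulRec

variable (A) in
/-- `K₀(A)`, the Grothendieck group of `V(A)`. -/
abbrev K0 := Algebra.GrothendieckAddGroup (V A)

/-- The class `[p]` of a matrix projection in `K₀(A)`. -/
def K0.cls (p : Proj A) : K0 A := Algebra.GrothendieckAddGroup.of (V.mk p)

variable (A) in
/-- The positive cone `K₀(A)⁺`: the classes of matrix projections. -/
def K0.pos : Set (K0 A) := Set.range K0.cls

variable (A) in
/-- The class `[1_A]` in `K₀(A)`. -/
def K0.unit : K0 A := K0.cls ⟨1, 1, IsStarProjection.one _⟩

end Star

section CStar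

variable {A : Type*} [CStarAlgebra A]

variable (A) in
/-- A unital C*-algebra is AF if it is the norm closure of an increasing sequence of
finite-dimensional (unital) *-subalgebras. -/
def IsAF : Prop :=
  ∃ B : ℕ → StarSubalgebra ℂ A, Monotone B ∧ (∀ n, FiniteDimensional ℂ (B n)) ∧
    Dense (⋃ n, (B n : Set A))

variable (A) in
/-- The trace space of `A`: all bounded linear functionals `τ` with `τ(xy) = τ(yx)`. -/
noncomputable def traceSpace : Submodule ℂ (A →L[ℂ] ℂ) where
  carrier := {τ | ∀ x y, τ (x * y) = τ (y * x)}
  add_mem' := by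
    intro s t hs ht x y
    simp [hs x y, ht x y]
  zero_mem' := by
    intro x y
    simp
  smul_mem' := by
    intro c t ht x y
    simp [ht x y]

variable (A) in
/-- The set of normalized traces (tracial states) of `A`. -/
def tracialStates : Set (A →L[ℂ] ℂ) :=
  {τ | τ ∈ traceSpace A ∧ (∀ x, 0 ≤ τ (star x * x)) ∧ τ 1 = 1}

/-- `φ` lists the extreme normalized traces of `A`, without repetition. -/
def EnumeratesExtremeTraces {n : ℕ} (φ : Fin n → tracialStates A) : Prop :=
  Function.Injective φ ∧
    Set.range (fun i => (φ i : A →L[ℂ] ℂ)) = Set.extremePoints ℝ (tracialStates A)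

/-- `(Tr_k ⊗ τ)(x) = ∑ i, τ (x i i)` for `x ∈ M_k(A)`. -/
noncomputable def ampTrace (τ : A →L[ℂ] ℂ) {m : Type*} [Fintype m] (x : Matrix m m A) : ℂ :=
  ∑ i, τ (x i i)

theorem ampTrace_congr {τ : A →L[ℂ] ℂ} (hτ : τ ∈ traceSpace A) {m n : Type*} [Fintype m]
    [Fintype n] {p : Matrix m m A} {q : Matrix n n A} (h : MvN p q) :
    ampTrace τ p = ampTrace τ q := by
  obtain ⟨v, rfl, rfl⟩ := h
  simp only [ampTrace, Matrix.mul_apply, map_sum, Matrix.conjTranspose_apply]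
  rw [Finset.sum_comm]
  exact Finset.sum_congr rfl fun i _ => Finset.sum_congr rfl fun j _ => hτ _ _

theorem ampTrace_fromBlocks (τ : A →L[ℂ] ℂ) {m n l : Type*} [Fintype m] [Fintype n] [Fintype l]
    (p : Matrix m m A) (q : Matrix n n A) (e : m ⊕ n ≃ l) :
    ampTrace τ ((Matrix.fromBlocks p 0 0 q).submatrix e.symm e.symm)
      = ampTrace τ p + ampTrace τ q := by
  simp only [ampTrace, Matrix.submatrix_apply]
  rw [Equiv.sum_comp e.symm (fun i => τ (Matrix.fromBlocks p 0 0 q i i)), Fintype.sum_sum_type]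
  simp

theorem ampTrace_add (τ : A →L[ℂ] ℂ) (p q : Proj A) :
    ampTrace τ (p.add q).mat = ampTrace τ p.mat + ampTrace τ q.mat :=
  ampTrace_fromBlocks τ p.mat q.mat finSumFinEquiv

/-- `(Tr ⊗ τ)` of a matrix projection is nonnegative, in particular real; so nothing is lost
by taking real parts in `traceV`. -/
theorem ampTrace_nonneg (τ : tracialStates A) (p : Proj A) :
    0 ≤ ampTrace (τ : A →L[ℂ] ℂ) p.mat := by
  have h1 : (p.mat)ᴴ = p.mat := p.isProj.isSelfAdjoint
  have h2 : p.mat * p.mat = p.mat := p.isProj.isIdempotentElem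
  have h3 : (p.mat)ᴴ * p.mat = p.mat := by rw [h1, h2]
  rw [← h3]
  unfold ampTrace
  refine Finset.sum_nonneg fun i _ => ?_
  simp only [Matrix.mul_apply, map_sum, Matrix.conjTranspose_apply]
  exact Finset.sum_nonneg fun j _ => τ.2.2.1 _

/-- The additive map `V(A) → ℝ` induced by a normalized trace. -/
noncomputable def traceV (τ : tracialStates A) : V A →+ ℝ where
  toFun := Quotient.lift (fun p : Proj A => (ampTrace (τ : A →L[ℂ] ℂ) p.mat).re)
    (fun _ _ h => congrArg Complex.re (ampTrace_congr τ.2.1 h))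
  map_zero' := by
    change (ampTrace (τ : A →L[ℂ] ℂ) (Proj.zero (A := A)).mat).re = 0
    simp [ampTrace, Proj.zero]
  map_add' := by
    rintro ⟨p⟩ ⟨q⟩
    change (ampTrace (τ : A →L[ℂ] ℂ) (p.add q).mat).re = _
    rw [ampTrace_add, Complex.add_re]

/-- The homomorphism `τ* : K₀(A) → ℝ` induced by a normalized trace. -/
noncomputable def traceK0 (τ : tracialStates A) : K0 A →+ ℝ :=
  Algebra.GrothendieckAddGroup.lift (traceV τ)

/-- `Γ(g) = (φ₁*(g), …, φₙ*(g))`. -/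
noncomputable def Gam {n : ℕ} (φ : Fin n → tracialStates A) : K0 A →+ (Fin n → ℝ) :=
  AddMonoidHom.pi fun i => traceK0 (φ i)

/-- `K₀(A)` embeds in `ℝⁿ`: `Γ` is an injective, positive, unit preserving homomorphism from
`(K₀(A), K₀(A)⁺, [1_A])` to `(ℝⁿ, ℝⁿ₊, (1, …, 1))`. -/
def EmbedsK0 {n : ℕ} (φ : Fin n → tracialStates A) : Prop :=
  Function.Injective (Gam φ) ∧ (∀ g ∈ K0.pos A, ∀ i, 0 ≤ Gam φ g i) ∧
    Gam φ (K0.unit A) = fun _ => 1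

/-- The fundamental group `F(A)`, relative to the listed extreme traces `φ₁, …, φₙ`: all matrices
with respect to the basis `φ` of the maps `T_{(k,p,Φ)} : τ ↦ (Tr_k ⊗ τ) ∘ Φ` of the trace space,
where `p ∈ M_k(A)` is a full projection and `Φ` is a *-isomorphism of `A` onto the corner
`p M_k(A) p`. The `j`-th column of `N` gives the coordinates of the image of `φ j`. -/
def fundamentalGroup {n : ℕ} (φ : Fin n → tracialStates A) : Set (Matrix (Fin n) (Fin n) ℂ) :=
  {N | ∃ (k : ℕ) (p : Matrix (Fin k) (Fin k) A) (Φ : A →⋆ₙₐ[ℂ] Matrix (Fin k) (Fin k) A),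
    IsStarProjection p ∧ TwoSidedIdeal.span {p} = ⊤ ∧
    Function.Injective Φ ∧ Set.range Φ = {x | p * x * p = x} ∧
    ∀ (j : Fin n) (x : A),
      ampTrace (φ j : A →L[ℂ] ℂ) (Φ x) = ∑ i, N i j * (φ i : A →L[ℂ] ℂ) x}

end CStar

end AFAlg

namespace AFAlg

/-! ### Projections in finite-dimensional *-subalgebras -/

section FiniteDimensional

variable {M : Type*} [CStarAlgebra M]

/-! The trace vectors of matrix projections form a cone in ℝ² (`IsVal`). Cancellation together with
injectivity of `Gam` makes the trace vector a complete invariant of projections up to equivalence. A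
diagonal element diag(c) of the fundamental group multiplies this cone coordinatewise, so c lies in
the ring R of multipliers of the group generated by the cone (`multipliers`). If the fundamental
group were {diag(a,b)^n}, then R would contain (a,b) and its inverse. Since R is also closed under
addition, it contains a unit that is not a power of (a,b), and that unit is again realized by a
*-isomorphism: a contradiction.

Arithmetic (`exists_rational_unit`). As p/q is an integral Laurent polynomial in b and p, q are
coprime, R has an element with second coordinate 1/q. If a and b are conjugate over ℚ, the first
coordinate is 1/q too, and (q²,q²) is a unit of R; it is no power of (a,b) because a ≠ b. Otherwise
R contains (0,N) for some integer N ≠ 0, and since N divides some q^(2l)(q^(2k)-1), the vector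
(1,q^(2k)) is a unit of R. If it were a power of (a,b), then a = 1 and b would have a nonzero power
equal to one of |q|, which the last hypothesis excludes.

Positivity (`isVal_mul`). A positive multiplier need not obviously preserve the cone, only the
group. On vectors with two positive coordinates it does, by strict comparison (`isVal_sub_of_lt`), a
compactness argument on tracial states. On vectors with a zero coordinate a rational multiplier acts
as a rational scalar, and unperforation (`isVal_sub_of_nsmul`) applies. This is why rational units
are sought.

Realization (`diagonal_mem_fundamentalGroup`). If c and its inverse preserve the cone, choose a
projection q with trace vector c. An Elliott back-and-forth argument builds an isomorphism of the
algebra onto the corner of q that scales the traces by c. Partial isomorphisms are encoded by their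
graphs, finite-dimensional *-subalgebras of a product (`IsGraph`); each can be enlarged to
approximate a further element on either side, and the closure of the union is the graph sought. -/

theorem isClosed_of_finiteDimensional (D : NonUnitalStarSubalgebra ℂ M)
    [FiniteDimensional ℂ D] : IsClosed (D : Set M) := by
  have : FiniteDimensional ℂ D.toSubmodule := ‹FiniteDimensional ℂ D›
  exact Submodule.closed_of_finiteDimensional D.toSubmodule

/-- Let P be the minimal polynomial of left multiplication by x on D. Evaluating P of that operator
at x itself gives P(x)x = 0, so every spectral value is a root of P·X. The extra factor X is needed
because D need not contain 1. -/
theorem finite_spectrum_of_mem (D : NonUnitalStarSubalgebra ℂ M) [FiniteDimensional ℂ D]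
    {x : M} (hx : x ∈ D) : (spectrum ℂ x).Finite := by
  let L : Module.End ℂ D := LinearMap.mulLeft ℂ (⟨x, hx⟩ : D)
  let P := minpoly ℂ L
  have hP : P ≠ 0 := minpoly.ne_zero (Algebra.IsIntegral.isIntegral L)
  have key : ∀ (Q : Polynomial ℂ) (y : D), ((Polynomial.aeval L Q y : D) : M)
      = Polynomial.aeval x Q * (y : M) := by
    intro Q y
    induction Q using Polynomial.induction_on generalizing y with
    | C a => simp [Algebra.algebraMap_eq_smul_one]
    | add p q hp hq => simp [hp, hq, add_mul]
    | monomial n a h =>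
      have e1 : Polynomial.aeval L (Polynomial.C a * Polynomial.X ^ (n + 1))
          = Polynomial.aeval L (Polynomial.C a * Polynomial.X ^ n) * L := by
        rw [pow_succ, ← mul_assoc, map_mul, Polynomial.aeval_X]
      have e2 : Polynomial.aeval x (Polynomial.C a * Polynomial.X ^ (n + 1))
          = Polynomial.aeval x (Polynomial.C a * Polynomial.X ^ n) * x := by
        rw [pow_succ, ← mul_assoc, map_mul, Polynomial.aeval_X]
      rw [e1, e2, Module.End.mul_apply, h]
      simp [L, mul_assoc]
  have h0 : Polynomial.aeval x (P * Polynomial.X) = 0 := by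
    have h1 := key P ⟨x, hx⟩
    rw [minpoly.aeval] at h1
    simp only [map_mul, Polynomial.aeval_X]
    exact h1.symm
  have hQ : P * Polynomial.X ≠ 0 := mul_ne_zero hP Polynomial.X_ne_zero
  refine ((P * Polynomial.X).rootSet_finite ℂ).subset ?_
  intro c hc
  rw [Polynomial.mem_rootSet]
  refine ⟨hQ, ?_⟩
  have h2 := spectrum.subset_polynomial_aeval x (P * Polynomial.X) ⟨c, hc, rfl⟩
  rw [h0] at h2
  have : Nontrivial M := by
    by_contra h
    rw [not_nontrivial_iff_subsingleton] at h
    simp [spectrum.of_subsingleton] at hc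
  rw [spectrum.zero_eq] at h2
  simpa using h2

/-- The projection is the spectral projection f of x at a nonzero spectral value l. The indicator of
l is continuous on the finite quasispectrum, so f is available in D by functional calculus. Since xf
= lf, the equality f = e would force x = le. -/
theorem exists_projection_of_not_smul (D : NonUnitalStarSubalgebra ℂ M) [FiniteDimensional ℂ D]
    {e x : M} (hx : x ∈ D) (hxs : IsSelfAdjoint x) (hex : e * x = x)
    (hxe : ∀ c : ℝ, x ≠ c • e) (he : IsSelfAdjoint e) :
    ∃ f ∈ D, IsStarProjection f ∧ e * f = f ∧ f ≠ 0 ∧ f ≠ e := by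
  have hcl : IsClosed (D : Set M) := isClosed_of_finiteDimensional D
  have hfin : (quasispectrum ℝ x).Finite := by
    rw [quasispectrum_eq_spectrum_union_zero]
    refine Set.Finite.union ?_ (Set.finite_singleton 0)
    rw [← spectrum.preimage_algebraMap (R := ℝ) ℂ]
    exact (finite_spectrum_of_mem D hx).preimage (FaithfulSMul.algebraMap_injective ℝ ℂ).injOn
  have hcont : ∀ g : ℝ → ℝ, ContinuousOn g (quasispectrum ℝ x) := fun g => hfin.continuousOn g
  have hx0 : x ≠ 0 := fun h => hxe 0 (by simpa using h)
  obtain ⟨l, hl, hl0⟩ : ∃ l ∈ quasispectrum ℝ x, l ≠ 0 := by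
    by_contra! h
    apply hx0
    rw [← cfcₙ_id' ℝ x, ← cfcₙ_const_zero ℝ x]
    exact cfcₙ_congr fun t ht => h t ht
  let g : ℝ → ℝ := fun t => if t = l then 1 else 0
  have hg0 : g 0 = 0 := by simp [g, hl0.symm]
  have h1 : x * cfcₙ g x = l • cfcₙ g x := by
    have h2 : cfcₙ (fun t => t * g t) x = x * cfcₙ g x := by
      rw [cfcₙ_mul (fun t => t) g x (hcont _) rfl (hcont _) hg0, cfcₙ_id' ℝ x]
    rw [← h2, ← cfcₙ_smul l g x (hcont _) hg0]
    congr 1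
    ext t
    by_cases h : t = l <;> simp [g, h]
  refine ⟨cfcₙ g x, cfcₙ_mem (hs := hcl) g hx, ⟨?_, cfcₙ_predicate g x⟩, ?_, ?_, ?_⟩
  · change cfcₙ g x * cfcₙ g x = cfcₙ g x
    rw [← cfcₙ_mul g g x (hcont _) hg0 (hcont _) hg0]
    congr 1
    ext t
    by_cases h : t = l <;> simp [g, h]
  · have h3 : cfcₙ g x = l⁻¹ • (x * cfcₙ g x) := by rw [h1, inv_smul_smul₀ hl0]
    rw [h3, mul_smul_comm, ← mul_assoc, hex]
  · intro h
    have h4 := norm_apply_le_norm_cfcₙ g x hl (hcont _) hg0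
    rw [h] at h4
    simp [g] at h4
    linarith
  · intro h
    apply hxe l
    rw [← h, ← h1, h]
    have := congrArg star hex
    rwa [star_mul, hxs.star_eq, he.star_eq, eq_comm] at this

/-- A minimal projection of a finite-dimensional *-subalgebra. -/
structure IsMinProj (D : NonUnitalStarSubalgebra ℂ M) (e : M) : Prop where
  mem : e ∈ D
  proj : IsStarProjection e
  ne_zero : e ≠ 0
  corner : ∀ x ∈ D, ∃ c : ℂ, e * x * e = c • e

/-- If no such f existed, every self-adjoint element of D fixed by left multiplication by e would be
a real multiple of e. Applied to the real and imaginary parts of exe, this makes the corner scalar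
and e minimal. -/
theorem exists_lt_of_not_isMinProj (D : NonUnitalStarSubalgebra ℂ M) [FiniteDimensional ℂ D]
    {e : M} (heD : e ∈ D) (he : IsStarProjection e) (he0 : e ≠ 0) (hm : ¬ IsMinProj D e) :
    ∃ f ∈ D, IsStarProjection f ∧ e * f = f ∧ f ≠ 0 ∧ f ≠ e := by
  by_contra hcon
  apply hm
  have hes : star e = e := he.isSelfAdjoint
  have hee : e * e = e := he.isIdempotentElem
  have hsa : ∀ x ∈ D, IsSelfAdjoint x → e * x = x → ∃ c : ℝ, x = c • e := by
    intro x hx hxs hex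
    by_contra! h
    exact hcon (exists_projection_of_not_smul D hx hxs hex h he.isSelfAdjoint)
  refine ⟨heD, he, he0, fun x hx => ?_⟩
  set y := e * x * e with hy
  have hyD : y ∈ D := mul_mem (mul_mem heD hx) heD
  have hey : e * y = y := by rw [hy, ← mul_assoc, ← mul_assoc, hee]
  have hey' : e * star y = star y := by
    rw [hy]; simp only [star_mul, hes, ← mul_assoc, hee]
  obtain ⟨a, ha⟩ := hsa (y + star y) (add_mem hyD (star_mem hyD)) (IsSelfAdjoint.add_star_self y)
    (by rw [mul_add, hey, hey'])
  obtain ⟨b, hb⟩ := hsa (Complex.I • (y - star y))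
    (SMulMemClass.smul_mem _ (sub_mem hyD (star_mem hyD)))
    (by
      rw [isSelfAdjoint_iff, star_smul, star_sub, star_star]
      simp [← smul_neg])
    (by rw [mul_smul_comm, mul_sub, hey, hey'])
  refine ⟨((a : ℂ) - Complex.I * b) / 2, ?_⟩
  have h1 : y = (2⁻¹ : ℂ) • ((y + star y) - Complex.I • (Complex.I • (y - star y))) := by
    rw [smul_smul, Complex.I_mul_I]
    simp only [neg_smul, one_smul, sub_neg_eq_add]
    rw [show y + star y + (y - star y) = (2 : ℂ) • y by rw [two_smul]; abel, smul_smul]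
    norm_num
  rw [h1, ha, hb]
  have e1 : ∀ c : ℝ, c • e = (c : ℂ) • e := fun c => (Complex.coe_smul c e).symm
  rw [e1, e1, smul_smul, ← sub_smul, smul_smul]
  congr 1
  ring

theorem isStarProjection_mul_right {e f : M} (he : IsStarProjection e) (hf : IsStarProjection f)
    (h : e * f = f) : f * e = f := by
  have := congrArg star h
  rwa [star_mul, hf.isSelfAdjoint.star_eq, he.isSelfAdjoint.star_eq] at this

theorem isStarProjection_mul_left {e f : M} (he : IsStarProjection e) (hf : IsStarProjection f)
    (h : f * e = f) : e * f = f := by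
  have := congrArg star h
  rwa [star_mul, hf.isSelfAdjoint.star_eq, he.isSelfAdjoint.star_eq] at this

theorem mul_sum_of_orthogonal {ι : Type*} [Fintype ι] {g : ι → M} (h : ∀ i, IsStarProjection (g i))
    (ho : ∀ i j, i ≠ j → g i * g j = 0) (i : ι) : g i * ∑ j, g j = g i := by
  classical
  rw [Finset.mul_sum, Finset.sum_eq_single i (fun j _ hj => ho i j hj.symm) (by simp)]
  exact (h i).isIdempotentElem

/-- Induction on the dimension of eD = {x ∈ D : ex = x}. A nonminimal e splits as f + (e - f), and
both summands cut out strictly smaller spaces because e itself is lost. -/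
theorem exists_decomposition (D : NonUnitalStarSubalgebra ℂ M) [FiniteDimensional ℂ D]
    {e : M} (heD : e ∈ D) (he : IsStarProjection e) :
    ∃ (ι : Type) (_ : Fintype ι) (g : ι → M), (∀ i, IsMinProj D (g i)) ∧
      (∀ i j, i ≠ j → g i * g j = 0) ∧ ∑ i, g i = e := by
  let K : M → Submodule ℂ D := fun e =>
    LinearMap.ker (LinearMap.mulLeft ℂ (1 - e) ∘ₗ D.toSubmodule.subtype)
  have hK : ∀ (e : M) (x : D), x ∈ K e ↔ e * x = x := by
    intro e x
    change (1 - e) * (x : M) = 0 ↔ _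
    rw [sub_mul, one_mul, sub_eq_zero, eq_comm]
  induction hn : Module.finrank ℂ (K e) using Nat.strong_induction_on generalizing e with
  | _ n ih =>
  by_cases he0 : e = 0
  · exact ⟨Empty, inferInstance, Empty.elim, fun i => i.elim, fun i => i.elim, by simp [he0]⟩
  by_cases hm : IsMinProj D e
  · exact ⟨Unit, inferInstance, fun _ => e, fun _ => hm, fun i j h => (h rfl).elim, by simp⟩
  obtain ⟨f, hfD, hf, hef, hf0, hfe⟩ := exists_lt_of_not_isMinProj D heD he he0 hm
  have hfe' := isStarProjection_mul_right he hf hef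
  have hee : e * e = e := he.isIdempotentElem
  have hlt : ∀ f' : M, IsStarProjection f' → e * f' = f' → f' ≠ e →
      Module.finrank ℂ (K f') < n := by
    intro f' hf' h1 h2
    rw [← hn]
    apply Submodule.finrank_lt_finrank_of_lt
    rw [SetLike.lt_iff_le_and_exists]
    refine ⟨fun x hx => ?_, ⟨e, heD⟩, ?_, ?_⟩
    · rw [hK] at hx ⊢
      rw [← hx, ← mul_assoc, h1]
    · rw [hK]; exact hee
    · rw [hK]
      intro h3
      exact h2 ((isStarProjection_mul_right he hf' h1).symm.trans h3)
  have hd : IsStarProjection (e - f) := hf.sub_of_mul_eq_left he hfe'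
  obtain ⟨ι, _, g, hg, ho, hs⟩ := ih _ (hlt f hf hef hfe) hfD hf rfl
  obtain ⟨ι', _, g', hg', ho', hs'⟩ := ih _ (hlt (e - f) hd (by rw [mul_sub, hee, hef])
    (fun h => hf0 (by simpa using h))) (sub_mem heD hfD) hd rfl
  have hff : f * f = f := hf.isIdempotentElem
  have h1 : ∀ i j, g i * g' j = 0 := by
    intro i j
    have a1 := mul_sum_of_orthogonal (fun i => (hg i).proj) ho i
    have a2 := mul_sum_of_orthogonal (fun i => (hg' i).proj) ho' j
    rw [hs] at a1
    rw [hs'] at a2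
    have a3 := isStarProjection_mul_left hd (hg' j).proj a2
    rw [← a1, ← a3, mul_assoc, ← mul_assoc f, mul_sub, hff, hfe', sub_self, zero_mul, mul_zero]
  refine ⟨ι ⊕ ι', inferInstance, Sum.elim g g', ?_, ?_, ?_⟩
  · rintro (i | i)
    exacts [hg i, hg' i]
  · rintro (i | i) (j | j) hij
    · exact ho i j (fun h => hij (by rw [h]))
    · exact h1 i j
    · have := congrArg star (h1 j i)
      rw [star_mul, (hg j).proj.isSelfAdjoint.star_eq, (hg' i).proj.isSelfAdjoint.star_eq,
        star_zero] at this
      exact this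
    · exact ho' i j (fun h => hij (by rw [h]))
  · simp [hs, hs']

end FiniteDimensional

end AFAlg

namespace AFAlg

/-! ### Matrix units -/

section Systems

variable {M : Type*} [CStarAlgebra M]

/-- The C*-identity: (ev - v)(ev - v)* expands to 0. -/
theorem mul_of_mul_star_eq {e v : M} (he : IsStarProjection e) (h : v * star v = e) :
    e * v = v := by
  have hee : e * e = e := he.isIdempotentElem
  have hes : star e = e := he.isSelfAdjoint
  have h3 : (e * v - v) * star (e * v - v) = 0 := by
    have e1 : star (e * v - v) = star v * e - star v := by rw [star_sub, star_mul, hes]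
    have e2 : (e * v - v) * (star v * e - star v)
        = e * (v * star v) * e - e * (v * star v) - (v * star v) * e + v * star v := by
      noncomm_ring
    rw [e1, e2, h, hee, hee]
    simp
  rwa [CStarRing.mul_star_self_eq_zero_iff, sub_eq_zero] at h3

theorem mul_of_star_mul_eq {f v : M} (hf : IsStarProjection f) (h : star v * v = f) :
    v * f = v := by
  have h3 := congrArg star (mul_of_mul_star_eq (v := star v) hf (by rw [star_star, h]))
  rwa [star_mul, star_star, hf.isSelfAdjoint.star_eq] at h3

theorem nonneg_of_smul_eq_mul_star {e y : M} (he : IsStarProjection e) (he0 : e ≠ 0) {c : ℂ}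
    (h : y * star y = c • e) : ∃ s : ℝ, 0 ≤ s ∧ c = s := by
  let _ := CStarAlgebra.spectralOrder M
  let _ := CStarAlgebra.spectralOrderedRing M
  have hes : star e = e := he.isSelfAdjoint
  have hy : 0 ≤ y * star y := mul_star_self_nonneg y
  have he1 : 0 ≤ e := by
    have := mul_star_self_nonneg e
    rwa [hes, he.isIdempotentElem.eq] at this
  have h1 : star c = c := by
    have h2 := congrArg star h
    rw [star_mul, star_star, star_smul, hes, h, ← sub_eq_zero, ← sub_smul] at h2
    rcases smul_eq_zero.1 h2 with h3 | h3
    · exact (sub_eq_zero.1 h3).symm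
    · exact absurd h3 he0
  obtain ⟨s, hs⟩ := Complex.conj_eq_iff_real.1 h1
  refine ⟨s, ?_, hs⟩
  by_contra! hneg
  rw [h, hs, Complex.coe_smul] at hy
  have h2 : s • e ≤ 0 := smul_nonpos_of_nonpos_of_nonneg hneg.le he1
  have h3 := le_antisymm h2 hy
  rcases smul_eq_zero.1 h3 with h4 | h4
  · exact hneg.ne h4
  · exact he0 h4

/-- A Schur-type dichotomy. For y = exf ≠ 0, minimality gives yy* = ce and y*y = df; then cy = yy*y
= dy forces c = d, a positive real s, and y/√s is the partial isometry. -/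
theorem IsMinProj.disjoint_or_equiv {D : NonUnitalStarSubalgebra ℂ M} {e f : M}
    (he : IsMinProj D e) (hf : IsMinProj D f) :
    (∀ x ∈ D, e * x * f = 0) ∨ ∃ v ∈ D, v * star v = e ∧ star v * v = f := by
  by_cases hx : ∀ x ∈ D, e * x * f = 0
  · exact Or.inl hx
  right
  push Not at hx
  obtain ⟨x, hxD, hy0⟩ := hx
  set y := e * x * f with hy
  have hyD : y ∈ D := mul_mem (mul_mem he.mem hxD) hf.mem
  have hes : star e = e := he.proj.isSelfAdjoint
  have hfs : star f = f := hf.proj.isSelfAdjoint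
  have hee : e * e = e := he.proj.isIdempotentElem
  have hff : f * f = f := hf.proj.isIdempotentElem
  obtain ⟨c, hc⟩ := he.corner (x * f * star x) (mul_mem (mul_mem hxD hf.mem) (star_mem hxD))
  obtain ⟨d, hd⟩ := hf.corner (star x * e * x) (mul_mem (mul_mem (star_mem hxD) he.mem) hxD)
  have hc1 : y * star y = c • e := by
    rw [← hc, hy]
    simp only [star_mul, hes, hfs, mul_assoc]
    rw [← mul_assoc f f, hff]
  have hd1 : star y * y = d • f := by
    rw [← hd, hy]
    simp only [star_mul, hes, hfs, mul_assoc]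
    rw [← mul_assoc e e, hee]
  have hey : e * y = y := by rw [hy, ← mul_assoc, ← mul_assoc, hee]
  have hyf : y * f = y := by rw [hy, mul_assoc, hff]
  have hcd : c = d := by
    have h1 : c • y = d • y := by
      calc c • y = (c • e) * y := by rw [smul_mul_assoc, hey]
        _ = y * (d • f) := by rw [← hc1, mul_assoc, hd1]
        _ = d • y := by rw [mul_smul_comm, hyf]
    rw [← sub_eq_zero, ← sub_smul] at h1
    rcases smul_eq_zero.1 h1 with h3 | h3
    · exact sub_eq_zero.1 h3
    · exact absurd h3 hy0
  obtain ⟨s, hs0, hs⟩ := nonneg_of_smul_eq_mul_star he.proj he.ne_zero hc1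
  have hs1 : s ≠ 0 := by
    rintro rfl
    rw [hs] at hc1
    simp only [Complex.ofReal_zero, zero_smul, CStarRing.mul_star_self_eq_zero_iff] at hc1
    exact hy0 hc1
  have hcc : ((Real.sqrt s : ℂ))⁻¹ * (((Real.sqrt s : ℂ))⁻¹ * (s : ℂ)) = 1 := by
    have h1 : (Real.sqrt s : ℂ) * Real.sqrt s = s := by
      rw [← Complex.ofReal_mul, Real.mul_self_sqrt hs0]
    have h2 : (Real.sqrt s : ℂ) ≠ 0 := by
      intro h0
      rw [h0] at h1
      simp at h1
      exact hs1 (by exact_mod_cast h1.symm)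
    rw [← h1]
    field_simp
  refine ⟨((Real.sqrt s : ℂ)⁻¹) • y, SMulMemClass.smul_mem _ hyD, ?_, ?_⟩
  · rw [star_smul, smul_mul_smul_comm, hc1, smul_smul, hs]
    have : star ((Real.sqrt s : ℂ)⁻¹) = (Real.sqrt s : ℂ)⁻¹ := by simp
    rw [this, mul_assoc, hcc, one_smul]
  · rw [star_smul, smul_mul_smul_comm, hd1, smul_smul, ← hcd, hs]
    have : star ((Real.sqrt s : ℂ)⁻¹) = (Real.sqrt s : ℂ)⁻¹ := by simp
    rw [this, mul_assoc, hcc, one_smul]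

/-- Partial isometries `v i` with orthogonal ranges summing to `p` and with source projection
`h (r i)`; the products `v i * star (v j)` with `r i = r j` form a system of matrix units. -/
structure IsSystem {ι κ : Type*} [Fintype ι] (p : M) (r : ι → κ) (v : ι → M) (h : κ → M) :
    Prop where
  source : ∀ i, star (v i) * v i = h (r i)
  orth : ∀ i j, i ≠ j → star (v i) * v j = 0
  mul_h : ∀ i, v i * h (r i) = v i
  sum : ∑ i, v i * star (v i) = p

namespace IsSystem

variable {ι κ : Type*} [Fintype ι] {p : M} {r : ι → κ} {v : ι → M} {h : κ → M}

theorem h_mul (S : IsSystem p r v h) (i : ι) : h (r i) * star (v i) = star (v i) := by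
  have h1 : star (h (r i)) = h (r i) := by rw [← S.source, star_mul, star_star]
  have := congrArg star (S.mul_h i)
  rwa [star_mul, h1] at this

theorem p_mul (S : IsSystem p r v h) (i : ι) : p * v i = v i := by
  classical
  rw [← S.sum, Finset.sum_mul, Finset.sum_eq_single i]
  · rw [mul_assoc, S.source, S.mul_h]
  · intro j _ hj
    rw [mul_assoc, S.orth j i hj, mul_zero]
  · simp

theorem p_star (S : IsSystem p r v h) : star p = p := by
  rw [← S.sum, star_sum]
  simp

theorem mul_p (S : IsSystem p r v h) (i : ι) : star (v i) * p = star (v i) := by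
  have := congrArg star (S.p_mul i)
  rwa [star_mul, S.p_star] at this

theorem isStarProjection (S : IsSystem p r v h) : IsStarProjection p := by
  refine ⟨?_, S.p_star⟩
  change p * p = p
  conv_lhs => rw [← S.sum, mul_assoc_sum_p S]
  exact S.sum
where
  mul_assoc_sum_p (S : IsSystem p r v h) :
      (∑ i, v i * star (v i)) * ∑ i, v i * star (v i) = ∑ i, v i * star (v i) := by
    rw [S.sum, ← S.sum, Finset.sum_mul]
    refine Finset.sum_congr rfl fun i _ => ?_
    rw [S.sum, mul_assoc, S.mul_p]

/-- The matrix units of a system. -/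
def units (r : ι → κ) (v : ι → M) : Set M := {x | ∃ i j, r i = r j ∧ x = v i * star (v j)}

theorem units_finite (r : ι → κ) (v : ι → M) : (units r v).Finite := by
  refine (Set.finite_range fun ij : ι × ι => v ij.1 * star (v ij.2)).subset ?_
  rintro _ ⟨i, j, -, rfl⟩
  exact ⟨(i, j), rfl⟩

theorem unit_mul (S : IsSystem p r v h) {i j k l : ι} (hij : r i = r j) :
    v i * star (v j) * (v k * star (v l)) = v i * star (v l) ∧ j = k ∨
    v i * star (v j) * (v k * star (v l)) = 0 := by
  by_cases hjk : j = k
  · left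
    subst hjk
    refine ⟨?_, rfl⟩
    rw [mul_assoc, ← mul_assoc (star (v j)), S.source, ← mul_assoc, ← hij, S.mul_h]
  · right
    rw [mul_assoc, ← mul_assoc (star (v j)), S.orth j k hjk, zero_mul, mul_zero]

/-- The *-subalgebra spanned by the matrix units of a system. -/
noncomputable def alg (S : IsSystem p r v h) : NonUnitalStarSubalgebra ℂ M where
  __ := Submodule.span ℂ (units r v)
  mul_mem' := by
    intro a b ha hb
    change a * b ∈ Submodule.span ℂ (units r v)
    change a ∈ Submodule.span ℂ (units r v) at ha
    change b ∈ Submodule.span ℂ (units r v) at hb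
    induction ha, hb using Submodule.span_induction₂ with
    | mem_mem x y hx hy =>
      obtain ⟨i, j, hij, rfl⟩ := hx
      obtain ⟨k, l, hkl, rfl⟩ := hy
      rcases S.unit_mul (k := k) (l := l) hij with ⟨h1, rfl⟩ | h1
      · rw [h1]; exact Submodule.subset_span ⟨i, l, hij.trans hkl, rfl⟩
      · rw [h1]; exact zero_mem _
    | zero_left y hy => rw [zero_mul]; exact zero_mem _
    | zero_right y hy => rw [mul_zero]; exact zero_mem _
    | add_left x y z _ _ _ h1 h2 => rw [add_mul]; exact add_mem h1 h2
    | add_right x y z _ _ _ h1 h2 => rw [mul_add]; exact add_mem h1 h2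
    | smul_left c x y _ _ h1 => rw [smul_mul_assoc]; exact Submodule.smul_mem _ _ h1
    | smul_right c x y _ _ h1 => rw [mul_smul_comm]; exact Submodule.smul_mem _ _ h1
  star_mem' := by
    intro a ha
    change star a ∈ Submodule.span ℂ (units r v)
    change a ∈ Submodule.span ℂ (units r v) at ha
    induction ha using Submodule.span_induction with
    | mem x hx =>
      obtain ⟨i, j, hij, rfl⟩ := hx
      rw [star_mul, star_star]
      exact Submodule.subset_span ⟨j, i, hij.symm, rfl⟩
    | zero => rw [star_zero]; exact zero_mem _
    | add x y _ _ h1 h2 => rw [star_add]; exact add_mem h1 h2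
    | smul c x _ h1 => rw [star_smul]; exact Submodule.smul_mem _ _ h1

theorem mem_alg (S : IsSystem p r v h) {x : M} : x ∈ S.alg ↔ x ∈ Submodule.span ℂ (units r v) :=
  Iff.rfl

instance (S : IsSystem p r v h) : FiniteDimensional ℂ S.alg :=
  FiniteDimensional.span_of_finite ℂ (units_finite r v)

theorem unit_mem_alg (S : IsSystem p r v h) {i j : ι} (hij : r i = r j) :
    v i * star (v j) ∈ S.alg := Submodule.subset_span ⟨i, j, hij, rfl⟩

theorem p_mem_alg (S : IsSystem p r v h) : p ∈ S.alg := by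
  have : ∑ i, v i * star (v i) ∈ S.alg := sum_mem fun i _ => S.unit_mem_alg rfl
  rwa [S.sum] at this

theorem p_mul_of_mem (S : IsSystem p r v h) {x : M} (hx : x ∈ S.alg) : p * x = x := by
  rw [mem_alg] at hx
  induction hx using Submodule.span_induction with
  | mem x hx =>
    obtain ⟨i, j, -, rfl⟩ := hx
    rw [← mul_assoc, S.p_mul]
  | zero => simp
  | add x y _ _ h1 h2 => rw [mul_add, h1, h2]
  | smul c x _ h1 => rw [mul_smul_comm, h1]

end IsSystem

theorem mul_right_of_unit {D : NonUnitalStarSubalgebra ℂ M} {p : M} (hp : star p = p)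
    (hpD : ∀ x ∈ D, p * x = x) {x : M} (hx : x ∈ D) : x * p = x := by
  have := congrArg star (hpD _ (star_mem hx))
  rwa [star_mul, star_star, hp] at this

/-- A finite-dimensional *-subalgebra is spanned by the matrix units of a system. -/
theorem exists_system (D : NonUnitalStarSubalgebra ℂ M) [FiniteDimensional ℂ D] {p : M}
    (hp : IsStarProjection p) (hpm : p ∈ D) (hpD : ∀ x ∈ D, p * x = x) :
    ∃ (ι : Type) (_ : Fintype ι) (r : ι → ι) (v h : ι → M), ∃ S : IsSystem p r v h,
      S.alg = D ∧ (∀ i, v i ∈ D) ∧ (∀ i, IsMinProj D (h i)) ∧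
      (∀ i, IsMinProj D (v i * star (v i))) ∧
      (∀ i, v (r i) * star (v (r i)) = h (r i)) ∧
      (∀ i j, r i ≠ r j → ∀ x ∈ D, v i * star (v i) * x * (v j * star (v j)) = 0) := by
  classical
  obtain ⟨ι, _, g, hg, ho, hs⟩ := exists_decomposition D hpm hp
  have hgg : ∀ i, g i * g i = g i := fun i => (hg i).proj.isIdempotentElem
  have hgs : ∀ i, star (g i) = g i := fun i => (hg i).proj.isSelfAdjoint
  let R : Setoid ι :=
    { r := fun i j => ∃ v ∈ D, v * star v = g i ∧ star v * v = g j
      iseqv :=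
        { refl := fun i => ⟨g i, (hg i).mem, by rw [hgs, hgg], by rw [hgs, hgg]⟩
          symm := fun {i j} ⟨v, hv, h1, h2⟩ =>
            ⟨star v, star_mem hv, by rw [star_star, h2], by rw [star_star, h1]⟩
          trans := fun {i j k} ⟨v, hv, h1, h2⟩ ⟨w, hw, h3, h4⟩ => by
            refine ⟨v * w, mul_mem hv hw, ?_, ?_⟩
            · rw [star_mul, mul_assoc, ← mul_assoc w, h3, ← mul_assoc,
                mul_of_star_mul_eq (hg j).proj h2, h1]
            · rw [star_mul, mul_assoc, ← mul_assoc (star v), h2,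
                mul_of_mul_star_eq (hg j).proj h3, h4] } }
  -- The index `r i` is a chosen representative of the equivalence class of `g i`, so all members of
  -- a class share one source projection. Distinct classes are the simple blocks of D.
  let r : ι → ι := fun i => (Quotient.mk R i).out
  have hr : ∀ i, ∃ v ∈ D, v * star v = g i ∧ star v * v = g (r i) := fun i =>
    R.iseqv.symm (Quotient.mk_out (s := R) i)
  choose v hvD hv1 hv2 using hr
  have hv3 : ∀ i, v i * g (r i) = v i := fun i => mul_of_star_mul_eq (hg _).proj (hv2 i)
  have hv4 : ∀ i, g i * v i = v i := fun i => mul_of_mul_star_eq (hg _).proj (hv1 i)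
  have hv5 : ∀ i, star (v i) * g i = star (v i) := fun i => by
    have := congrArg star (hv4 i)
    rwa [star_mul, hgs] at this
  have hrr : ∀ i, r (r i) = r i := by
    intro i
    simp only [r, Quotient.out_eq]
  let S : IsSystem p r v g :=
    { source := hv2
      orth := fun i j hij => by
        rw [← hv4 j, ← hv5 i, mul_assoc, ← mul_assoc (g i), ho i j hij, zero_mul, mul_zero]
      mul_h := hv3
      sum := by simp_rw [hv1]; exact hs }
  have hdis : ∀ i j, r i ≠ r j → ∀ x ∈ D, g i * x * g j = 0 := by
    intro i j hij
    rcases (hg i).disjoint_or_equiv (hg j) with h | h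
    · exact h
    · exact absurd (congrArg Quotient.out (Quotient.sound (s := R) h)) hij
  refine ⟨ι, inferInstance, r, v, g, S, ?_, hvD, hg, ?_, ?_, ?_⟩
  · apply le_antisymm
    · intro x hx
      have hle : Submodule.span ℂ (IsSystem.units r v) ≤ D.toSubmodule := by
        rw [Submodule.span_le]
        rintro _ ⟨i, j, -, rfl⟩
        exact show v i * star (v j) ∈ D from mul_mem (hvD i) (star_mem (hvD j))
      exact hle hx
    · intro x hx
      -- Peirce decomposition: each g_i x g_j vanishes across classes, and within a class it is a
      -- scalar multiple of the matrix unit v_i v_j*.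
      have hx1 : x = ∑ i, ∑ j, g i * x * g j := by
        conv_lhs => rw [← hpD x hx, ← mul_right_of_unit hp.isSelfAdjoint hpD hx, ← hs]
        rw [Finset.sum_mul]
        refine Finset.sum_congr rfl fun i _ => ?_
        rw [Finset.mul_sum, Finset.mul_sum]
        exact Finset.sum_congr rfl fun j _ => by rw [mul_assoc]
      rw [hx1]
      refine sum_mem fun i _ => sum_mem fun j _ => ?_
      by_cases hij : r i = r j
      · obtain ⟨c, hc⟩ := (hg (r i)).corner (star (v i) * x * v j)
          (mul_mem (mul_mem (star_mem (hvD i)) hx) (hvD j))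
        have : g i * x * g j = c • (v i * star (v j)) := by
          calc g i * x * g j = v i * star (v i) * x * (v j * star (v j)) := by rw [hv1, hv1]
            _ = (v i * g (r i)) * star (v i) * x * ((v j * g (r j)) * star (v j)) := by
                rw [hv3, hv3]
            _ = v i * (g (r i) * (star (v i) * x * v j) * g (r i)) * star (v j) := by
                rw [hij]; simp only [mul_assoc]
            _ = c • (v i * g (r i) * star (v j)) := by
                rw [hc, mul_smul_comm, smul_mul_assoc]
            _ = _ := by rw [hv3]
        rw [this]
        exact SMulMemClass.smul_mem _ (S.unit_mem_alg hij)
      · rw [hdis i j hij x hx]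
        exact zero_mem _
  · intro i; rw [hv1]; exact hg i
  · intro i; rw [hv1]
  · intro i j hij x hx
    rw [hv1, hv1]
    exact hdis i j hij x hx

end Systems

end AFAlg

namespace AFAlg

/-! ### Comparison of projections in a finite-dimensional algebra -/

section Comparison

variable {M : Type*} [CStarAlgebra M]

theorem norm_isStarProjection {e : M} (he : IsStarProjection e) (he0 : e ≠ 0) : ‖e‖ = 1 := by
  have h := CStarRing.norm_star_mul_self (x := e)
  rw [he.isSelfAdjoint.star_eq, he.isIdempotentElem.eq] at h
  have : ‖e‖ ≠ 0 := norm_ne_zero_iff.2 he0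
  exact mul_left_cancel₀ this (by rw [← h, mul_one])

/-- The functional giving the scalar part of `e * x * e` for a minimal projection `e`. -/
theorem IsMinProj.exists_functional {D : NonUnitalStarSubalgebra ℂ M} {e : M}
    (he : IsMinProj D e) : ∃ l : M →L[ℂ] ℂ, ‖l‖ ≤ 1 ∧ l e = 1 ∧
      (∀ x, l (e * x * e) = l x) ∧ ∀ x ∈ D, e * x * e = l x • e := by
  have h1 := norm_isStarProjection he.proj he.ne_zero
  have hee : e * e = e := he.proj.isIdempotentElem
  -- A Hahn–Banach functional norming e, composed below with the compression x ↦ exe.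
  obtain ⟨ψ, hψ, hψe⟩ := exists_dual_vector ℂ e (by rw [h1]; exact one_ne_zero)
  refine ⟨ψ.comp (ContinuousLinearMap.mulLeftRight ℂ M e e), ?_, ?_, ?_, ?_⟩
  · refine (ContinuousLinearMap.opNorm_comp_le _ _).trans ?_
    rw [hψ, one_mul]
    refine (ContinuousLinearMap.opNorm_mulLeftRight_apply_apply_le ℂ M e e).trans ?_
    rw [h1, one_mul]
  · simp [hee, hψe, h1]
  · intro x
    simp only [ContinuousLinearMap.comp_apply, ContinuousLinearMap.mulLeftRight_apply]
    congr 1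
    rw [mul_assoc, mul_assoc _ e e, hee, ← mul_assoc, ← mul_assoc, hee]
  · intro x hx
    obtain ⟨c, hc⟩ := he.corner x hx
    simp [hc, hψe, h1]

theorem exists_injective_of_card_fiber_le {α β κ : Type*} [Fintype α] [Fintype β] [DecidableEq κ]
    (s : α → κ) (t : β → κ)
    (h : ∀ k, Fintype.card {a // s a = k} ≤ Fintype.card {b // t b = k}) :
    ∃ f : α → β, Function.Injective f ∧ ∀ a, t (f a) = s a := by
  have F := fun k => Classical.choice (Function.Embedding.nonempty_of_card_le (h k))
  refine ⟨fun a => (F (s a) ⟨a, rfl⟩).1, ?_, fun a => (F (s a) ⟨a, rfl⟩).2⟩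
  have key : ∀ k (x y : α) (hx : s x = k) (hy : s y = k),
      (F k ⟨x, hx⟩).1 = (F k ⟨y, hy⟩).1 → x = y := by
    intro k x y hx hy hxy
    have := (F k).injective (Subtype.ext hxy)
    exact congrArg Subtype.val this
  intro x y hxy
  have h1 : s y = s x := by
    rw [← (F (s x) ⟨x, rfl⟩).2, ← (F (s y) ⟨y, rfl⟩).2]
    exact congrArg t hxy.symm
  refine key (s x) x y rfl h1 ?_
  refine Eq.trans hxy ?_
  have : ∀ k (hk : s y = k), (F (s y) ⟨y, rfl⟩).1 = (F k ⟨y, hk⟩).1 := by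
    rintro _ rfl; rfl
  exact this _ h1

/-- In a finite-dimensional *-algebra, a projection that is not subequivalent to another one
is larger in some tracial state. -/
theorem exists_subequiv_or_trace (D : NonUnitalStarSubalgebra ℂ M) [FiniteDimensional ℂ D] {p : M}
    (hp : IsStarProjection p) (hpm : p ∈ D) (hpD : ∀ x ∈ D, p * x = x) {e f : M}
    (heD : e ∈ D) (hfD : f ∈ D) (he : IsStarProjection e) (hf : IsStarProjection f) :
    (∃ v ∈ D, v * star v = e ∧ v * f = v ∧ IsStarProjection (star v * v)) ∨
    ∃ τ : M →L[ℂ] ℂ, ‖τ‖ ≤ 1 ∧ τ p = 1 ∧ (∀ x ∈ D, ∀ y ∈ D, τ (x * y) = τ (y * x)) ∧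
      (∀ x ∈ D, 0 ≤ (τ (star x * x)).re ∧ (τ (star x * x)).im = 0) ∧
      (τ f).re < (τ e).re := by
  classical
  obtain ⟨ι, _, r, v, h, S, hSD, hvD, hh, hg, hrh, hdis⟩ := exists_system D hp hpm hpD
  obtain ⟨α, _, e', he', heo, hes⟩ := exists_decomposition D heD he
  obtain ⟨β, _, f', hf', hfo, hfs⟩ := exists_decomposition D hfD hf
  let g : ι → M := fun i => v i * star (v i)
  have hgg : ∀ i, g i * g i = g i := fun i => (hg i).proj.isIdempotentElem
  have hgs : ∀ i, star (g i) = g i := fun i => (hg i).proj.isSelfAdjoint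
  have hgD : ∀ i, g i ∈ D := fun i => (hg i).mem
  have hsum : ∑ i, g i = p := S.sum
  -- every minimal projection is equivalent to one of the `h (r i)`
  have hcl : ∀ m, IsMinProj D m → ∃ i, ∃ w ∈ D, w * star w = m ∧ star w * w = h (r i) := by
    intro m hm
    by_contra! hcon
    apply hm.ne_zero
    have h1 : m * p = m := mul_right_of_unit hp.isSelfAdjoint hpD hm.mem
    rw [← h1, ← hsum, Finset.mul_sum]
    refine Finset.sum_eq_zero fun i _ => ?_
    rcases hm.disjoint_or_equiv (hg i) with h2 | ⟨w, hw, h2, h3⟩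
    · have := h2 m hm.mem
      rwa [hm.proj.isIdempotentElem.eq] at this
    · refine absurd ?_ (hcon i (w * v i) (mul_mem hw (hvD i)) ?_)
      · rw [star_mul, mul_assoc, ← mul_assoc (star w), h3]
        rw [show v i * star (v i) * v i = v i by rw [mul_assoc, S.source, S.mul_h], S.source]
      · rw [star_mul, mul_assoc, ← mul_assoc (v i), ← h3]
        rw [← mul_assoc, ← mul_assoc, h2, mul_assoc, h2, hm.proj.isIdempotentElem.eq]
  choose ce we hweD hwe1 hwe2 using fun a => hcl (e' a) (he' a)
  choose cf wf hwfD hwf1 hwf2 using fun b => hcl (f' b) (hf' b)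
  -- In each class, count the minimal summands of e and of f. If e never has more, matching them
  -- injectively and adding the partial isometries embeds e in f. If e has more in some class k, the
  -- normalized trace of the block k separates them.
  by_cases hcard : ∀ k, Fintype.card {a // r (ce a) = k} ≤ Fintype.card {b // r (cf b) = k}
  · left
    obtain ⟨σ, hσ, hσr⟩ := exists_injective_of_card_fiber_le (fun a => r (ce a))
      (fun b => r (cf b)) hcard
    let w : α → M := fun a => we a * star (wf (σ a))
    have e1 : ∀ a, we a * h (r (ce a)) = we a := fun a => mul_of_star_mul_eq (hh _).proj (hwe2 a)
    have e2 : ∀ b, wf b * h (r (cf b)) = wf b := fun a => mul_of_star_mul_eq (hh _).proj (hwf2 a)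
    have w1 : ∀ a, w a * star (w a) = e' a := by
      intro a
      simp only [w, star_mul, star_star]
      rw [mul_assoc, ← mul_assoc (star (wf (σ a))), hwf2, hσr, ← mul_assoc, e1, hwe1]
    have w2 : ∀ a, star (w a) * w a = f' (σ a) := by
      intro a
      simp only [w, star_mul, star_star]
      rw [mul_assoc, ← mul_assoc (star (we a)), hwe2, ← hσr, ← mul_assoc, e2, hwf1]
    have w3 : ∀ a, w a * f' (σ a) = w a := fun a => mul_of_star_mul_eq (hf' _).proj (w2 a)
    have w4 : ∀ a, e' a * w a = w a := fun a => mul_of_mul_star_eq (he' _).proj (w1 a)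
    have w5 : ∀ a, f' (σ a) * star (w a) = star (w a) := fun a => by
      have := congrArg star (w3 a)
      rwa [star_mul, (hf' _).proj.isSelfAdjoint.star_eq] at this
    have hvv : (∑ a, w a) * star (∑ a, w a) = e := by
      rw [star_sum, Finset.sum_mul, ← hes]
      refine Finset.sum_congr rfl fun a _ => ?_
      rw [Finset.mul_sum, Finset.sum_eq_single a _ (by simp)]
      · exact w1 a
      · intro a' _ ha'
        rw [← w3 a, ← w5 a', mul_assoc, ← mul_assoc (f' (σ a)),
          hfo _ _ (fun hh => ha' (hσ hh.symm)), zero_mul, mul_zero]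
    refine ⟨∑ a, w a, sum_mem fun a _ => mul_mem (hweD a) (star_mem (hwfD _)), hvv, ?_, ?_⟩
    · rw [Finset.sum_mul]
      refine Finset.sum_congr rfl fun a _ => ?_
      have := mul_sum_of_orthogonal (fun b => (hf' b).proj) hfo (σ a)
      rw [hfs] at this
      rw [← w3 a, mul_assoc, this]
    · refine ⟨?_, by rw [isSelfAdjoint_iff, star_mul, star_star]⟩
      have := mul_of_mul_star_eq he hvv
      change _ * _ = _
      rw [mul_assoc, ← mul_assoc (∑ a, w a), hvv, this]
  · right
    push Not at hcard
    obtain ⟨k, hk⟩ := hcard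
    choose l hl1 hle hlx hlD using fun i => (hg i).exists_functional
    -- The diagonal units of the block k. The sum T of their functionals is on D the unnormalized
    -- trace of that block, with T p equal to the number of these units; this explains the
    -- normalization at the end.
    let I : Finset ι := Finset.univ.filter fun i => r i = k
    have hI : ∀ i, i ∈ I ↔ r i = k := fun i => by simp [I]
    obtain ⟨a0⟩ : Nonempty {a // r (ce a) = k} := by
      rw [← Fintype.card_pos_iff]; omega
    have hIne : I.Nonempty := ⟨ce a0, by rw [hI]; exact a0.2⟩
    have hn : (0 : ℝ) < I.card := by exact_mod_cast hIne.card_pos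
    have hn' : ((I.card : ℝ) : ℂ) ≠ 0 := by exact_mod_cast hn.ne'
    let T : M →L[ℂ] ℂ := ∑ i ∈ I, l i
    have hT : ∀ x, T x = ∑ i ∈ I, l i x := fun x => by simp [T]
    -- expansion of the products
    have hexp : ∀ i, ∀ x ∈ D, ∀ y ∈ D, l i (x * y) = ∑ j, l i (x * g j * y) := by
      intro i x hx y hy
      rw [← map_sum, ← Finset.sum_mul, ← Finset.mul_sum, hsum, mul_assoc, hpD y hy]
    have hzero : ∀ i j, r i ≠ r j → ∀ x ∈ D, ∀ y ∈ D, l i (x * g j * y) = 0 := by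
      intro i j hij x hx y hy
      rw [← hlx]
      have : g i * (x * g j * y) * g i = (g i * x * g j) * (y * g i) := by
        simp only [mul_assoc]
      rw [show v i * star (v i) = g i from rfl, this, hdis i j hij x hx, zero_mul, map_zero]
    have hscal : ∀ i j, r i = r j → ∀ x ∈ D, ∃ c : ℂ, g i * x * g j = c • (v i * star (v j)) := by
      intro i j hij x hx
      obtain ⟨c, hc⟩ := (hh (r i)).corner (star (v i) * x * v j)
        (mul_mem (mul_mem (star_mem (hvD i)) hx) (hvD j))
      refine ⟨c, ?_⟩
      calc g i * x * g j
          = (v i * h (r i)) * star (v i) * x * ((v j * h (r j)) * star (v j)) := by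
            rw [S.mul_h, S.mul_h]
        _ = v i * (h (r i) * (star (v i) * x * v j) * h (r i)) * star (v j) := by
            rw [hij]; simp only [mul_assoc]
        _ = c • (v i * h (r i) * star (v j)) := by
            rw [hc, mul_smul_comm, smul_mul_assoc]
        _ = _ := by rw [S.mul_h]
    have hvvj : ∀ i j, r i = r j → v i * star (v j) * (v j * star (v i)) = g i := by
      intro i j hij
      rw [mul_assoc, ← mul_assoc (star (v j)), S.source, ← mul_assoc, ← hij, S.mul_h]
    -- Both values equal the product of the two scalars by which g_i x g_j and g_j y g_i multiply
    -- their matrix units.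
    have hsymm : ∀ i j, r i = r j → ∀ x ∈ D, ∀ y ∈ D,
        l i (x * g j * y) = l j (y * g i * x) := by
      intro i j hij x hx y hy
      obtain ⟨c, hc⟩ := hscal i j hij x hx
      obtain ⟨d, hd⟩ := hscal j i hij.symm y hy
      have e1 : g i * (x * g j * y) * g i = (c * d) • g i := by
        calc g i * (x * g j * y) * g i = (g i * x * g j) * (g j * y * g i) := by
              conv_lhs => rw [← hgg j]
              simp only [mul_assoc]
          _ = _ := by rw [hc, hd, smul_mul_smul_comm, hvvj i j hij]
      have e2 : g j * (y * g i * x) * g j = (c * d) • g j := by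
        calc g j * (y * g i * x) * g j = (g j * y * g i) * (g i * x * g j) := by
              conv_lhs => rw [← hgg i]
              simp only [mul_assoc]
          _ = _ := by rw [hc, hd, smul_mul_smul_comm, hvvj j i hij.symm, mul_comm]
      have e3 := congrArg (l i) e1
      have e4 := congrArg (l j) e2
      rw [hlx i, map_smul, hle i] at e3
      rw [hlx j, map_smul, hle j] at e4
      rw [e3, e4]
    have hexp' : ∀ x ∈ D, ∀ y ∈ D, T (x * y) = ∑ i ∈ I, ∑ j ∈ I, l i (x * g j * y) := by
      intro x hx y hy
      rw [hT]
      refine Finset.sum_congr rfl fun i hi => ?_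
      rw [hexp i x hx y hy]
      symm
      refine Finset.sum_subset (Finset.subset_univ I) fun j _ hj => ?_
      rw [hI] at hi hj
      exact hzero i j (fun hh => hj (hh ▸ hi)) x hx y hy
    have htr : ∀ x ∈ D, ∀ y ∈ D, T (x * y) = T (y * x) := by
      intro x hx y hy
      rw [hexp' x hx y hy, hexp' y hy x hx, Finset.sum_comm]
      refine Finset.sum_congr rfl fun j hj => Finset.sum_congr rfl fun i hi => ?_
      rw [hI] at hi hj
      exact hsymm i j (hi.trans hj.symm) x hx y hy
    have hmin0 : ∀ i m (w : M), w ∈ D → w * star w = m → star w * w = h (r i) →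
        T m = if r i = k then 1 else 0 := by
      intro i m w hw h1 h2
      -- The trace property carries m = ww* to w*w = v_i*v_i and then to v_i v_i*, on which T is 1
      -- or 0 according to the block.
      rw [← h1, htr w hw _ (star_mem hw), h2, ← S.source, htr _ (star_mem (hvD i)) _ (hvD i), hT]
      have hother : ∀ j, j ≠ i → l j (v i * star (v i)) = 0 := by
        intro j hj
        rw [← hlx]
        have : v j * star (v j) * (v i * star (v i)) = 0 := by
          rw [mul_assoc, ← mul_assoc (star (v j)), S.orth j i hj, zero_mul, mul_zero]
        rw [this, zero_mul, map_zero]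
      split_ifs with hik
      · rw [Finset.sum_eq_single i (fun j _ hj => hother j hj)
          (fun hi => absurd ((hI i).2 hik) hi), hle]
      · refine Finset.sum_eq_zero fun j hj => hother j ?_
        rintro rfl
        exact hik ((hI _).1 hj)
    have hTe : T e = (Fintype.card {a // r (ce a) = k} : ℂ) := by
      rw [← hes, map_sum, Finset.sum_congr rfl fun a _ =>
        hmin0 (ce a) (e' a) (we a) (hweD a) (hwe1 a) (hwe2 a)]
      simp [Fintype.card_subtype]
    have hTf : T f = (Fintype.card {b // r (cf b) = k} : ℂ) := by
      rw [← hfs, map_sum, Finset.sum_congr rfl fun a _ =>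
        hmin0 (cf a) (f' a) (wf a) (hwfD a) (hwf1 a) (hwf2 a)]
      simp [Fintype.card_subtype]
    have hscale : ∀ z : ℂ, (((I.card : ℝ) : ℂ)⁻¹ * z).re = (I.card : ℝ)⁻¹ * z.re := by
      intro z
      rw [← Complex.ofReal_inv, Complex.re_ofReal_mul]
    have hscale' : ∀ z : ℂ, (((I.card : ℝ) : ℂ)⁻¹ * z).im = (I.card : ℝ)⁻¹ * z.im := by
      intro z
      rw [← Complex.ofReal_inv, Complex.im_ofReal_mul]
    refine ⟨((I.card : ℝ) : ℂ)⁻¹ • T, ?_, ?_, ?_, ?_, ?_⟩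
    · rw [norm_smul, norm_inv, Complex.norm_real, Real.norm_of_nonneg hn.le]
      have : ‖T‖ ≤ I.card := by
        refine (norm_sum_le _ _).trans ?_
        exact (Finset.sum_le_sum fun i _ => hl1 i).trans (by simp)
      rw [inv_mul_le_iff₀ hn, mul_one]
      exact this
    · rw [smul_apply, hT, smul_eq_mul]
      have : ∀ i ∈ I, l i p = 1 := by
        intro i _
        rw [← hlx, ← hle i]
        congr 1
        rw [show v i * star (v i) * p = v i * star (v i) by rw [mul_assoc, S.mul_p]]
        exact hgg i
      rw [Finset.sum_congr rfl this]
      simp only [Finset.sum_const, nsmul_eq_mul, mul_one]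
      exact inv_mul_cancel₀ (by exact_mod_cast hn')
    · intro x hx y hy
      rw [smul_apply, smul_apply, htr x hx y hy]
    · intro x hx
      have hpos : ∀ i, ∃ s : ℝ, 0 ≤ s ∧ l i (star x * x) = s := by
        intro i
        refine nonneg_of_smul_eq_mul_star (hg i).proj (hg i).ne_zero (y := g i * star x) ?_
        rw [← hlD i _ (mul_mem (star_mem hx) hx), star_mul, star_star, hgs i]
        simp only [g, mul_assoc]
      choose s hs0 hs using hpos
      rw [smul_apply, smul_eq_mul, hscale, hscale', hT,
        Finset.sum_congr rfl fun i _ => hs i, ← Complex.ofReal_sum]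
      refine ⟨mul_nonneg (inv_nonneg.2 hn.le) ?_, by simp⟩
      rw [Complex.ofReal_re]
      exact Finset.sum_nonneg fun i _ => hs0 i
    · rw [smul_apply, smul_apply, smul_eq_mul,
        smul_eq_mul, hscale, hscale, hTe, hTf]
      refine mul_lt_mul_of_pos_left ?_ (inv_pos.2 hn)
      simpa using hk

end Comparison

end AFAlg

namespace AFAlg

/-! ### Perturbation of projections and partial isometries -/

section Perturbation

variable {M : Type*} [CStarAlgebra M]

theorem norm_isStarProjection_le {e : M} (he : IsStarProjection e) : ‖e‖ ≤ 1 := by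
  by_cases h : e = 0
  · simp [h]
  · exact (norm_isStarProjection he h).le

/-- Polar decomposition inside D. The element a = w*w + (1 - f) is within distance less than 1 of
the identity, so r = a^(-1/2) exists in D, and v = wr satisfies v*v = f. Then P = vv* is a
subprojection of e fixing ww*, so ‖e - P‖ = ‖(e - P)(e - ww*)‖ < 1, which forces the projection e -
P to vanish. -/
theorem exists_equiv_of_near (D : StarSubalgebra ℂ M) (hD : IsClosed (D : Set M)) {e f w : M}
    (hfD : f ∈ D) (hwD : w ∈ D) (he : IsStarProjection e) (hf : IsStarProjection f)
    (hew : e * w = w) (hwf : w * f = w) (h1 : ‖e - w * star w‖ < 1) (h2 : ‖f - star w * w‖ < 1) :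
    ∃ v ∈ D, v * star v = e ∧ star v * v = f := by
  have hff : f * f = f := hf.isIdempotentElem
  have hfs : star f = f := hf.isSelfAdjoint
  have hes : star e = e := he.isSelfAdjoint
  have hfw : f * star w = star w := by
    have := congrArg star hwf
    rwa [star_mul, hfs] at this
  have hwe : star w * e = star w := by
    have := congrArg star hew
    rwa [star_mul, hes] at this
  set a := star w * w + (1 - f) with ha
  have haD : a ∈ D := add_mem (mul_mem (star_mem hwD) hwD) (sub_mem (one_mem D) hfD)
  have has : IsSelfAdjoint a := by
    rw [isSelfAdjoint_iff, ha]
    simp [hfs]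
  have haf : a * f = star w * w := by
    rw [ha, add_mul, sub_mul, one_mul, hff, sub_self, add_zero, mul_assoc, hwf]
  have hfa : f * a = star w * w := by
    rw [ha, mul_add, mul_sub, mul_one, hff, sub_self, add_zero, ← mul_assoc, hfw]
  have hna : ‖1 - a‖ < 1 := by
    rwa [show 1 - a = f - star w * w by rw [ha]; abel]
  have hpos : ∀ t ∈ spectrum ℝ a, 0 < t := by
    intro t ht
    have e1 : cfc (fun s : ℝ => 1 - s) a = 1 - a := by
      rw [cfc_sub (fun _ => 1) (fun s => s) a, cfc_const_one ℝ a, cfc_id' ℝ a]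
    have e2 := norm_apply_le_norm_cfc (fun s : ℝ => 1 - s) a ht
    rw [e1] at e2
    have e3 := (abs_lt.1 ((Real.norm_eq_abs _ ▸ e2).trans_lt hna)).2
    linarith
  have hcont : ContinuousOn (fun t : ℝ => (Real.sqrt t)⁻¹) (spectrum ℝ a) := by
    refine ContinuousOn.inv₀ (Real.continuous_sqrt.continuousOn) fun t ht => ?_
    exact (Real.sqrt_pos.2 (hpos t ht)).ne'
  set r := cfc (fun t : ℝ => (Real.sqrt t)⁻¹) a with hr
  have hrs : star r = r := cfc_predicate (R := ℝ) _ a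
  have hrD : r ∈ D := cfc_mem (hs := hD) _ haD
  have hrra : r * r * a = 1 := by
    have e1 : r * r * a = cfc (fun t : ℝ => (Real.sqrt t)⁻¹ * (Real.sqrt t)⁻¹ * t) a := by
      rw [cfc_mul (fun t : ℝ => (Real.sqrt t)⁻¹ * (Real.sqrt t)⁻¹) (fun t => t) a
        (hcont.mul hcont) continuousOn_id, cfc_mul _ _ a hcont hcont, cfc_id' ℝ a]
    rw [e1, ← cfc_one ℝ a]
    refine cfc_congr fun t ht => ?_
    have h3 := hpos t ht
    have h4 := Real.mul_self_sqrt h3.le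
    have h5 := (Real.sqrt_pos.2 h3).ne'
    simp only [Pi.one_apply]
    nth_rw 3 [← h4]
    field_simp
  have hrf : Commute r f := by
    have : Commute a f := haf.trans hfa.symm
    exact this.cfc_real _
  have hra : Commute r a := by
    exact (Commute.refl a).cfc_real _
  have hrar : r * a * r = 1 := by rw [mul_assoc, ← hra.eq, ← mul_assoc, hrra]
  have hvv : star (w * r) * (w * r) = f := by
    calc star (w * r) * (w * r) = r * (star w * w) * r := by
          rw [star_mul, hrs]; simp only [mul_assoc]
      _ = r * a * r * f := by rw [← haf]; simp only [mul_assoc]; rw [hrf.eq]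
      _ = f := by rw [hrar, one_mul]
  refine ⟨w * r, mul_mem hwD hrD, ?_, hvv⟩
  set P := w * r * star (w * r) with hP
  have hPe : P * e = P := by
    rw [hP, star_mul, hrs]; simp only [mul_assoc, hwe]
  have hvf : w * r * f = w * r := by rw [mul_assoc, hrf.eq, ← mul_assoc, hwf]
  have hPP : IsStarProjection P := by
    refine ⟨?_, by rw [isSelfAdjoint_iff, hP, star_mul, star_star]⟩
    change P * P = P
    rw [hP, mul_assoc, ← mul_assoc (star (w * r)), hvv, ← mul_assoc, hvf]
  have hPw : P * (w * star w) = w * star w := by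
    calc P * (w * star w) = w * (r * r * (star w * w)) * star w := by
          rw [hP, star_mul, hrs]; simp only [mul_assoc]
      _ = w * (r * r * a * f) * star w := by rw [← haf]; simp only [mul_assoc]
      _ = w * star w := by rw [hrra, one_mul, hwf]
  have hd : IsStarProjection (e - P) := hPP.sub_of_mul_eq_left he hPe
  by_contra hne
  have hd0 : e - P ≠ 0 := fun h => hne (sub_eq_zero.1 h).symm
  have hn := norm_isStarProjection hd hd0
  have heww : (e - P) * (w * star w) = 0 := by
    rw [sub_mul, hPw, ← mul_assoc, hew, sub_self]
  have h3 : e - P = (e - P) * (e - w * star w) := by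
    rw [mul_sub, heww, sub_zero, sub_mul, hPe, he.isIdempotentElem.eq]
  have h4 : ‖e - P‖ ≤ ‖e - P‖ * ‖e - w * star w‖ := by
    conv_lhs => rw [h3]
    exact norm_mul_le _ _
  rw [hn, one_mul] at h4
  linarith

/-- The self-adjoint part z of y almost satisfies z² = z, so its spectrum clusters at 0 and 1 and a
cutoff turns it into a projection q ∈ D with ‖q - e‖ < 1. Then eq is close enough to a partial
isometry for `exists_equiv_of_near` in the whole algebra. -/
theorem exists_projection_near (D : StarSubalgebra ℂ M) (hD : IsClosed (D : Set M)) {e y : M}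
    (he : IsStarProjection e) (hyD : y ∈ D) (hy : ‖y - e‖ ≤ 1 / 20) :
    ∃ q ∈ D, IsStarProjection q ∧ ∃ v : M, v * star v = e ∧ star v * v = q := by
  have hes : star e = e := he.isSelfAdjoint
  have hee : e * e = e := he.isIdempotentElem
  have he1 := norm_isStarProjection_le he
  obtain ⟨z, hzD, hz, hzs⟩ : ∃ z ∈ D, ‖z - e‖ ≤ 1 / 20 ∧ IsSelfAdjoint z := by
    refine ⟨(2⁻¹ : ℂ) • (y + star y), SMulMemClass.smul_mem _ (add_mem hyD (star_mem hyD)), ?_, ?_⟩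
    · have h1 : (2⁻¹ : ℂ) • (y + star y) - e = (2⁻¹ : ℂ) • ((y - e) + star (y - e)) := by
        rw [star_sub, hes, show y - e + (star y - e) = (y + star y) - (2 : ℂ) • e by
          rw [two_smul]; abel, smul_sub, smul_smul]
        norm_num
      rw [h1, norm_smul]
      have h2 := norm_add_le (y - e) (star (y - e))
      rw [norm_star] at h2
      have h3 : ‖(2⁻¹ : ℂ)‖ = 1 / 2 := by norm_num
      rw [h3]
      linarith
    · rw [isSelfAdjoint_iff, star_smul, star_add, star_star, add_comm]
      simp
  -- The terms of the expansion add up to 1/400 + 3/20 = 0.1525. Below, the bound 0.16 = 0.32 · 1/2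
  -- works because one of |t|, |1 - t| is at least 1/2.
  have hzz : ‖z * z - z‖ ≤ 0.16 := by
    have h1 : z * z - z = (z - e) * (z - e) + (z - e) * e + e * (z - e) - (z - e) := by
      simp only [sub_mul, mul_sub, hee]; abel
    rw [h1]
    have h2 : ‖(z - e) * (z - e)‖ ≤ 1 / 20 * (1 / 20) :=
      (norm_mul_le _ _).trans (mul_le_mul hz hz (norm_nonneg _) (by norm_num))
    have h3 : ‖(z - e) * e‖ ≤ 1 / 20 * 1 :=
      (norm_mul_le _ _).trans (mul_le_mul hz he1 (norm_nonneg _) (by norm_num))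
    have h4 : ‖e * (z - e)‖ ≤ 1 * (1 / 20) :=
      (norm_mul_le _ _).trans (mul_le_mul he1 hz (norm_nonneg _) (by norm_num))
    have h5 := norm_sub_le ((z - e) * (z - e) + (z - e) * e + e * (z - e)) (z - e)
    have h6 := norm_add_le ((z - e) * (z - e) + (z - e) * e) (e * (z - e))
    have h7 := norm_add_le ((z - e) * (z - e)) ((z - e) * e)
    norm_num at *
    linarith
  have hspec : ∀ t ∈ spectrum ℝ z, |t| ≤ 0.32 ∨ |1 - t| ≤ 0.32 := by
    intro t ht
    have e1 : cfc (fun s : ℝ => s * s - s) z = z * z - z := by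
      rw [cfc_sub (fun s => s * s) (fun s => s) z, cfc_mul (fun s => s) (fun s => s) z,
        cfc_id' ℝ z]
    have e2 := norm_apply_le_norm_cfc (fun s : ℝ => s * s - s) z ht
    rw [e1] at e2
    have e3 : |t| * |1 - t| ≤ 0.16 := by
      rw [← abs_mul, show t * (1 - t) = -(t * t - t) by ring, abs_neg]
      exact e2.trans hzz
    by_contra! hcon
    rcases le_total (1 / 2) |t| with h3 | h3
    · nlinarith [hcon.2, abs_nonneg (1 - t)]
    · have h4 : (1 : ℝ) / 2 ≤ |1 - t| := by
        have := abs_sub_abs_le_abs_sub 1 t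
        rw [abs_one] at this
        linarith
      nlinarith [hcon.1, abs_nonneg t]
  -- Piecewise linear, equal to 0 up to 0.32 and to 1 from 0.68 on, hence an idempotent function on
  -- the spectrum that moves no spectral value by more than 0.32.
  let g : ℝ → ℝ := fun t => max 0 (min 1 ((t - 0.32) / 0.36))
  have hg : Continuous g := by fun_prop
  have hg1 : ∀ t, |t| ≤ 0.32 → g t = 0 := by
    intro t ht
    have := (abs_le.1 ht).2
    apply max_eq_left
    refine (min_le_right _ _).trans ?_
    apply div_nonpos_of_nonpos_of_nonneg <;> linarith
  have hg2 : ∀ t, |1 - t| ≤ 0.32 → g t = 1 := by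
    intro t ht
    have := (abs_le.1 ht).2
    have h1 : min 1 ((t - 0.32) / 0.36) = 1 := by
      apply min_eq_left
      rw [le_div_iff₀ (by norm_num)]
      linarith
    simp only [g, h1]
    norm_num
  have hqp : IsStarProjection (cfc g z) := by
    refine ⟨?_, cfc_predicate g z⟩
    change cfc g z * cfc g z = cfc g z
    rw [← cfc_mul g g z hg.continuousOn hg.continuousOn]
    refine cfc_congr fun t ht => ?_
    rcases hspec t ht with h1 | h1
    · simp [hg1 t h1]
    · simp [hg2 t h1]
  have hqD : cfc g z ∈ D := cfc_mem (hs := hD) g hzD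
  set q := cfc g z with hq
  have hqz : ‖q - z‖ ≤ 0.32 := by
    have e1 : q - z = cfc (fun t => g t - t) z := by
      rw [cfc_sub g (fun s => s) z hg.continuousOn, cfc_id' ℝ z]
    rw [e1]
    refine norm_cfc_le (by norm_num) fun t ht => ?_
    rw [Real.norm_eq_abs]
    rcases hspec t ht with h1 | h1
    · rw [hg1 t h1, zero_sub, abs_neg]; exact h1
    · rw [hg2 t h1]; exact h1
  have hqe : ‖q - e‖ < 1 := by
    have := norm_add_le (q - z) (z - e)
    rw [sub_add_sub_cancel] at this
    norm_num at *
    linarith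
  refine ⟨q, hqD, hqp, ?_⟩
  have hqq : q * q = q := hqp.isIdempotentElem
  have hqs : star q = q := hqp.isSelfAdjoint
  have hbound : ∀ a b : M, IsStarProjection a → ‖a * b * a‖ ≤ ‖b‖ := by
    intro a b ha
    have h1 := norm_isStarProjection_le ha
    calc ‖a * b * a‖ ≤ ‖a‖ * ‖b‖ * ‖a‖ := norm_mul₃_le
      _ ≤ 1 * ‖b‖ * 1 := by gcongr
      _ = ‖b‖ := by ring
  obtain ⟨v, -, h1, h2⟩ := exists_equiv_of_near (⊤ : StarSubalgebra ℂ M)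
    (by simp) (w := e * q) (StarSubalgebra.mem_top)
    (StarSubalgebra.mem_top) he hqp (by rw [← mul_assoc, hee]) (by rw [mul_assoc, hqq])
    (by
      have : e - e * q * star (e * q) = e * (e - q) * e := by
        rw [star_mul, hes, hqs, mul_sub, hee, sub_mul, hee, mul_assoc, ← mul_assoc q, hqq,
          ← mul_assoc]
      rw [this]
      refine (hbound e _ he).trans_lt ?_
      rwa [norm_sub_rev])
    (by
      have : q - star (e * q) * (e * q) = q * (q - e) * q := by
        rw [star_mul, hes, hqs, mul_sub, hqq, sub_mul, hqq, mul_assoc, ← mul_assoc e, hee,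
          ← mul_assoc]
      rw [this]
      exact (hbound q _ hqp).trans_lt hqe)
  exact ⟨v, h1, h2⟩

/-- An increasing sequence of finite-dimensional *-subalgebras with dense union. -/
structure IsFiltration (D : ℕ → StarSubalgebra ℂ M) : Prop where
  mono : Monotone D
  fin : ∀ n, FiniteDimensional ℂ (D n)
  dense : Dense (⋃ n, (D n : Set M))

namespace IsFiltration

variable {D : ℕ → StarSubalgebra ℂ M}

theorem isClosed (hD : IsFiltration D) (n : ℕ) : IsClosed (D n : Set M) := by
  have : FiniteDimensional ℂ (D n).toSubalgebra.toSubmodule := hD.fin n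
  exact Submodule.closed_of_finiteDimensional (D n).toSubalgebra.toSubmodule

theorem exists_near (hD : IsFiltration D) (x : M) {ε : ℝ} (hε : 0 < ε) :
    ∃ m, ∃ y ∈ D m, ‖y - x‖ < ε := by
  obtain ⟨y, hy, hyx⟩ := hD.dense.exists_dist_lt x hε
  obtain ⟨m, hm⟩ := Set.mem_iUnion.1 hy
  exact ⟨m, y, hm, by rwa [← dist_eq_norm, dist_comm]⟩

theorem exists_projection (hD : IsFiltration D) {e : M} (he : IsStarProjection e) :
    ∃ m, ∃ q ∈ D m, IsStarProjection q ∧ ∃ v : M, v * star v = e ∧ star v * v = q := by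
  obtain ⟨m, y, hy, hyx⟩ := hD.exists_near e (ε := 1 / 20) (by norm_num)
  exact ⟨m, exists_projection_near (D m) (hD.isClosed m) he hy hyx.le⟩

/-- Approximate v within 1/4 by some y of a later stage and cut it down to w = eyf. Then e - ww* and
f - w*w have norm at most 5/16 + 1/4 < 1, so w can be corrected inside that stage. -/
theorem exists_equiv (hD : IsFiltration D) {n : ℕ} {e f v : M} (heD : e ∈ D n) (hfD : f ∈ D n)
    (he : IsStarProjection e) (hf : IsStarProjection f) (h1 : v * star v = e)
    (h2 : star v * v = f) :
    ∃ m, n ≤ m ∧ ∃ w ∈ D m, w * star w = e ∧ star w * w = f := by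
  obtain ⟨m, y, hy, hyv⟩ := hD.exists_near v (ε := 1 / 4) (by norm_num)
  refine ⟨max n m, le_max_left _ _, ?_⟩
  have heD' := hD.mono (le_max_left n m) heD
  have hfD' := hD.mono (le_max_left n m) hfD
  have hy' := hD.mono (le_max_right n m) hy
  have hev : e * v = v := mul_of_mul_star_eq he h1
  have hvf : v * f = v := mul_of_star_mul_eq hf h2
  have hn1 := norm_isStarProjection_le he
  have hn2 := norm_isStarProjection_le hf
  have hv1 : ‖v‖ ≤ 1 := by
    have := CStarRing.norm_self_mul_star (x := v)
    rw [h1] at this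
    nlinarith [norm_nonneg v]
  have hw : ‖e * y * f - v‖ ≤ 1 / 4 := by
    have : e * y * f - v = e * (y - v) * f := by rw [mul_sub, sub_mul, hev, hvf]
    rw [this]
    calc ‖e * (y - v) * f‖ ≤ ‖e‖ * ‖y - v‖ * ‖f‖ := norm_mul₃_le
      _ ≤ 1 * (1 / 4) * 1 := by gcongr
      _ = 1 / 4 := by ring
  set w := e * y * f with hwdef
  have hwn : ‖w‖ ≤ 5 / 4 := by
    have := norm_add_le (w - v) v
    rw [sub_add_cancel] at this
    linarith
  refine exists_equiv_of_near (D (max n m)) (hD.isClosed _) (w := w) hfD'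
    (mul_mem (mul_mem heD' hy') hfD') he hf ?_ ?_ ?_ ?_
  · rw [hwdef, ← mul_assoc, ← mul_assoc, he.isIdempotentElem.eq]
  · rw [hwdef, mul_assoc, hf.isIdempotentElem.eq]
  · have : e - w * star w = -((w - v) * star w + v * star (w - v)) := by
      rw [← h1, star_sub, sub_mul, mul_sub]; abel
    rw [this, norm_neg]
    have a1 := norm_add_le ((w - v) * star w) (v * star (w - v))
    have a2 : ‖(w - v) * star w‖ ≤ 1 / 4 * (5 / 4) := by
      refine (norm_mul_le _ _).trans ?_
      rw [norm_star]
      gcongr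
    have a3 : ‖v * star (w - v)‖ ≤ 1 * (1 / 4) := by
      refine (norm_mul_le _ _).trans ?_
      rw [norm_star]
      gcongr
    linarith
  · have : f - star w * w = -(star w * (w - v) + star (w - v) * v) := by
      rw [← h2, star_sub, mul_sub, sub_mul]; abel
    rw [this, norm_neg]
    have a1 := norm_add_le (star w * (w - v)) (star (w - v) * v)
    have a2 : ‖star w * (w - v)‖ ≤ 5 / 4 * (1 / 4) := by
      refine (norm_mul_le _ _).trans ?_
      rw [norm_star]
      gcongr
    have a3 : ‖star (w - v) * v‖ ≤ 1 / 4 * 1 := by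
      refine (norm_mul_le _ _).trans ?_
      rw [norm_star]
      gcongr
    linarith

end IsFiltration

end Perturbation

end AFAlg

namespace AFAlg

open scoped Matrix ComplexOrder

/-! ### Matrices over a filtration -/

section Matrices

variable {A : Type*} [CStarAlgebra A]

/-- All entries of the matrix lie in `B`. -/
def EntriesIn (B : StarSubalgebra ℂ A) {m n : Type*} (x : Matrix m n A) : Prop :=
  ∀ i j, x i j ∈ B

namespace EntriesIn

variable {B : StarSubalgebra ℂ A} {l m n : Type*}

theorem mul [Fintype m] {x : Matrix l m A} {y : Matrix m n A} (hx : EntriesIn B x)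
    (hy : EntriesIn B y) : EntriesIn B (x * y) := fun i j => by
  rw [Matrix.mul_apply]
  exact sum_mem fun k _ => mul_mem (hx i k) (hy k j)

theorem conjTranspose {x : Matrix m n A} (hx : EntriesIn B x) : EntriesIn B xᴴ := fun i j => by
  rw [Matrix.conjTranspose_apply]
  exact star_mem (hx j i)

theorem zero : EntriesIn B (0 : Matrix m n A) := fun _ _ => zero_mem B

theorem one [DecidableEq m] : EntriesIn B (1 : Matrix m m A) := fun i j => by
  rw [Matrix.one_apply]
  split_ifs
  exacts [one_mem B, zero_mem B]

theorem sub {x y : Matrix m n A} (hx : EntriesIn B x) (hy : EntriesIn B y) :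
    EntriesIn B (x - y) := fun i j => sub_mem (hx i j) (hy i j)

theorem mono {B' : StarSubalgebra ℂ A} (h : B ≤ B') {x : Matrix m n A} (hx : EntriesIn B x) :
    EntriesIn B' x := fun i j => h (hx i j)

theorem fromBlocks {l m n o : Type*} {a : Matrix n l A} {b : Matrix n m A} {c : Matrix o l A}
    {d : Matrix o m A} (ha : EntriesIn B a) (hb : EntriesIn B b) (hc : EntriesIn B c)
    (hd : EntriesIn B d) : EntriesIn B (Matrix.fromBlocks a b c d) := by
  rintro (i | i) (j | j)
  exacts [ha i j, hb i j, hc i j, hd i j]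

end EntriesIn

theorem ampTrace_congr_of_entriesIn {B : StarSubalgebra ℂ A} {τ : A →L[ℂ] ℂ}
    (hτ : ∀ x ∈ B, ∀ y ∈ B, τ (x * y) = τ (y * x)) {m n : Type*} [Fintype m] [Fintype n]
    {p : Matrix m m A} {q : Matrix n n A} {v : Matrix m n A} (hv : EntriesIn B v)
    (h1 : v * vᴴ = p) (h2 : vᴴ * v = q) : ampTrace τ p = ampTrace τ q := by
  subst h1 h2
  simp only [ampTrace, Matrix.mul_apply, map_sum, Matrix.conjTranspose_apply]
  rw [Finset.sum_comm]
  exact Finset.sum_congr rfl fun i _ => Finset.sum_congr rfl fun j _ =>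
    hτ _ (hv j i) _ (star_mem (hv j i))

theorem ampTrace_blocks (τ : A →L[ℂ] ℂ) {m n : Type*} [Fintype m] [Fintype n]
    (p : Matrix m m A) (q : Matrix n n A) (b : Matrix m n A) (c : Matrix n m A) :
    ampTrace τ (Matrix.fromBlocks p b c q) = ampTrace τ p + ampTrace τ q := by
  simp [ampTrace, Fintype.sum_sum_type]

theorem ampTrace_sub (τ : A →L[ℂ] ℂ) {m : Type*} [Fintype m] (p q : Matrix m m A) :
    ampTrace τ (p - q) = ampTrace τ p - ampTrace τ q := by
  simp [ampTrace]

theorem ampTrace_zero (τ : A →L[ℂ] ℂ) {m : Type*} [Fintype m] :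
    ampTrace τ (0 : Matrix m m A) = 0 := by
  simp [ampTrace]

variable [PartialOrder A] [StarOrderedRing A]

/-- The matrices over a *-subalgebra. -/
def matSubalgebra (B : StarSubalgebra ℂ A) (n : Type*) [Fintype n] [DecidableEq n] :
    StarSubalgebra ℂ (CStarMatrix n n A) where
  carrier := {x | EntriesIn B (CStarMatrix.ofMatrix.symm x)}
  mul_mem' := fun ha hb => EntriesIn.mul ha hb
  one_mem' := EntriesIn.one
  add_mem' := fun ha hb i j => add_mem (ha i j) (hb i j)
  zero_mem' := EntriesIn.zero
  algebraMap_mem' := by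
    intro c i j
    change (algebraMap ℂ (Matrix n n A) c) i j ∈ B
    rw [Matrix.algebraMap_matrix_apply]
    split_ifs
    exacts [algebraMap_mem B c, zero_mem B]
  star_mem' := fun ha => EntriesIn.conjTranspose ha

theorem finiteDimensional_matSubalgebra (B : StarSubalgebra ℂ A) [FiniteDimensional ℂ B]
    (n : Type*) [Fintype n] [DecidableEq n] : FiniteDimensional ℂ (matSubalgebra B n) := by
  let f : matSubalgebra B n →ₗ[ℂ] (n → n → B) :=
    { toFun := fun x i j => ⟨_, x.2 i j⟩
      map_add' := fun _ _ => rfl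
      map_smul' := fun _ _ => rfl }
  refine FiniteDimensional.of_injective f fun x y hxy => ?_
  apply Subtype.ext
  refine CStarMatrix.ext fun i j => ?_
  have := congrArg Subtype.val (congrFun (congrFun hxy i) j)
  exact this

theorem IsFiltration.matrix {B : ℕ → StarSubalgebra ℂ A} (hB : IsFiltration B)
    (n : Type*) [Fintype n] [DecidableEq n] :
    IsFiltration (fun k => matSubalgebra (B k) n) := by
  refine ⟨fun k l hkl x hx => EntriesIn.mono (hB.mono hkl) hx, fun k => ?_, ?_⟩
  · have := hB.fin k
    exact finiteDimensional_matSubalgebra (B k) n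
  · have h1 : Dense (Set.pi Set.univ fun _ : n => Set.pi Set.univ fun _ : n =>
        (⋃ k, (B k : Set A))) :=
      dense_pi _ fun _ _ => dense_pi _ fun _ _ => hB.dense
    have h2 : Dense (X := CStarMatrix n n A) (Set.pi Set.univ fun _ : n =>
        Set.pi Set.univ fun _ : n => (⋃ k, (B k : Set A))) := h1
    refine h2.mono ?_
    intro x hx
    have h3 : ∀ i j, ∃ k, x i j ∈ B k := fun i j =>
      Set.mem_iUnion.1 (hx i trivial j trivial)
    choose k hk using h3
    -- The finitely many entries lie in finitely many stages, hence in the largest of them.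
    refine Set.mem_iUnion.2 ⟨Finset.univ.sup fun i => Finset.univ.sup fun j => k i j, ?_⟩
    intro i j
    refine hB.mono ?_ (hk i j)
    exact (Finset.le_sup (f := fun j => k i j) (Finset.mem_univ j)).trans
      (Finset.le_sup (f := fun i => Finset.univ.sup fun j => k i j) (Finset.mem_univ i))

theorem exists_mvN_entriesIn {B : ℕ → StarSubalgebra ℂ A} (hB : IsFiltration B)
    {m : Type*} [Fintype m] {e : Matrix m m A} (he : IsStarProjection e) :
    ∃ k, ∃ q : Matrix m m A, EntriesIn (B k) q ∧ IsStarProjection q ∧ MvN e q := by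
  classical
  obtain ⟨k, q, hq, hqp, v, h1, h2⟩ := (hB.matrix m).exists_projection
    (e := CStarMatrix.ofMatrix e) ⟨he.isIdempotentElem, he.isSelfAdjoint⟩
  exact ⟨k, CStarMatrix.ofMatrix.symm q, hq, ⟨hqp.isIdempotentElem, hqp.isSelfAdjoint⟩,
    CStarMatrix.ofMatrix.symm v, h1, h2⟩

theorem isStarProjection_blocks₁ {R m n : Type*} [Ring R] [StarRing R] [Fintype m] [Fintype n]
    {e : Matrix m m R} (he : IsStarProjection e) :
    IsStarProjection (Matrix.fromBlocks e 0 0 (0 : Matrix n n R)) :=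
  isStarProjection_fromBlocks he (IsStarProjection.zero _)

theorem isStarProjection_blocks₂ {R m n : Type*} [Ring R] [StarRing R] [Fintype m] [Fintype n]
    {f : Matrix n n R} (hf : IsStarProjection f) :
    IsStarProjection (Matrix.fromBlocks (0 : Matrix m m R) 0 0 f) :=
  isStarProjection_fromBlocks (IsStarProjection.zero _) hf

theorem corner_mul_conjTranspose {R m n : Type*} [Ring R] [StarRing R] [Fintype m] [Fintype n]
    (v : Matrix m n R) :
    Matrix.fromBlocks (0 : Matrix m m R) v 0 (0 : Matrix n n R) * (Matrix.fromBlocks 0 v 0 0)ᴴ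
      = Matrix.fromBlocks (v * vᴴ) 0 0 0 := by
  simp [Matrix.fromBlocks_conjTranspose, Matrix.fromBlocks_multiply]

theorem conjTranspose_mul_corner {R m n : Type*} [Ring R] [StarRing R] [Fintype m] [Fintype n]
    (v : Matrix m n R) :
    (Matrix.fromBlocks (0 : Matrix m m R) v 0 (0 : Matrix n n R))ᴴ * Matrix.fromBlocks 0 v 0 0
      = Matrix.fromBlocks 0 0 0 (vᴴ * v) := by
  simp [Matrix.fromBlocks_conjTranspose, Matrix.fromBlocks_multiply]

theorem eq_corner {R m n : Type*} [Ring R] [Fintype m] [Fintype n] {e : Matrix m m R}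
    {f : Matrix n n R} {W : Matrix (m ⊕ n) (m ⊕ n) R}
    (hew : Matrix.fromBlocks e 0 0 0 * W = W) (hwf : W * Matrix.fromBlocks 0 0 0 f = W) :
    W = Matrix.fromBlocks 0 W.toBlocks₁₂ 0 0 := by
  rw [← Matrix.fromBlocks_toBlocks W, Matrix.fromBlocks_multiply, Matrix.fromBlocks_inj] at hew hwf
  simp only [Matrix.zero_mul, Matrix.mul_zero, add_zero] at hew hwf
  conv_lhs => rw [← Matrix.fromBlocks_toBlocks W]
  rw [← hwf.1, ← hwf.2.2.1, ← hew.2.2.2]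

/-- A rectangular partial isometry is not an element of a C*-algebra, so it is placed in the
off-diagonal corner of the square matrices indexed by `m ⊕ n`. There `IsFiltration.exists_equiv`
applies, and `eq_corner` shows that the result lies in the same corner. -/
theorem exists_entriesIn_of_mvN {B : ℕ → StarSubalgebra ℂ A} (hB : IsFiltration B)
    {m n : Type*} [Fintype m] [Fintype n] {e : Matrix m m A} {f : Matrix n n A} {k : ℕ}
    (he : IsStarProjection e) (hf : IsStarProjection f) (heB : EntriesIn (B k) e)
    (hfB : EntriesIn (B k) f) (h : MvN e f) :
    ∃ k', k ≤ k' ∧ ∃ v : Matrix m n A, EntriesIn (B k') v ∧ v * vᴴ = e ∧ vᴴ * v = f := by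
  classical
  obtain ⟨v, h1, h2⟩ := h
  have hE := isStarProjection_blocks₁ (n := n) he
  have hF := isStarProjection_blocks₂ (m := m) hf
  obtain ⟨k', hk, w, hw, hw1, hw2⟩ := (hB.matrix (m ⊕ n)).exists_equiv (n := k)
    (e := CStarMatrix.ofMatrix (Matrix.fromBlocks e 0 0 0))
    (f := CStarMatrix.ofMatrix (Matrix.fromBlocks 0 0 0 f))
    (v := CStarMatrix.ofMatrix (Matrix.fromBlocks 0 v 0 0))
    (EntriesIn.fromBlocks heB .zero .zero .zero) (EntriesIn.fromBlocks .zero .zero .zero hfB)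
    ⟨hE.isIdempotentElem, hE.isSelfAdjoint⟩ ⟨hF.isIdempotentElem, hF.isSelfAdjoint⟩
    ((corner_mul_conjTranspose v).trans (by rw [h1]; rfl))
    ((conjTranspose_mul_corner v).trans (by rw [h2]; rfl))
  refine ⟨k', hk, ?_⟩
  have hew : CStarMatrix.ofMatrix (Matrix.fromBlocks e 0 0 0) * w = w :=
    mul_of_mul_star_eq ⟨hE.isIdempotentElem, hE.isSelfAdjoint⟩ hw1
  have hwf : w * CStarMatrix.ofMatrix (Matrix.fromBlocks 0 0 0 f) = w :=
    mul_of_star_mul_eq ⟨hF.isIdempotentElem, hF.isSelfAdjoint⟩ hw2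
  obtain ⟨W, rfl⟩ := CStarMatrix.ofMatrix.surjective w
  rw [eq_corner (W := W) hew hwf] at hw1 hw2
  have hw1' : Matrix.fromBlocks _ _ _ _ = Matrix.fromBlocks _ _ _ _ :=
    (corner_mul_conjTranspose W.toBlocks₁₂).symm.trans hw1
  have hw2' : Matrix.fromBlocks _ _ _ _ = Matrix.fromBlocks _ _ _ _ :=
    (conjTranspose_mul_corner W.toBlocks₁₂).symm.trans hw2
  exact ⟨W.toBlocks₁₂, fun i j => hw (Sum.inl i) (Sum.inr j), (Matrix.fromBlocks_inj.1 hw1').1,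
    (Matrix.fromBlocks_inj.1 hw2').2.2.2⟩

end Matrices

end AFAlg

namespace AFAlg

open scoped Matrix ComplexOrder

/-! ### Comparison and cancellation for matrix projections -/

section MatrixComparison

variable {A : Type*} [CStarAlgebra A] [PartialOrder A] [StarOrderedRing A]

/-- The scalar diagonal embedding of `A` into a matrix algebra. -/
noncomputable def diagHom (A : Type*) [CStarAlgebra A] [PartialOrder A] [StarOrderedRing A]
    (n : Type*) [Fintype n] [DecidableEq n] : A →⋆ₙₐ[ℂ] CStarMatrix n n A where
  toFun x := CStarMatrix.ofMatrix (Matrix.diagonal fun _ => x)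
  map_smul' c x := (Matrix.diagonal_smul c fun _ => x)
  map_zero' := Matrix.diagonal_zero
  map_add' x y := (Matrix.diagonal_add (fun _ => x) (fun _ => y)).symm
  map_mul' x y := (Matrix.diagonal_mul_diagonal (fun _ => x) (fun _ => y)).symm
  map_star' x := (Matrix.diagonal_conjTranspose (fun _ : n => x)).symm

theorem diagHom_mem {B : StarSubalgebra ℂ A} {n : Type*} [Fintype n] [DecidableEq n] {x : A}
    (hx : x ∈ B) : diagHom A n x ∈ matSubalgebra B n := by
  intro i j
  change Matrix.diagonal (fun _ => x) i j ∈ B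
  rw [Matrix.diagonal_apply]
  split_ifs
  exacts [hx, zero_mem B]

/-- The composition of a functional on a matrix algebra with the diagonal embedding. -/
noncomputable def diagFunctional {n : Type*} [Fintype n] [DecidableEq n]
    (T : CStarMatrix n n A →L[ℂ] ℂ) : A →L[ℂ] ℂ :=
  LinearMap.mkContinuous (T.toLinearMap ∘ₗ (diagHom A n : A →ₗ[ℂ] CStarMatrix n n A)) ‖T‖
    fun x => (T.le_opNorm _).trans (by
      gcongr
      exact NonUnitalStarAlgHom.norm_apply_le (diagHom A n) x)

theorem diagFunctional_apply {n : Type*} [Fintype n] [DecidableEq n]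
    (T : CStarMatrix n n A →L[ℂ] ℂ) (x : A) : diagFunctional T x = T (diagHom A n x) := rfl

theorem norm_diagFunctional_le {n : Type*} [Fintype n] [DecidableEq n]
    (T : CStarMatrix n n A →L[ℂ] ℂ) : ‖diagFunctional T‖ ≤ ‖T‖ :=
  LinearMap.mkContinuous_norm_le _ (norm_nonneg _) _

/-- A trace on matrices over B kills the off-diagonal units and takes the same value on x placed at
any diagonal position. It is therefore Tr ⊗ τ up to the factor card n, where τ is its restriction to
scalar diagonals. -/
theorem ampTrace_diagFunctional {n : Type*} [Fintype n] [DecidableEq n]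
    (T : CStarMatrix n n A →L[ℂ] ℂ) {B : StarSubalgebra ℂ A}
    (hT : ∀ x ∈ matSubalgebra B n, ∀ y ∈ matSubalgebra B n, T (x * y) = T (y * x))
    {y : Matrix n n A} (hy : EntriesIn B y) :
    ampTrace (diagFunctional T) y = Fintype.card n * T (CStarMatrix.ofMatrix y) := by
  let s : n → n → A → CStarMatrix n n A := fun i j x => CStarMatrix.ofMatrix (Matrix.single i j x)
  have hs : ∀ i j, ∀ x ∈ B, s i j x ∈ matSubalgebra B n := by
    intro i j x hx k l
    change Matrix.single i j x k l ∈ B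
    rw [Matrix.single_apply]
    split_ifs
    exacts [hx, zero_mem B]
  have hmul : ∀ i j k x y, s i j x * s j k y = s i k (x * y) := fun i j k x y =>
    Matrix.single_mul_single_same ..
  have hmul0 : ∀ i j k l x y, j ≠ k → s i j x * s k l y = 0 := fun i j k l x y h =>
    Matrix.single_mul_single_of_ne (h := h) ..
  have hoff : ∀ i j, ∀ x ∈ B, i ≠ j → T (s i j x) = 0 := by
    intro i j x hx hij
    have h1 : s i i 1 * s i j x = s i j x := by rw [hmul, one_mul]
    rw [← h1, hT _ (hs _ _ _ (one_mem B)) _ (hs _ _ _ hx), hmul0 _ _ _ _ _ _ hij.symm, map_zero]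
  have hdiag : ∀ i j, ∀ x ∈ B, T (s i i x) = T (s j j x) := by
    intro i j x hx
    have h1 : s i j x * s j i 1 = s i i x := by rw [hmul, mul_one]
    have h2 : s j i 1 * s i j x = s j j x := by rw [hmul, one_mul]
    rw [← h1, ← h2, hT _ (hs _ _ _ hx) _ (hs _ _ _ (one_mem B))]
  have hd : ∀ x, diagFunctional T x = ∑ j, T (s j j x) := by
    intro x
    rw [diagFunctional_apply, ← map_sum]
    congr 1
    refine CStarMatrix.ext fun i j => ?_
    have h1 : (∑ k, s k k x) i j = (∑ k, Matrix.single k k x) i j := rfl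
    rw [h1]
    change Matrix.diagonal (fun _ => x) i j = _
    rw [Matrix.sum_apply, Matrix.diagonal_apply]
    by_cases hij : i = j
    · subst hij
      simp [Matrix.single_apply]
    · rw [if_neg hij]
      symm
      refine Finset.sum_eq_zero fun k _ => ?_
      rw [Matrix.single_apply, if_neg]
      rintro ⟨rfl, rfl⟩
      exact hij rfl
  have hTy : T (CStarMatrix.ofMatrix y) = ∑ i, T (s i i (y i i)) := by
    have h1 : CStarMatrix.ofMatrix y = ∑ i, ∑ j, s i j (y i j) := Matrix.matrix_eq_sum_single y
    rw [h1, map_sum]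
    refine Finset.sum_congr rfl fun i _ => ?_
    rw [map_sum, Finset.sum_eq_single i (fun j _ hj => hoff i j _ (hy i j) hj.symm) (by simp)]
  rw [hTy, ampTrace, Finset.mul_sum]
  refine Finset.sum_congr rfl fun i _ => ?_
  rw [hd, Finset.sum_congr rfl fun j _ => hdiag j i _ (hy i i)]
  simp

/-- Comparison of projections over a finite-dimensional *-algebra by its tracial states. -/
theorem exists_subequiv_or_trace_matrix (B : StarSubalgebra ℂ A) [FiniteDimensional ℂ B]
    {m n : Type*} [Fintype m] [Fintype n] {e : Matrix m m A} {f : Matrix n n A}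
    (heB : EntriesIn B e) (hfB : EntriesIn B f) (he : IsStarProjection e)
    (hf : IsStarProjection f) :
    (∃ v : Matrix m n A, EntriesIn B v ∧ v * vᴴ = e ∧ v * f = v ∧ IsStarProjection (vᴴ * v)) ∨
    ∃ τ : A →L[ℂ] ℂ, ‖τ‖ ≤ 1 ∧ τ 1 = 1 ∧ (∀ x ∈ B, ∀ y ∈ B, τ (x * y) = τ (y * x)) ∧
      (∀ x ∈ B, 0 ≤ (τ (star x * x)).re ∧ (τ (star x * x)).im = 0) ∧
      (ampTrace τ f).re < (ampTrace τ e).re := by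
  classical
  have hE := isStarProjection_blocks₁ (n := n) he
  have hF := isStarProjection_blocks₂ (m := m) hf
  have hEB := EntriesIn.fromBlocks (m := n) (o := n) heB .zero .zero .zero
  have hFB := EntriesIn.fromBlocks (B := B) (n := m) (l := m) .zero .zero .zero hfB
  have := finiteDimensional_matSubalgebra B (m ⊕ n)
  rcases exists_subequiv_or_trace (matSubalgebra B (m ⊕ n)).toNonUnitalStarSubalgebra (p := 1)
    (IsStarProjection.one _) (one_mem (matSubalgebra B (m ⊕ n))) (fun x _ => one_mul x)
    (e := CStarMatrix.ofMatrix (Matrix.fromBlocks e 0 0 0))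
    (f := CStarMatrix.ofMatrix (Matrix.fromBlocks 0 0 0 f)) hEB hFB
    ⟨hE.isIdempotentElem, hE.isSelfAdjoint⟩ ⟨hF.isIdempotentElem, hF.isSelfAdjoint⟩ with
    ⟨w, hw, hw1, hwf, hwp⟩ | ⟨T, hT1, hT2, hT3, hT4, hT5⟩
  · left
    have hew : CStarMatrix.ofMatrix (Matrix.fromBlocks e 0 0 0) * w = w :=
      mul_of_mul_star_eq ⟨hE.isIdempotentElem, hE.isSelfAdjoint⟩ hw1
    obtain ⟨W, rfl⟩ := CStarMatrix.ofMatrix.surjective w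
    have hwp' : IsStarProjection (Wᴴ * W) := ⟨hwp.isIdempotentElem, hwp.isSelfAdjoint⟩
    have hwf' : W * Matrix.fromBlocks 0 0 0 f = W := hwf
    rw [eq_corner (W := W) hew hwf] at hw1
    rw [eq_corner (W := W) hew hwf, conjTranspose_mul_corner] at hwp'
    have hw1' : Matrix.fromBlocks _ _ _ _ = Matrix.fromBlocks _ _ _ _ :=
      (corner_mul_conjTranspose W.toBlocks₁₂).symm.trans hw1
    rw [eq_corner (W := W) hew hwf, Matrix.fromBlocks_multiply, Matrix.fromBlocks_inj] at hwf'
    refine ⟨W.toBlocks₁₂, fun i j => hw (Sum.inl i) (Sum.inr j), (Matrix.fromBlocks_inj.1 hw1').1,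
      by simpa using hwf'.2.1, ?_, ?_⟩
    · have := hwp'.isIdempotentElem.eq
      rw [Matrix.fromBlocks_multiply, Matrix.fromBlocks_inj] at this
      have h := this.2.2.2
      rw [Matrix.zero_mul, zero_add] at h
      exact h
    · exact Matrix.isHermitian_conjTranspose_mul_self _
  · right
    refine ⟨diagFunctional T, (norm_diagFunctional_le T).trans hT1, ?_, ?_, ?_, ?_⟩
    · rw [diagFunctional_apply, ← hT2]
      congr 1
    · intro x hx y hy
      simp only [diagFunctional_apply, map_mul]
      exact hT3 _ (diagHom_mem hx) _ (diagHom_mem hy)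
    · intro x hx
      simp only [diagFunctional_apply, map_mul, map_star]
      exact hT4 _ (diagHom_mem hx)
    · have h1 := ampTrace_diagFunctional T hT3 hEB
      have h2 := ampTrace_diagFunctional T hT3 hFB
      rw [ampTrace_blocks, ampTrace_zero, add_zero] at h1
      rw [ampTrace_blocks, ampTrace_zero, zero_add] at h2
      have hpos : 0 < Fintype.card (m ⊕ n) := by
        rw [Fintype.card_pos_iff]
        by_contra hcon
        rw [not_nonempty_iff] at hcon
        rw [show (1 : CStarMatrix (m ⊕ n) (m ⊕ n) A) = 0 from
          CStarMatrix.ext fun i => hcon.elim i, map_zero] at hT2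
        exact zero_ne_one hT2
      rw [h1, h2]
      have hc : ∀ z : ℂ, ((Fintype.card (m ⊕ n) : ℂ) * z).re = (Fintype.card (m ⊕ n) : ℝ) * z.re :=
        fun z => Complex.re_ofReal_mul (Fintype.card (m ⊕ n) : ℝ) z
      rw [hc, hc]
      exact mul_lt_mul_of_pos_left hT5 (by exact_mod_cast hpos)

/-- No trace separates e from f, so e is equivalent to some v*v ≤ f. The remainder f - v*v has trace
zero under every trace of B; comparing it with the zero projection shows that it is zero. -/
theorem mvN_of_trace_eq (B : StarSubalgebra ℂ A) [FiniteDimensional ℂ B]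
    {m n : Type*} [Fintype m] [Fintype n] {e : Matrix m m A} {f : Matrix n n A}
    (heB : EntriesIn B e) (hfB : EntriesIn B f) (he : IsStarProjection e)
    (hf : IsStarProjection f)
    (h : ∀ τ : A →L[ℂ] ℂ, (∀ x ∈ B, ∀ y ∈ B, τ (x * y) = τ (y * x)) →
      ampTrace τ e = ampTrace τ f) : MvN e f := by
  rcases exists_subequiv_or_trace_matrix B heB hfB he hf with
    ⟨v, hv, hve, hvf, hvp⟩ | ⟨τ, -, -, h1, -, h2⟩
  swap
  · rw [h τ h1] at h2; exact absurd h2 (lt_irrefl _)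
  refine ⟨v, hve, ?_⟩
  have hd : IsStarProjection (f - vᴴ * v) :=
    hvp.sub_of_mul_eq_left hf (by rw [Matrix.mul_assoc, hvf])
  rcases exists_subequiv_or_trace_matrix B (hfB.sub (hv.conjTranspose.mul hv))
    (EntriesIn.zero (m := n) (n := n)) hd (IsStarProjection.zero _) with
    ⟨w, hw, hwe, hwf, -⟩ | ⟨τ, -, -, h1, -, h2⟩
  · rw [Matrix.mul_zero] at hwf
    rw [← hwf, Matrix.zero_mul, eq_comm, sub_eq_zero] at hwe
    exact hwe.symm
  · rw [ampTrace_sub, ← ampTrace_congr_of_entriesIn h1 hv hve rfl, h τ h1, sub_self,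
      ampTrace_zero] at h2
    exact absurd h2 (lt_irrefl _)

/-- All three projections and the equivalence can be moved into one finite-dimensional stage. There
equivalence is decided by traces, and the contribution of r cancels as a complex number. -/
theorem mvN_cancel {B : ℕ → StarSubalgebra ℂ A} (hB : IsFiltration B) {l m n : Type*} [Fintype l]
    [Fintype m] [Fintype n] {e : Matrix m m A} {f : Matrix n n A} {r : Matrix l l A}
    (he : IsStarProjection e) (hf : IsStarProjection f) (hr : IsStarProjection r)
    (h : MvN (Matrix.fromBlocks e 0 0 r) (Matrix.fromBlocks f 0 0 r)) : MvN e f := by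
  obtain ⟨k₁, e', he'B, he', hee'⟩ := exists_mvN_entriesIn hB he
  obtain ⟨k₂, f', hf'B, hf', hff'⟩ := exists_mvN_entriesIn hB hf
  obtain ⟨k₃, r', hr'B, hr', hrr'⟩ := exists_mvN_entriesIn hB hr
  have h' : MvN (Matrix.fromBlocks e' 0 0 r') (Matrix.fromBlocks f' 0 0 r') :=
    MvN.trans (isStarProjection_fromBlocks he' hr') (isStarProjection_fromBlocks hf' hr')
      (MvN.fromBlocks hee'.symm hrr'.symm)
      (MvN.trans (isStarProjection_fromBlocks he hr) (isStarProjection_fromBlocks hf' hr') h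
        (MvN.fromBlocks hff' hrr'))
  let k := max k₁ (max k₂ k₃)
  have l1 : k₁ ≤ k := le_max_left _ _
  have l2 : k₂ ≤ k := (le_max_left _ _).trans (le_max_right _ _)
  have l3 : k₃ ≤ k := (le_max_right _ _).trans (le_max_right _ _)
  obtain ⟨k', hk, v, hv, hv1, hv2⟩ := exists_entriesIn_of_mvN hB (k := k)
    (isStarProjection_fromBlocks he' hr') (isStarProjection_fromBlocks hf' hr')
    (.fromBlocks (he'B.mono (hB.mono l1)) .zero .zero (hr'B.mono (hB.mono l3)))
    (.fromBlocks (hf'B.mono (hB.mono l2)) .zero .zero (hr'B.mono (hB.mono l3))) h'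
  have := hB.fin k'
  have h2 : MvN e' f' := by
    refine mvN_of_trace_eq (B k') (he'B.mono (hB.mono (l1.trans hk)))
      (hf'B.mono (hB.mono (l2.trans hk))) he' hf' fun τ hτ => ?_
    have := ampTrace_congr_of_entriesIn hτ hv hv1 hv2
    rw [ampTrace_blocks, ampTrace_blocks] at this
    exact add_right_cancel this
  exact MvN.trans he hf hee' (MvN.trans he' hf h2 hff'.symm)

end MatrixComparison

end AFAlg

namespace AFAlg

open scoped Matrix ComplexOrder

/-! ### Compactness of the tracial states -/

section Traces

variable {A : Type*} [CStarAlgebra A]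

/-- A positive unital functional is contractive on positive elements, and every x is a combination
of four of these with norm at most ‖x‖. The crude constant 4 suffices for compactness. -/
theorem norm_tracialState_le {τ : A →L[ℂ] ℂ} (hτ : τ ∈ tracialStates A) : ‖τ‖ ≤ 4 := by
  let _ := CStarAlgebra.spectralOrder A
  let _ := CStarAlgebra.spectralOrderedRing A
  obtain ⟨-, hpos, h1⟩ := hτ
  have hnn : ∀ z : A, 0 ≤ z → 0 ≤ τ z := by
    intro z hz
    obtain ⟨b, rfl⟩ := CStarAlgebra.nonneg_iff_eq_star_mul_self.1 hz
    exact hpos b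
  have hb : ∀ z : A, 0 ≤ z → ‖τ z‖ ≤ ‖z‖ := by
    intro z hz
    have h2 : 0 ≤ algebraMap ℝ A ‖z‖ - z :=
      sub_nonneg.2 (IsSelfAdjoint.le_algebraMap_norm_self (.of_nonneg hz))
    have h3 := hnn _ h2
    rw [map_sub, Algebra.algebraMap_eq_smul_one, ← Complex.coe_smul, map_smul, h1,
      smul_eq_mul, mul_one] at h3
    have h4 := hnn z hz
    rw [Complex.nonneg_iff] at h3 h4
    have h5 : τ z = ((τ z).re : ℂ) := Complex.ext rfl (by simpa using h4.2.symm)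
    rw [h5, Complex.norm_real, Real.norm_of_nonneg h4.1]
    simpa using h3.1
  refine τ.opNorm_le_bound (by norm_num) fun x => ?_
  obtain ⟨y, hy0, hyn, hy⟩ := CStarAlgebra.exists_sum_four_nonneg x
  conv_lhs => rw [hy]
  rw [map_sum]
  refine (norm_sum_le _ _).trans ?_
  refine (Finset.sum_le_sum (g := fun _ => ‖x‖) fun i _ => ?_).trans (by simp)
  rw [map_smul, norm_smul, norm_pow, Complex.norm_I, one_pow, one_mul]
  exact (hb _ (hy0 i)).trans (hyn i)

theorem convex_tracialStates : Convex ℝ (tracialStates A) := by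
  intro s hs t ht a b ha hb hab
  have hsm : ∀ (c : ℝ) (u : A →L[ℂ] ℂ) (x : A), (c • u) x = (c : ℂ) * u x := fun c u x => by simp
  refine ⟨fun x y => ?_, fun x => ?_, ?_⟩
  · simp only [add_apply, hsm, hs.1 x y, ht.1 x y]
  · simp only [add_apply, hsm]
    exact add_nonneg (mul_nonneg (by exact_mod_cast ha) (hs.2.1 x))
      (mul_nonneg (by exact_mod_cast hb) (ht.2.1 x))
  · simp only [add_apply, hsm, hs.2.2, ht.2.2, mul_one]
    exact_mod_cast hab

theorem isClosed_tracialStates : IsClosed (tracialStates A) := by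
  have hc : ∀ x : A, Continuous fun τ : A →L[ℂ] ℂ => τ x := fun x => by fun_prop
  have h1 : tracialStates A = (⋂ x : A, ⋂ y : A, {τ : A →L[ℂ] ℂ | τ (x * y) = τ (y * x)}) ∩
      ((⋂ x : A, {τ : A →L[ℂ] ℂ | 0 ≤ τ (star x * x)}) ∩ {τ | τ 1 = 1}) := by
    ext τ
    simp [tracialStates, traceSpace]
  rw [h1]
  refine IsClosed.inter ?_ (IsClosed.inter ?_ ?_)
  · exact isClosed_iInter fun x => isClosed_iInter fun y => isClosed_eq (hc _) (hc _)
  · exact isClosed_iInter fun x => isClosed_le continuous_const (hc _)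
  · exact isClosed_eq (hc _) continuous_const

theorem isCompact_tracialStates [FiniteDimensional ℂ (traceSpace A)] :
    IsCompact (tracialStates A) := by
  have : ProperSpace (traceSpace A) := FiniteDimensional.proper ℂ (traceSpace A)
  have h1 : IsCompact ((↑) ⁻¹' tracialStates A : Set (traceSpace A)) := by
    refine Metric.isCompact_of_isClosed_isBounded
      (isClosed_tracialStates.preimage continuous_subtype_val) ?_
    refine (Metric.isBounded_closedBall (x := (0 : traceSpace A)) (r := 4)).subset fun τ hτ => ?_
    rw [Metric.mem_closedBall, Subtype.dist_eq]
    simpa using norm_tracialState_le hτ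
  have h2 := h1.image continuous_subtype_val
  rwa [Set.image_preimage_eq_of_subset fun τ hτ => ⟨⟨τ, hτ.1⟩, rfl⟩] at h2

/-- Krein–Milman: the tracial states are compact and convex, and the convex hull of the two extreme
points is already closed. -/
theorem exists_convex_combination {φ : Fin 2 → tracialStates A}
    [FiniteDimensional ℂ (traceSpace A)] (hφ : EnumeratesExtremeTraces φ) {τ : A →L[ℂ] ℂ}
    (hτ : τ ∈ tracialStates A) : ∃ c : Fin 2 → ℝ, (∀ j, 0 ≤ c j) ∧ ∑ j, c j = 1 ∧
      τ = ∑ j, (c j : ℂ) • (φ j : A →L[ℂ] ℂ) := by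
  have h := closure_convexHull_extremePoints (isCompact_tracialStates (A := A))
    convex_tracialStates
  rw [← hφ.2, (Set.Finite.isClosed_convexHull ℝ (Set.finite_range _)).closure_eq] at h
  rw [← h] at hτ
  have hr : Set.range (fun i => (φ i : A →L[ℂ] ℂ)) = {(φ 0 : A →L[ℂ] ℂ), (φ 1 : A →L[ℂ] ℂ)} := by
    ext x
    simp [Fin.exists_fin_two, eq_comm]
  rw [hr, convexHull_pair, segment] at hτ
  obtain ⟨a, b, ha, hb, hab, rfl⟩ := hτ
  refine ⟨![a, b], ?_, ?_, ?_⟩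
  · intro j; fin_cases j <;> simpa
  · simpa using hab
  · ext x
    simp

/-- Weak* limits of tracial states of the members of a filtration. -/
theorem IsFiltration.exists_tracialState {B : ℕ → StarSubalgebra ℂ A} (hB : IsFiltration B)
    (τ : ℕ → A →L[ℂ] ℂ) (k : ℕ) (h1 : ∀ m ≥ k, ‖τ m‖ ≤ 1) (h2 : ∀ m ≥ k, τ m 1 = 1)
    (h3 : ∀ m ≥ k, ∀ x ∈ B m, ∀ y ∈ B m, τ m (x * y) = τ m (y * x))
    (h4 : ∀ m ≥ k, ∀ x ∈ B m, 0 ≤ (τ m (star x * x)).re ∧ (τ m (star x * x)).im = 0) :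
    ∃ T ∈ tracialStates A, ∃ U : Filter ℕ, U.NeBot ∧ U ≤ Filter.atTop ∧
      ∀ x, Filter.Tendsto (fun m => τ m x) U (nhds (T x)) := by
  -- Banach–Alaoglu along a free ultrafilter. Every fixed stage eventually lies in the later ones,
  -- so the trace property and positivity pass to the limit first on the dense union and then
  -- everywhere.
  let U : Ultrafilter ℕ := Filter.hyperfilter ℕ
  have hU : (U : Filter ℕ) ≤ Filter.atTop := by
    rw [← Nat.cofinite_eq_atTop]
    exact Filter.hyperfilter_le_cofinite
  have hev : ∀ m, ∀ᶠ l in (U : Filter ℕ), m ≤ l := fun m => hU (Filter.eventually_ge_atTop m)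
  let σ : ℕ → WeakDual ℂ A := fun m => StrongDual.toWeakDual (τ m)
  have hcpt := WeakDual.isCompact_closedBall (𝕜 := ℂ) (E := A) 0 1
  obtain ⟨T', -, hT'⟩ := hcpt.ultrafilter_le_nhds (U.map σ) (by
    rw [Ultrafilter.coe_map, Filter.le_principal_iff, Filter.mem_map]
    filter_upwards [hev k] with m hm
    simpa [σ] using h1 m hm)
  have hlim : ∀ x, Filter.Tendsto (fun m => τ m x) U (nhds (WeakDual.toStrongDual T' x)) := by
    rw [Ultrafilter.coe_map] at hT'
    exact tendsto_iff_forall_eval_tendsto_topDualPairing.1 hT'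
  set T := WeakDual.toStrongDual T' with hT
  refine ⟨T, ⟨?_, ?_, ?_⟩, U, inferInstance, hU, hlim⟩
  · have hD2 : Dense ((⋃ n, (B n : Set A)) ×ˢ (⋃ n, (B n : Set A))) := hB.dense.prod hB.dense
    have hcl : IsClosed {z : A × A | T (z.1 * z.2) = T (z.2 * z.1)} :=
      isClosed_eq (by fun_prop) (by fun_prop)
    have hall : ∀ z : A × A, T (z.1 * z.2) = T (z.2 * z.1) := by
      intro z
      have := hD2.closure_eq ▸ Set.mem_univ z
      refine hcl.closure_subset_iff.2 ?_ this
      rintro ⟨x, y⟩ ⟨hx, hy⟩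
      obtain ⟨m, hx⟩ := Set.mem_iUnion.1 hx
      obtain ⟨n, hy⟩ := Set.mem_iUnion.1 hy
      refine tendsto_nhds_unique (hlim (x * y)) ((hlim (y * x)).congr' ?_)
      filter_upwards [hev k, hev m, hev n] with l hk hm hn
      exact (h3 l hk x (hB.mono hm hx) y (hB.mono hn hy)).symm
    exact fun x y => hall (x, y)
  · have hcl : IsClosed {x : A | 0 ≤ T (star x * x)} :=
      isClosed_le continuous_const (by fun_prop)
    intro x
    have := hB.dense.closure_eq ▸ Set.mem_univ x
    refine hcl.closure_subset_iff.2 ?_ this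
    intro x hx
    obtain ⟨m, hx⟩ := Set.mem_iUnion.1 hx
    refine ge_of_tendsto (hlim (star x * x)) ?_
    filter_upwards [hev k, hev m] with l hk hm
    have := h4 l hk x (hB.mono hm hx)
    rw [Complex.nonneg_iff]
    exact ⟨this.1, this.2.symm⟩
  · refine tendsto_nhds_unique (hlim 1) (tendsto_const_nhds.congr' ?_)
    filter_upwards [hev k] with l hk
    exact (h2 l hk).symm

end Traces

end AFAlg

namespace AFAlg

open scoped Matrix ComplexOrder

/-! ### Trace vectors of projections -/

section Values

variable {A : Type*} [CStarAlgebra A]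

/-- An AF-algebra with two-dimensional trace space whose `K₀`-group is separated by the extreme
traces, together with a filtration. -/
structure IsEmbeddedAF (φ : Fin 2 → tracialStates A) (B : ℕ → StarSubalgebra ℂ A) : Prop where
  filtration : IsFiltration B
  finiteDimensional : FiniteDimensional ℂ (traceSpace A)
  enumerates : EnumeratesExtremeTraces φ
  injective : Function.Injective (Gam φ)

/-- The vector of traces of a matrix projection. -/
noncomputable def trVec (φ : Fin 2 → tracialStates A) {m : Type*} [Fintype m] (e : Matrix m m A) :
    Fin 2 → ℝ := fun j => (ampTrace (φ j : A →L[ℂ] ℂ) e).re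

theorem ampTrace_nonneg_of_isStarProjection (τ : tracialStates A) {m : Type*} [Fintype m]
    {e : Matrix m m A} (he : IsStarProjection e) : 0 ≤ ampTrace (τ : A →L[ℂ] ℂ) e := by
  have h1 : eᴴ = e := he.isSelfAdjoint
  have h2 : e * e = e := he.isIdempotentElem
  have h3 : eᴴ * e = e := by rw [h1, h2]
  rw [← h3]
  unfold ampTrace
  refine Finset.sum_nonneg fun i _ => ?_
  simp only [Matrix.mul_apply, map_sum, Matrix.conjTranspose_apply]
  exact Finset.sum_nonneg fun j _ => τ.2.2.1 _

variable {φ : Fin 2 → tracialStates A}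

theorem ampTrace_eq_trVec {m : Type*} [Fintype m] {e : Matrix m m A} (he : IsStarProjection e)
    (j : Fin 2) : ampTrace (φ j : A →L[ℂ] ℂ) e = trVec φ e j := by
  have h := Complex.nonneg_iff.1 (ampTrace_nonneg_of_isStarProjection (φ j) he)
  exact Complex.ext rfl (by simpa using h.2.symm)

theorem trVec_nonneg {m : Type*} [Fintype m] {e : Matrix m m A} (he : IsStarProjection e)
    (j : Fin 2) : 0 ≤ trVec φ e j :=
  (Complex.nonneg_iff.1 (ampTrace_nonneg_of_isStarProjection (φ j) he)).1

theorem trVec_congr {m n : Type*} [Fintype m] [Fintype n] {e : Matrix m m A} {f : Matrix n n A}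
    (h : MvN e f) : trVec φ e = trVec φ f :=
  funext fun j => congrArg Complex.re (ampTrace_congr (φ j).2.1 h)

theorem trVec_blocks {m n : Type*} [Fintype m] [Fintype n] (e : Matrix m m A) (f : Matrix n n A) :
    trVec φ (Matrix.fromBlocks e 0 0 f) = trVec φ e + trVec φ f :=
  funext fun j => by simp [trVec, ampTrace_blocks]

theorem trVec_sub {m : Type*} [Fintype m] (e f : Matrix m m A) :
    trVec φ (e - f) = trVec φ e - trVec φ f :=
  funext fun j => by simp [trVec, ampTrace_sub]

theorem trVec_zero {m : Type*} [Fintype m] : trVec φ (0 : Matrix m m A) = 0 :=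
  funext fun j => by simp [trVec, ampTrace_zero]

theorem trVec_one {m : Type*} [Fintype m] [DecidableEq m] :
    trVec φ (1 : Matrix m m A) = fun _ => (Fintype.card m : ℝ) :=
  funext fun j => by simp [trVec, ampTrace, (φ j).2.2.2]

variable (φ) in
/-- The vectors of traces of matrix projections, i.e. the image of the positive cone of `K₀`. -/
def IsVal (t : Fin 2 → ℝ) : Prop :=
  ∃ (m : ℕ) (e : Matrix (Fin m) (Fin m) A), IsStarProjection e ∧ trVec φ e = t

theorem isVal_trVec {m : Type*} [Fintype m] {e : Matrix m m A} (he : IsStarProjection e) :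
    IsVal φ (trVec φ e) := by
  classical
  let q := (Fintype.equivFin m).symm
  exact ⟨_, e.submatrix q q, isStarProjection_submatrix he q,
    (trVec_congr (MvN.submatrix he q)).symm⟩

namespace IsVal

theorem zero : IsVal φ 0 := ⟨0, 0, IsStarProjection.zero _, trVec_zero⟩

theorem nonneg {t : Fin 2 → ℝ} (ht : IsVal φ t) (j : Fin 2) : 0 ≤ t j := by
  obtain ⟨m, e, he, rfl⟩ := ht
  exact trVec_nonneg he j

theorem add {s t : Fin 2 → ℝ} (hs : IsVal φ s) (ht : IsVal φ t) : IsVal φ (s + t) := by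
  obtain ⟨m, e, he, rfl⟩ := hs
  obtain ⟨n, f, hf, rfl⟩ := ht
  rw [← trVec_blocks]
  exact isVal_trVec (isStarProjection_fromBlocks he hf)

theorem nsmul {t : Fin 2 → ℝ} (ht : IsVal φ t) (n : ℕ) : IsVal φ (n • t) := by
  induction n with
  | zero => rw [zero_smul]; exact zero
  | succ n ih => rw [succ_nsmul]; exact ih.add ht

end IsVal

variable [PartialOrder A] [StarOrderedRing A] {B : ℕ → StarSubalgebra ℂ A}

/-- Equal trace vectors mean equal classes in K₀, since `Gam` is injective. Equality in the
Grothendieck group is equivalence after adding a common projection R, which `mvN_cancel` removes. -/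
theorem IsEmbeddedAF.mvN (hA : IsEmbeddedAF φ B) {m n : Type*} [Fintype m] [Fintype n]
    {e : Matrix m m A} {f : Matrix n n A} (he : IsStarProjection e) (hf : IsStarProjection f)
    (h : trVec φ e = trVec φ f) : MvN e f := by
  classical
  let q := (Fintype.equivFin m).symm
  let q' := (Fintype.equivFin n).symm
  let E : Proj A := ⟨_, e.submatrix q q, isStarProjection_submatrix he q⟩
  let F : Proj A := ⟨_, f.submatrix q' q', isStarProjection_submatrix hf q'⟩
  have hE : MvN e E.mat := MvN.submatrix he q
  have hF : MvN f F.mat := MvN.submatrix hf q'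
  have hval : ∀ P : Proj A, Gam φ (K0.cls P) = trVec φ P.mat := by
    intro P
    funext j
    change (Algebra.GrothendieckAddGroup.lift (traceV (φ j))) (Algebra.GrothendieckAddGroup.of _) = _
    have := DFunLike.congr_fun (Algebra.GrothendieckAddGroup.lift.symm_apply_apply (traceV (φ j)))
      (V.mk P)
    exact this
  have h1 : K0.cls E = K0.cls F := by
    apply hA.injective
    rw [hval, hval, ← trVec_congr hE, ← trVec_congr hF, h]
  obtain ⟨⟨c, hc0⟩, hc⟩ := (AddLocalization.addMonoidOf (⊤ : AddSubmonoid (V A))).eq_iff_exists.1 h1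
  change c + V.mk E = c + V.mk F at hc
  rw [add_comm c, add_comm c] at hc
  obtain ⟨R, rfl⟩ := Quotient.exists_rep c
  have h2 : MvN (E.add R).mat (F.add R).mat := Quotient.exact hc
  have h3 : MvN E.mat F.mat := mvN_cancel hA.filtration E.isProj F.isProj R.isProj
    (MvN.trans (isStarProjection_fromBlocks E.isProj R.isProj)
      (isStarProjection_fromBlocks F.isProj R.isProj) (Proj.mvN_add E R)
      (MvN.trans (E.add R).isProj (isStarProjection_fromBlocks F.isProj R.isProj) h2
        (Proj.mvN_add F R).symm))
  exact MvN.trans he hf hE (MvN.trans E.isProj hf h3 hF.symm)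

/-- Strict comparison: a difference of values with positive coordinates is a value. -/
theorem IsEmbeddedAF.isVal_sub_of_lt (hA : IsEmbeddedAF φ B) {s t : Fin 2 → ℝ} (hs : IsVal φ s)
    (ht : IsVal φ t) (hst : ∀ j, s j < t j) : IsVal φ (t - s) := by
  obtain ⟨m, e₀, he₀, rfl⟩ := hs
  obtain ⟨n, f₀, hf₀, rfl⟩ := ht
  obtain ⟨k₁, e, heB, he, hee⟩ := exists_mvN_entriesIn hA.filtration he₀
  obtain ⟨k₂, f, hfB, hf, hff⟩ := exists_mvN_entriesIn hA.filtration hf₀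
  rw [trVec_congr hee, trVec_congr hff] at *
  have hmono := hA.filtration.mono
  have hfin := hA.filtration.fin
  have hcmp := fun k => exists_subequiv_or_trace_matrix (B (max (max k₁ k₂) k))
    (heB.mono (hmono ((le_max_left k₁ k₂).trans (le_max_left _ k))))
    (hfB.mono (hmono ((le_max_right k₁ k₂).trans (le_max_left _ k)))) he hf
  by_cases hex : ∃ v : Matrix (Fin m) (Fin n) A, v * vᴴ = e ∧ v * f = v ∧ IsStarProjection (vᴴ * v)
  · obtain ⟨v, hv1, hv2, hv3⟩ := hex
    have hp : IsStarProjection (f - vᴴ * v) :=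
      hv3.sub_of_mul_eq_left hf (by rw [Matrix.mul_assoc, hv2])
    have := isVal_trVec (φ := φ) hp
    rwa [trVec_sub, ← trVec_congr (⟨v, hv1, rfl⟩ : MvN e (vᴴ * v))] at this
  exfalso
  -- If e embeds in f at no stage, every stage carries a tracial state whose value on e exceeds that
  -- on f. A limit T of these satisfies T(f) ≤ T(e), whereas T is a convex combination of the
  -- extreme traces, each strictly larger on f.
  have hcmp' := fun k => (hcmp k).resolve_left
    (fun ⟨v, _, h⟩ => hex ⟨v, h⟩)
  choose τ h1 h2 h3 h4 h5 using hcmp'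
  have hle : ∀ k ≥ max k₁ k₂, B k ≤ B (max (max k₁ k₂) k) := fun k _ => hmono (le_max_right _ _)
  obtain ⟨T, hT, U, hU, -, hlim⟩ := hA.filtration.exists_tracialState τ (max k₁ k₂)
    (fun k _ => h1 k) (fun k _ => h2 k)
    (fun k hk x hx y hy => h3 k x (hle k hk hx) y (hle k hk hy))
    (fun k hk x hx => h4 k x (hle k hk hx))
  have hamp : ∀ {l : ℕ} (x : Matrix (Fin l) (Fin l) A),
      Filter.Tendsto (fun k => (ampTrace (τ k) x).re) U (nhds (ampTrace T x).re) := by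
    intro l x
    exact (Complex.continuous_re.tendsto _).comp (tendsto_finsetSum _ fun i _ => hlim _)
  have hTle : (ampTrace T f).re ≤ (ampTrace T e).re :=
    le_of_tendsto_of_tendsto' (hamp f) (hamp e) fun k => (h5 k).le
  have := hA.finiteDimensional
  obtain ⟨c, hc0, hc1, rfl⟩ := exists_convex_combination hA.enumerates hT
  have hexp : ∀ {l : ℕ} (x : Matrix (Fin l) (Fin l) A),
      (ampTrace (∑ j, (c j : ℂ) • (φ j : A →L[ℂ] ℂ)) x).re = ∑ j, c j * trVec φ x j := by
    intro l x
    simp only [ampTrace, trVec, Fin.sum_univ_two, add_apply, smul_apply, smul_eq_mul,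
      Finset.sum_add_distrib, ← Finset.mul_sum, Complex.add_re, Complex.re_ofReal_mul]
  rw [hexp, hexp, Fin.sum_univ_two, Fin.sum_univ_two] at hTle
  rw [Fin.sum_univ_two] at hc1
  have g0 := hst 0
  have g1 := hst 1
  have a0 := hc0 0
  have a1 := hc0 1
  have b0 := mul_le_mul_of_nonneg_left g0.le a0
  have b1 := mul_le_mul_of_nonneg_left g1.le a1
  rcases a0.lt_or_eq with h | h
  · have := mul_lt_mul_of_pos_left g0 h
    linarith
  · have h' : 0 < c 1 := by linarith
    have := mul_lt_mul_of_pos_left g1 h'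
    linarith

/-- The cone of values is unperforated. -/
theorem IsEmbeddedAF.isVal_sub_of_nsmul (hA : IsEmbeddedAF φ B) {s t u : Fin 2 → ℝ}
    (hs : IsVal φ s) (ht : IsVal φ t) (hu : IsVal φ u) {Q : ℕ} (hQ : 0 < Q)
    (h : Q • t = Q • s + u) : IsVal φ (t - s) := by
  classical
  obtain ⟨m, e₀, he₀, rfl⟩ := hs
  obtain ⟨n, f₀, hf₀, rfl⟩ := ht
  obtain ⟨l, g₀, hg₀, rfl⟩ := hu
  obtain ⟨k₁, e, heB, he, hee⟩ := exists_mvN_entriesIn hA.filtration he₀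
  obtain ⟨k₂, f, hfB, hf, hff⟩ := exists_mvN_entriesIn hA.filtration hf₀
  obtain ⟨k₃, g, hgB, hg, hgg⟩ := exists_mvN_entriesIn hA.filtration hg₀
  rw [trVec_congr hee, trVec_congr hff] at *
  rw [trVec_congr hgg] at h
  have hmono := hA.filtration.mono
  have hrep : ∀ {l : Type} [Fintype l] {k : ℕ} {x : Matrix l l A}, IsStarProjection x →
      EntriesIn (B k) x →
      IsStarProjection (Matrix.blockDiagonal fun _ : Fin Q => x) ∧
      EntriesIn (B k) (Matrix.blockDiagonal fun _ : Fin Q => x) ∧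
      ∀ τ : A →L[ℂ] ℂ, ampTrace τ (Matrix.blockDiagonal fun _ : Fin Q => x)
        = Q * ampTrace τ x := by
    intro l _ k x hx hxB
    refine ⟨⟨?_, ?_⟩, ?_, ?_⟩
    · change _ * _ = _
      rw [← Matrix.blockDiagonal_mul, hx.isIdempotentElem.eq]
    · change Matrix.conjTranspose _ = _
      rw [Matrix.blockDiagonal_conjTranspose]
      congr 1
      funext _
      exact hx.isSelfAdjoint
    · rintro ⟨i, a⟩ ⟨j, b⟩
      rw [Matrix.blockDiagonal_apply]
      split_ifs
      exacts [hxB i j, zero_mem _]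
    · intro τ
      simp only [ampTrace, Fintype.sum_prod_type, Matrix.blockDiagonal_apply_eq]
      rw [Finset.mul_sum]
      simp
  let k := max k₁ (max k₂ k₃)
  have l1 : k₁ ≤ k := le_max_left _ _
  have l2 : k₂ ≤ k := (le_max_left _ _).trans (le_max_right _ _)
  have l3 : k₃ ≤ k := (le_max_right _ _).trans (le_max_right _ _)
  obtain ⟨e1, e2, e3⟩ := hrep he (heB.mono (hmono l1))
  obtain ⟨f1, f2, f3⟩ := hrep hf (hfB.mono (hmono l2))
  have hre : ∀ z : ℂ, ((Q : ℂ) * z).re = (Q : ℝ) * z.re := fun z =>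
    Complex.re_ofReal_mul (Q : ℝ) z
  -- Q copies of f are equivalent to Q copies of e plus g, and this equivalence already occurs at a
  -- finite stage. Every positive trace of that stage is then at least as large on f as on e, so
  -- comparison there can only give an embedding.
  have hmvn : MvN (Matrix.blockDiagonal fun _ : Fin Q => f)
      (Matrix.fromBlocks (Matrix.blockDiagonal fun _ : Fin Q => e) 0 0 g) := by
    refine hA.mvN f1 (isStarProjection_fromBlocks e1 hg) ?_
    rw [trVec_blocks]
    funext j
    have := congrFun h j
    simp only [Pi.add_apply, Pi.smul_apply, nsmul_eq_mul] at this
    simp only [Pi.add_apply, trVec, e3, f3, hre]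
    exact this
  obtain ⟨k', hk, v, hv, hv1, hv2⟩ := exists_entriesIn_of_mvN hA.filtration (k := k) f1
    (isStarProjection_fromBlocks e1 hg) f2
    (.fromBlocks e2 .zero .zero (hgB.mono (hmono l3))) hmvn
  have := hA.filtration.fin k'
  rcases exists_subequiv_or_trace_matrix (B k') (heB.mono (hmono (l1.trans hk)))
    (hfB.mono (hmono (l2.trans hk))) he hf with ⟨w, -, hw1, hw2, hw3⟩ | ⟨τ, -, -, t1, t2, t3⟩
  · have hp : IsStarProjection (f - wᴴ * w) :=
      hw3.sub_of_mul_eq_left hf (by rw [Matrix.mul_assoc, hw2])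
    have := isVal_trVec (φ := φ) hp
    rwa [trVec_sub, ← trVec_congr (⟨w, hw1, rfl⟩ : MvN e (wᴴ * w))] at this
  · exfalso
    have h1 := ampTrace_congr_of_entriesIn t1 hv hv1 hv2
    rw [ampTrace_blocks, e3, f3] at h1
    have h2 : 0 ≤ (ampTrace τ g).re := by
      have h3 : gᴴ * g = g := by
        have a1 : gᴴ = g := hg.isSelfAdjoint
        rw [a1]; exact hg.isIdempotentElem
      rw [← h3]
      simp only [ampTrace, Complex.re_sum, Matrix.mul_apply, map_sum, Matrix.conjTranspose_apply]
      exact Finset.sum_nonneg fun i _ => Finset.sum_nonneg fun j _ =>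
        (t2 _ (hmono (l3.trans hk) (hgB j i))).1
    have h3 := congrArg Complex.re h1
    rw [Complex.add_re, hre, hre] at h3
    have hQ' : (0 : ℝ) < Q := by exact_mod_cast hQ
    nlinarith [mul_lt_mul_of_pos_left t3 hQ']

end Values

end AFAlg

namespace AFAlg

open scoped Matrix ComplexOrder

/-! ### The action of multipliers on trace vectors -/

section Scaling

variable {A : Type*} [CStarAlgebra A] {φ : Fin 2 → tracialStates A}

/-- Diagonal elements of the fundamental group act on the values of the traces. -/
theorem IsVal.mul_of_mem_fundamentalGroup {c : Fin 2 → ℝ}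
    (hc : Matrix.diagonal (fun j => (c j : ℂ)) ∈ fundamentalGroup φ) {t : Fin 2 → ℝ}
    (ht : IsVal φ t) : IsVal φ (c * t) := by
  obtain ⟨k, p, Φ, -, -, -, -, hΦ⟩ := hc
  obtain ⟨m, e, he, rfl⟩ := ht
  -- The map Φ is applied to every entry of e. Its trace under Tr_k is, by the matrix equation for N
  -- = diag(c), the trace of e scaled by c.
  let e' : Matrix (Fin m × Fin k) (Fin m × Fin k) A := fun x y => Φ (e x.1 y.1) x.2 y.2
  have he' : IsStarProjection e' := by
    refine ⟨?_, ?_⟩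
    · change e' * e' = e'
      ext ⟨i, a⟩ ⟨j, b⟩
      rw [Matrix.mul_apply, Fintype.sum_prod_type]
      have h1 : ∀ l, ∑ c, Φ (e i l) a c * Φ (e l j) c b = Φ (e i l * e l j) a b := by
        intro l
        rw [map_mul, Matrix.mul_apply]
      simp only [e', h1]
      rw [← Matrix.sum_apply, ← map_sum, ← Matrix.mul_apply, he.isIdempotentElem.eq]
    · change e'ᴴ = e'
      ext ⟨i, a⟩ ⟨j, b⟩
      have h1 : eᴴ = e := he.isSelfAdjoint
      have h2 : star (e j i) = e i j := by rw [← Matrix.conjTranspose_apply, h1]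
      rw [Matrix.conjTranspose_apply]
      simp only [e']
      rw [← Matrix.conjTranspose_apply, ← h2, map_star]
      rfl
  have h3 : trVec φ e' = c * trVec φ e := by
    funext j
    have h4 : ampTrace (φ j : A →L[ℂ] ℂ) e' = (c j : ℂ) * ampTrace (φ j : A →L[ℂ] ℂ) e := by
      unfold ampTrace
      rw [Fintype.sum_prod_type, Finset.mul_sum]
      refine Finset.sum_congr rfl fun i _ => ?_
      refine (hΦ j (e i i)).trans ?_
      rw [Finset.sum_eq_single j (fun l _ hl => by simp [Matrix.diagonal_apply_ne _ hl]) (by simp)]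
      simp
    simp only [trVec, h4, Pi.mul_apply, Complex.re_ofReal_mul]
  rw [← h3]
  exact isVal_trVec he'

variable (φ) in
/-- The group of differences of values, i.e. the image of `K₀`. -/
def IsDiff (t : Fin 2 → ℝ) : Prop := ∃ s u, IsVal φ s ∧ IsVal φ u ∧ t = s - u

theorem IsVal.isDiff {t : Fin 2 → ℝ} (ht : IsVal φ t) : IsDiff φ t :=
  ⟨t, 0, ht, IsVal.zero, by simp⟩

theorem IsDiff.add {s t : Fin 2 → ℝ} (hs : IsDiff φ s) (ht : IsDiff φ t) : IsDiff φ (s + t) := by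
  obtain ⟨a, b, ha, hb, rfl⟩ := hs
  obtain ⟨c, d, hc, hd, rfl⟩ := ht
  exact ⟨a + c, b + d, ha.add hc, hb.add hd, by abel⟩

theorem IsDiff.neg {t : Fin 2 → ℝ} (ht : IsDiff φ t) : IsDiff φ (-t) := by
  obtain ⟨a, b, ha, hb, rfl⟩ := ht
  exact ⟨b, a, hb, ha, by abel⟩

variable (φ) in
/-- The multipliers of the image of `K₀`. -/
def multipliers : Subring (Fin 2 → ℝ) where
  carrier := {c | ∀ t, IsDiff φ t → IsDiff φ (c * t)}
  mul_mem' := fun {c d} hc hd t ht => by rw [mul_assoc]; exact hc _ (hd _ ht)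
  one_mem' := fun t ht => by rwa [one_mul]
  add_mem' := fun {c d} hc hd t ht => by rw [add_mul]; exact (hc _ ht).add (hd _ ht)
  zero_mem' := fun t _ => by rw [zero_mul]; exact IsVal.zero.isDiff
  neg_mem' := fun {c} hc t ht => by rw [neg_mul]; exact (hc _ ht).neg

theorem mem_multipliers_of_mem_fundamentalGroup {c : Fin 2 → ℝ}
    (hc : Matrix.diagonal (fun j => (c j : ℂ)) ∈ fundamentalGroup φ) : c ∈ multipliers φ := by
  rintro t ⟨s, u, hs, hu, rfl⟩
  exact ⟨c * s, c * u, hs.mul_of_mem_fundamentalGroup hc, hu.mul_of_mem_fundamentalGroup hc,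
    mul_sub _ _ _⟩

variable [PartialOrder A] [StarOrderedRing A] {B : ℕ → StarSubalgebra ℂ A}

theorem IsEmbeddedAF.isVal_of_pos (hA : IsEmbeddedAF φ B) {t : Fin 2 → ℝ} (ht : IsDiff φ t)
    (h : ∀ j, 0 < t j) : IsVal φ t := by
  obtain ⟨s, u, hs, hu, rfl⟩ := ht
  exact hA.isVal_sub_of_lt hu hs fun j => sub_pos.1 (h j)

/-- Positive rational multipliers preserve the positive cone. -/
theorem IsEmbeddedAF.isVal_mul (hA : IsEmbeddedAF φ B) {c : Fin 2 → ℚ} (hc : ∀ j, 0 < c j)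
    (hm : (fun j => (c j : ℝ)) ∈ multipliers φ) {t : Fin 2 → ℝ} (ht : IsVal φ t) :
    IsVal φ ((fun j => (c j : ℝ)) * t) := by
  have hd := hm t ht.isDiff
  have hc' : ∀ j, (0 : ℝ) < c j := fun j => by exact_mod_cast hc j
  -- If multiplication by c acts on t as the single rational c_j, then den(c_j) · (ct) = num(c_j) ·
  -- t is a value, and unperforation divides by the denominator.
  have key : ∀ j, (fun j => (c j : ℝ)) * t = (c j : ℝ) • t →
      IsVal φ ((fun j => (c j : ℝ)) * t) := by
    intro j hj
    obtain ⟨s, u, hs, hu, hsu⟩ := hd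
    rw [hsu]
    refine hA.isVal_sub_of_nsmul hu hs (ht.nsmul (c j).num.toNat) (Q := (c j).den)
      (c j).den_pos ?_
    rw [← sub_eq_iff_eq_add', ← smul_sub, ← hsu, hj]
    have h1 : ((c j).num.toNat : ℝ) = (c j).num := by
      have : (((c j).num.toNat : ℤ) : ℝ) = (c j).num := by
        rw [Int.toNat_of_nonneg (Rat.num_nonneg.2 (hc j).le)]
      exact_mod_cast this
    have h2 : ((c j).den : ℝ) * (c j : ℝ) = (c j).num := by
      have := Rat.den_mul_eq_num (c j)
      exact_mod_cast this
    funext i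
    simp only [Pi.smul_apply, nsmul_eq_mul, smul_eq_mul]
    rw [h1, ← h2, mul_assoc]
  -- When one coordinate of t vanishes, only the other coordinate of c matters, so c acts as a
  -- scalar.
  by_cases h0 : t 0 = 0
  · refine key 1 ?_
    funext i
    fin_cases i <;> simp [h0]
  by_cases h1 : t 1 = 0
  · refine key 0 ?_
    funext i
    fin_cases i <;> simp [h1]
  refine hA.isVal_of_pos hd fun j => mul_pos (hc' j) ?_
  fin_cases j
  · exact (ht.nonneg 0).lt_of_ne' h0
  · exact (ht.nonneg 1).lt_of_ne' h1

end Scaling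

end AFAlg

namespace AFAlg

open scoped Matrix ComplexOrder

/-! ### Systems of matrix units in a product -/

section ProductSystems

variable {X Y : Type*} [CStarAlgebra X] [CStarAlgebra Y] {ι κ : Type*} [Fintype ι]

theorem IsSystem.isStarProjection_source {p : X} {r : ι → κ} {v : ι → X} {h : κ → X}
    (S : IsSystem p r v h) (i : ι) : IsStarProjection (h (r i)) := by
  refine ⟨?_, ?_⟩
  · change h (r i) * h (r i) = h (r i)
    calc h (r i) * h (r i) = star (v i) * v i * h (r i) := by rw [S.source]
      _ = h (r i) := by rw [mul_assoc, S.mul_h, S.source]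
  · rw [isSelfAdjoint_iff, ← S.source i, star_mul, star_star]

theorem IsSystem.isStarProjection_range {p : X} {r : ι → κ} {v : ι → X} {h : κ → X}
    (S : IsSystem p r v h) (i : ι) : IsStarProjection (v i * star (v i)) := by
  refine ⟨?_, ?_⟩
  · change v i * star (v i) * (v i * star (v i)) = _
    rw [mul_assoc, ← mul_assoc (star (v i)), S.source, ← mul_assoc, S.mul_h]
  · rw [isSelfAdjoint_iff, star_mul, star_star]

theorem IsSystem.prod {p : X} {q : Y} {r : ι → κ} {v : ι → X} {u : ι → Y} {h : κ → X} {k : κ → Y}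
    (S : IsSystem p r v h) (T : IsSystem q r u k) :
    IsSystem (p, q) r (fun i => (v i, u i)) (fun c => (h c, k c)) where
  source i := Prod.ext (S.source i) (T.source i)
  orth i j hij := Prod.ext (S.orth i j hij) (T.orth i j hij)
  mul_h i := Prod.ext (S.mul_h i) (T.mul_h i)
  sum := Prod.ext (by simpa [Prod.fst_sum] using S.sum) (by simpa [Prod.snd_sum] using T.sum)

theorem IsSystem.fst {p : X} {q : Y} {r : ι → κ} {V : ι → X × Y} {H : κ → X × Y}
    (S : IsSystem (p, q) r V H) : IsSystem p r (fun i => (V i).1) (fun c => (H c).1) where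
  source i := congrArg Prod.fst (S.source i)
  orth i j hij := congrArg Prod.fst (S.orth i j hij)
  mul_h i := congrArg Prod.fst (S.mul_h i)
  sum := by simpa [Prod.fst_sum] using congrArg Prod.fst S.sum

theorem IsSystem.snd {p : X} {q : Y} {r : ι → κ} {V : ι → X × Y} {H : κ → X × Y}
    (S : IsSystem (p, q) r V H) : IsSystem q r (fun i => (V i).2) (fun c => (H c).2) where
  source i := congrArg Prod.snd (S.source i)
  orth i j hij := congrArg Prod.snd (S.orth i j hij)
  mul_h i := congrArg Prod.snd (S.mul_h i)
  sum := by simpa [Prod.snd_sum] using congrArg Prod.snd S.sum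

theorem IsSystem.fst_mem {p : X} {q : Y} {r : ι → κ} {V : ι → X × Y} {H : κ → X × Y}
    (S : IsSystem (p, q) r V H) {z : X × Y} (hz : z ∈ S.alg) : z.1 ∈ S.fst.alg := by
  rw [IsSystem.mem_alg] at hz
  induction hz using Submodule.span_induction with
  | mem x hx =>
    obtain ⟨i, j, hij, rfl⟩ := hx
    exact S.fst.unit_mem_alg hij
  | zero => exact zero_mem _
  | add x y _ _ h1 h2 => exact add_mem h1 h2
  | smul a x _ h => exact SMulMemClass.smul_mem a h

/-- Two systems of the same shape span in the product the graph of the map matching their units;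
this provides the image of x under that map. -/
theorem IsSystem.exists_mem_of_fst {p : X} {q : Y} {r : ι → κ} {v : ι → X} {u : ι → Y}
    {h : κ → X} {k : κ → Y} (S : IsSystem p r v h) (T : IsSystem q r u k) {x : X}
    (hx : x ∈ S.alg) : ∃ y, (x, y) ∈ (S.prod T).alg := by
  rw [IsSystem.mem_alg] at hx
  induction hx using Submodule.span_induction with
  | mem x hx =>
    obtain ⟨i, j, hij, rfl⟩ := hx
    exact ⟨_, (S.prod T).unit_mem_alg hij⟩
  | zero => exact ⟨0, zero_mem _⟩
  | add x y _ _ h1 h2 =>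
    obtain ⟨a, ha⟩ := h1
    obtain ⟨b, hb⟩ := h2
    exact ⟨a + b, add_mem ha hb⟩
  | smul a x _ h =>
    obtain ⟨b, hb⟩ := h
    exact ⟨a • b, SMulMemClass.smul_mem a hb⟩

theorem IsSystem.conj {q : Y} {r : ι → κ} {u : ι → Y} {k : κ → Y} (T : IsSystem q r u k) {w : Y}
    (h1 : star w * w = q) (h2 : w * star w = q) : IsSystem q r (fun i => w * u i) k where
  source i := by
    rw [star_mul, mul_assoc, ← mul_assoc (star w), h1, T.p_mul, T.source]
  orth i j hij := by
    rw [star_mul, mul_assoc, ← mul_assoc (star w), h1, T.p_mul, T.orth i j hij]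
  mul_h i := by rw [mul_assoc, T.mul_h]
  sum := by
    have h3 : w * q = w := mul_of_star_mul_eq T.isStarProjection h1
    calc ∑ i, w * u i * star (w * u i) = w * (∑ i, u i * star (u i)) * star w := by
          rw [Finset.mul_sum, Finset.sum_mul]
          refine Finset.sum_congr rfl fun i _ => ?_
          rw [star_mul]
          simp only [mul_assoc]
      _ = q := by rw [T.sum, h3, h2]

/-- Conjugating the second system by w composes the partial map with Ad w. This adjusts a new graph
so that it extends an old one. -/
theorem IsSystem.conj_mem {p : X} {q : Y} {r : ι → κ} {v : ι → X} {u : ι → Y}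
    {h : κ → X} {k : κ → Y} (S : IsSystem p r v h) (T : IsSystem q r u k) {w : Y}
    (h1 : star w * w = q) (h2 : w * star w = q) {z : X × Y} (hz : z ∈ (S.prod T).alg) :
    (z.1, w * z.2 * star w) ∈ (S.prod (T.conj h1 h2)).alg := by
  rw [IsSystem.mem_alg] at hz
  induction hz using Submodule.span_induction with
  | mem x hx =>
    obtain ⟨i, j, hij, rfl⟩ := hx
    have := (S.prod (T.conj h1 h2)).unit_mem_alg hij
    convert this using 1
    refine Prod.ext rfl ?_
    change w * (u i * star (u j)) * star w = w * u i * star (w * u j)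
    rw [star_mul]
    simp only [mul_assoc]
  | zero =>
    have h0 := zero_mem (S.prod (T.conj h1 h2)).alg
    simp only [Prod.fst_zero, Prod.snd_zero, mul_zero, zero_mul]
    exact h0
  | add x y _ _ h1 h2 =>
    have := add_mem h1 h2
    simpa [mul_add, add_mul] using this
  | smul a x _ h =>
    have := SMulMemClass.smul_mem a h
    simpa using this

end ProductSystems

/-! ### Graphs of trace-scaling partial isomorphisms -/

section Graphs

variable {A : Type*} [CStarAlgebra A]

/-- `Tr ⊗ τ` as a linear functional on a matrix algebra. -/
noncomputable def trL (τ : A →L[ℂ] ℂ) {n : Type*} [Fintype n] : CStarMatrix n n A →ₗ[ℂ] ℂ where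
  toFun x := ampTrace τ (CStarMatrix.ofMatrix.symm x)
  map_add' x y := by
    simp only [ampTrace, ← Finset.sum_add_distrib, ← map_add]
    rfl
  map_smul' a x := by
    simp only [ampTrace, RingHom.id_apply, smul_eq_mul, Finset.mul_sum]
    refine Finset.sum_congr rfl fun i _ => ?_
    rw [← smul_eq_mul, ← map_smul]
    rfl

theorem trL_mul_comm {τ : A →L[ℂ] ℂ} (hτ : τ ∈ traceSpace A) {n : Type*} [Fintype n]
    (x y : CStarMatrix n n A) : trL τ (x * y) = trL τ (y * x) := by
  change ∑ i, τ (∑ k, x i k * y k i) = ∑ i, τ (∑ k, y i k * x k i)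
  simp only [map_sum]
  rw [Finset.sum_comm]
  exact Finset.sum_congr rfl fun i _ => Finset.sum_congr rfl fun j _ => hτ _ _

theorem isStarProjection_ofMatrix {n : Type*} [Fintype n] {e : CStarMatrix n n A} (he : IsStarProjection e) :
    IsStarProjection (CStarMatrix.ofMatrix.symm e) :=
  ⟨he.isIdempotentElem, he.isSelfAdjoint⟩

theorem continuous_trL (τ : A →L[ℂ] ℂ) {n : Type*} [Fintype n] :
    Continuous (trL τ : CStarMatrix n n A →ₗ[ℂ] ℂ) := by
  refine continuous_finsetSum _ fun i _ => τ.continuous.comp ?_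
  exact (continuous_apply i).comp ((continuous_apply i).comp
    (CStarMatrix.ofMatrixL (m := n) (n := n) (A := A)).symm.continuous)

variable [PartialOrder A] [StarOrderedRing A] {φ : Fin 2 → tracialStates A}
  {B : ℕ → StarSubalgebra ℂ A} {m n : Type*} [Fintype m] [Fintype n]

theorem IsEmbeddedAF.exists_equiv (hA : IsEmbeddedAF φ B) {e f : CStarMatrix n n A}
    (he : IsStarProjection e) (hf : IsStarProjection f)
    (h : ∀ j, trL (φ j : A →L[ℂ] ℂ) e = trL (φ j : A →L[ℂ] ℂ) f) :
    ∃ v, v * star v = e ∧ star v * v = f := by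
  obtain ⟨v, h1, h2⟩ := hA.mvN (isStarProjection_ofMatrix he) (isStarProjection_ofMatrix hf)
    (funext fun j => congrArg Complex.re (h j))
  exact ⟨CStarMatrix.ofMatrix v, h1, h2⟩

theorem IsEmbeddedAF.eq_zero (hA : IsEmbeddedAF φ B) {e : CStarMatrix n n A}
    (he : IsStarProjection e) (h : ∀ j, trL (φ j : A →L[ℂ] ℂ) e = 0) : e = 0 := by
  obtain ⟨v, h1, h2⟩ := hA.exists_equiv he (IsStarProjection.zero _)
    (fun j => by rw [h j, map_zero])
  rw [CStarRing.star_mul_self_eq_zero_iff] at h2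
  rw [← h1, h2, zero_mul]

variable (φ) in
/-- The graph of a *-isomorphism between finite-dimensional *-subalgebras with units `p` and `q`
which multiplies the extreme traces by the factors `c`. -/
structure IsGraph (c : Fin 2 → ℝ) (p : CStarMatrix m m A) (q : CStarMatrix n n A)
    (G : NonUnitalStarSubalgebra ℂ (CStarMatrix m m A × CStarMatrix n n A)) : Prop where
  fin : FiniteDimensional ℂ G
  proj : IsStarProjection (p, q)
  mem : (p, q) ∈ G
  unit : ∀ z ∈ G, (p, q) * z = z
  tr : ∀ z ∈ G, ∀ j, trL (φ j : A →L[ℂ] ℂ) z.2 = c j * trL (φ j : A →L[ℂ] ℂ) z.1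

variable [DecidableEq m] [DecidableEq n] {c : Fin 2 → ℝ} {p : CStarMatrix m m A}
  {q : CStarMatrix n n A}

/-- Scaling of the traces needs checking only on the diagonal units: for a ≠ b the trace property
turns V_a V_b* into V_b* V_a = 0 in both coordinates. -/
theorem IsSystem.isGraph {ι κ : Type*} [Fintype ι] {r : ι → κ}
    {V : ι → CStarMatrix m m A × CStarMatrix n n A} {H : κ → CStarMatrix m m A × CStarMatrix n n A}
    (S : IsSystem (p, q) r V H)
    (h : ∀ i j, trL (φ j : A →L[ℂ] ℂ) ((V i).2 * star (V i).2)
      = c j * trL (φ j : A →L[ℂ] ℂ) ((V i).1 * star (V i).1)) :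
    IsGraph φ c p q S.alg where
  fin := inferInstance
  proj := S.isStarProjection
  mem := S.p_mem_alg
  unit z hz := S.p_mul_of_mem hz
  tr z hz j := by
    rw [IsSystem.mem_alg] at hz
    induction hz using Submodule.span_induction with
    | mem x hx =>
      obtain ⟨a, b, -, rfl⟩ := hx
      by_cases hab : a = b
      · subst hab
        exact h a j
      · have h1 := congrArg Prod.fst (S.orth b a (Ne.symm hab))
        have h2 := congrArg Prod.snd (S.orth b a (Ne.symm hab))
        change trL _ ((V a).2 * star (V b).2) = _ * trL _ ((V a).1 * star (V b).1)
        rw [trL_mul_comm (φ j).2.1, trL_mul_comm (φ j).2.1 (V a).1]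
        change star (V b).1 * (V a).1 = 0 at h1
        change star (V b).2 * (V a).2 = 0 at h2
        rw [h1, h2, map_zero, map_zero, mul_zero]
    | zero => simp
    | add x y _ _ h1 h2 => rw [Prod.snd_add, Prod.fst_add, map_add, map_add, h1, h2, mul_add]
    | smul a x _ h1 =>
      rw [Prod.smul_snd, Prod.smul_fst, map_smul, map_smul, h1, smul_eq_mul, smul_eq_mul,
        mul_left_comm]

/-- The scaling of traces makes a graph single-valued. A minimal projection g of G has nonzero first
coordinate, since otherwise its second coordinate would have zero traces and vanish. For z = (0, y),
the scalar in g z*z g = ag must be 0 by the first coordinate, so z annihilates every g of a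
decomposition of the unit. -/
theorem IsGraph.eq_zero (hA : IsEmbeddedAF φ B)
    {G : NonUnitalStarSubalgebra ℂ (CStarMatrix m m A × CStarMatrix n n A)}
    (hG : IsGraph φ c p q G) {y : CStarMatrix n n A} (hy : ((0 : CStarMatrix m m A), y) ∈ G) :
    y = 0 := by
  have := hG.fin
  obtain ⟨ι, _, g, hg, ho, hs⟩ := exists_decomposition G hG.mem hG.proj
  have hg0 : ∀ i, (g i).1 ≠ 0 := by
    intro i h
    apply (hg i).ne_zero
    refine Prod.ext h ?_
    refine hA.eq_zero ⟨congrArg Prod.snd (hg i).proj.isIdempotentElem,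
      congrArg Prod.snd (hg i).proj.isSelfAdjoint⟩ fun j => ?_
    rw [hG.tr _ (hg i).mem j, h, map_zero, mul_zero]
  have hz : ∀ i, ((0 : CStarMatrix m m A), y) * g i = 0 := by
    intro i
    obtain ⟨a, ha⟩ := (hg i).corner _ (mul_mem (star_mem hy) hy)
    have h1 : a = 0 := by
      have := congrArg Prod.fst ha
      simp only [Prod.fst_mul, Prod.fst_star, star_zero, mul_zero, zero_mul, Prod.smul_fst] at this
      exact (smul_eq_zero.1 this.symm).resolve_right (hg0 i)
    rw [h1, zero_smul] at ha
    rw [← CStarRing.star_mul_self_eq_zero_iff, star_mul, (hg i).proj.isSelfAdjoint.star_eq, ← ha]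
    simp only [mul_assoc]
  have h2 : ((0 : CStarMatrix m m A), y) = 0 := by
    rw [← mul_right_of_unit hG.proj.isSelfAdjoint hG.unit hy, ← hs, Finset.mul_sum]
    exact Finset.sum_eq_zero fun i _ => hz i
  exact congrArg Prod.snd h2

end Graphs

end AFAlg

namespace AFAlg

open scoped Matrix ComplexOrder

/-! ### Conjugacy of systems of the same shape -/

section Intertwiners

variable {X : Type*} [CStarAlgebra X] {ι κ : Type*} [Fintype ι] {p q : X} {r : ι → κ}
  {v w : ι → X} {h k : κ → X}

/-- With U the displayed sum, orthogonality leaves Uv_i = w_i z*, where z identifies the source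
projections. Hence U v_i v_j* U* = w_i z*z w_j* = w_i w_j*. -/
theorem IsSystem.intertwiner_apply (S : IsSystem p r v h) (T : IsSystem q r w k) {z : κ → X}
    (hz1 : ∀ i, z (r i) * star (z (r i)) = h (r i)) (hz2 : ∀ i, star (z (r i)) * z (r i) = k (r i))
    {i j : ι} (hij : r i = r j) :
    (∑ l, w l * star (z (r l)) * star (v l)) * (v i * star (v j)) *
      star (∑ l, w l * star (z (r l)) * star (v l)) = w i * star (w j) := by
  classical
  have key : ∀ i, (∑ l, w l * star (z (r l)) * star (v l)) * v i = w i * star (z (r i)) := by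
    intro i
    rw [Finset.sum_mul, Finset.sum_eq_single i]
    · have h1 := congrArg star (mul_of_mul_star_eq (S.isStarProjection_source i) (hz1 i))
      rw [star_mul, (S.isStarProjection_source i).isSelfAdjoint.star_eq] at h1
      rw [mul_assoc, S.source, mul_assoc, h1]
    · intro l _ hl
      rw [mul_assoc, S.orth l i hl, mul_zero]
    · simp
  have h2 := congrArg star (key j)
  rw [star_mul, star_mul, star_star] at h2
  rw [← mul_assoc, key, mul_assoc, h2, hij, mul_assoc, ← mul_assoc (star (z (r j))), hz2,
    T.h_mul]

theorem IsSystem.intertwiner_mul_star (S : IsSystem p r v h) (T : IsSystem q r w k) {z : κ → X}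
    (hz1 : ∀ i, z (r i) * star (z (r i)) = h (r i))
    (hz2 : ∀ i, star (z (r i)) * z (r i) = k (r i)) :
    (∑ l, w l * star (z (r l)) * star (v l)) * star (∑ l, w l * star (z (r l)) * star (v l)) = q := by
  have h1 : (∑ l, w l * star (z (r l)) * star (v l)) * p
      = ∑ l, w l * star (z (r l)) * star (v l) := by
    rw [Finset.sum_mul]
    exact Finset.sum_congr rfl fun l _ => by rw [mul_assoc, S.mul_p]
  generalize hU : ∑ l, w l * star (z (r l)) * star (v l) = U at h1 ⊢
  calc U * star U = U * (∑ i, v i * star (v i)) * star U := by rw [S.sum, h1]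
    _ = ∑ i, U * (v i * star (v i)) * star U := by rw [Finset.mul_sum, Finset.sum_mul]
    _ = ∑ i, w i * star (w i) := Finset.sum_congr rfl fun i _ => by
      rw [← hU]
      exact S.intertwiner_apply T hz1 hz2 rfl
    _ = q := T.sum

/-- Two systems of the same shape with equivalent source projections are conjugate. -/
theorem IsSystem.exists_intertwiner (S : IsSystem p r v h) (T : IsSystem q r w k)
    (hz : ∀ i, ∃ z, z * star z = h (r i) ∧ star z * z = k (r i)) :
    ∃ U, star U * U = p ∧ U * star U = q ∧
      ∀ i j, r i = r j → U * (v i * star (v j)) * star U = w i * star (w j) := by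
  -- Labels outside the range of r do not enter the formula, so z may be 0 there.
  have hz' : ∀ c, ∃ z, (∃ i, r i = c) → z * star z = h c ∧ star z * z = k c := by
    intro c
    by_cases hc : ∃ i, r i = c
    · obtain ⟨i, rfl⟩ := hc
      obtain ⟨z, hz⟩ := hz i
      exact ⟨z, fun _ => hz⟩
    · exact ⟨0, fun h => absurd h hc⟩
  choose z hz using hz'
  have h1 := fun i => (hz (r i) ⟨i, rfl⟩).1
  have h2 := fun i => (hz (r i) ⟨i, rfl⟩).2
  refine ⟨∑ l, w l * star (z (r l)) * star (v l), ?_, S.intertwiner_mul_star T h1 h2,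
    fun i j hij => S.intertwiner_apply T h1 h2 hij⟩
  have h3 := T.intertwiner_mul_star S (z := fun c => star (z c))
    (fun i => by rw [star_star, h2]) (fun i => by rw [star_star, h1])
  have h4 : star (∑ l, w l * star (z (r l)) * star (v l))
      = ∑ l, v l * star (star (z (r l))) * star (w l) := by
    rw [star_sum]
    refine Finset.sum_congr rfl fun l _ => ?_
    rw [star_mul, star_mul, star_star, star_star, mul_assoc]
  rw [← h4, star_star] at h3
  exact h3

/-- Adding 1 - p as a one-dimensional block, or a zero one, lets `exists_unitary`, stated for
systems with unit 1, be used for arbitrary p. -/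
theorem IsSystem.unitization (S : IsSystem p r v h) :
    IsSystem (1 : X) (Option.map r) (fun o => o.elim (1 - p) v) (fun o => o.elim (1 - p) h) where
  source
    | none => by
      have := S.isStarProjection.one_sub
      simp [this.isSelfAdjoint.star_eq, this.isIdempotentElem.eq, -star_sub]
    | some i => S.source i
  orth
    | none, none, h => absurd rfl h
    | none, some j, _ => by
      simp [S.p_star, sub_mul, S.p_mul]
    | some i, none, _ => by
      simp [mul_sub, S.mul_p]
    | some i, some j, hij => S.orth i j fun h => hij (congrArg some h)
  mul_h
    | none => S.isStarProjection.one_sub.isIdempotentElem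
    | some i => S.mul_h i
  sum := by
    have := S.isStarProjection.one_sub
    rw [Fintype.sum_option]
    simp only [Option.elim_none, Option.elim_some, S.sum]
    rw [this.isSelfAdjoint.star_eq, this.isIdempotentElem.eq, sub_add_cancel]

theorem IsSystem.alg_le_unitization (S : IsSystem p r v h) : S.alg ≤ S.unitization.alg := by
  intro x hx
  rw [IsSystem.mem_alg] at hx ⊢
  refine Submodule.span_mono ?_ hx
  rintro _ ⟨i, j, hij, rfl⟩
  exact ⟨some i, some j, congrArg some hij, rfl⟩

end Intertwiners

/-! ### Splitting projections and moving subalgebras into the filtration -/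

section Slices

variable {A : Type*} [CStarAlgebra A]

theorem isStarProjection_blockDiagonal' {ι : Type*} [Fintype ι] [DecidableEq ι] {n : ι → Type*}
    [∀ i, Fintype (n i)] {e : ∀ i, Matrix (n i) (n i) A} (he : ∀ i, IsStarProjection (e i)) :
    IsStarProjection (Matrix.blockDiagonal' e) := by
  refine ⟨?_, ?_⟩
  · change _ * _ = _
    rw [← Matrix.blockDiagonal'_mul]
    exact congrArg _ (funext fun i => (he i).isIdempotentElem)
  · change Matrix.conjTranspose _ = _
    rw [Matrix.blockDiagonal'_conjTranspose]
    exact congrArg _ (funext fun i => (he i).isSelfAdjoint)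

theorem trVec_blockDiagonal' {φ : Fin 2 → tracialStates A} {ι : Type*} [Fintype ι] [DecidableEq ι]
    {n : ι → Type*} [∀ i, Fintype (n i)] (e : ∀ i, Matrix (n i) (n i) A) :
    trVec φ (Matrix.blockDiagonal' e) = ∑ i, trVec φ (e i) := by
  funext j
  simp [trVec, ampTrace, Fintype.sum_sigma, Finset.sum_apply]

/-- The `i`-th block column. -/
def slice {R m ι : Type*} {n : ι → Type*} (w : Matrix m (Σ i, n i) R) (i : ι) : Matrix m (n i) R :=
  w.submatrix id (Sigma.mk i)

theorem sum_slice {m ι : Type*} [Fintype ι] {n : ι → Type*} [∀ i, Fintype (n i)]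
    (w : Matrix m (Σ i, n i) A) : ∑ i, slice w i * (slice w i)ᴴ = w * wᴴ := by
  ext a b
  simp [Matrix.sum_apply, Matrix.mul_apply, Fintype.sum_sigma, slice]

theorem slice_mul {m ι : Type*} [Fintype m] [DecidableEq ι] {n : ι → Type*}
    {w : Matrix m (Σ i, n i) A} {e : ∀ i, Matrix (n i) (n i) A}
    (h : wᴴ * w = Matrix.blockDiagonal' e) (i : ι) : (slice w i)ᴴ * slice w i = e i := by
  ext a b
  have := congrFun (congrFun h ⟨i, a⟩) ⟨i, b⟩
  rw [Matrix.blockDiagonal'_apply_eq] at this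
  exact this

theorem slice_mul_of_ne {m ι : Type*} [Fintype m] [DecidableEq ι] {n : ι → Type*}
    {w : Matrix m (Σ i, n i) A} {e : ∀ i, Matrix (n i) (n i) A}
    (h : wᴴ * w = Matrix.blockDiagonal' e) {i j : ι} (hij : i ≠ j) :
    (slice w i)ᴴ * slice w j = 0 := by
  ext a b
  have := congrFun (congrFun h ⟨i, a⟩) ⟨j, b⟩
  rw [Matrix.blockDiagonal'_apply_ne _ _ _ hij] at this
  exact this

/-- Replacing v by evf secures the support relations algebraically, so that rectangular matrices
need no norm. -/
theorem MvN.exists_mul_eq {m n : Type*} [Fintype m] [Fintype n] {e : Matrix m m A}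
    {f : Matrix n n A} (he : IsStarProjection e) (hf : IsStarProjection f) (h : MvN e f) :
    ∃ v : Matrix m n A, v * vᴴ = e ∧ vᴴ * v = f ∧ e * v = v ∧ v * f = v := by
  obtain ⟨v, h1, h2⟩ := h
  have h3 : f * f = f := hf.isIdempotentElem
  have h4 : fᴴ = f := hf.isSelfAdjoint
  have h5 : e * e = e := he.isIdempotentElem
  have h6 : eᴴ = e := he.isSelfAdjoint
  refine ⟨e * v * f, ?_, ?_, by rw [← Matrix.mul_assoc, ← Matrix.mul_assoc, h5],
    by rw [Matrix.mul_assoc, h3]⟩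
  · calc e * v * f * (e * v * f)ᴴ = e * v * f * (f * (vᴴ * e)) := by
          rw [Matrix.conjTranspose_mul, Matrix.conjTranspose_mul, h4, h6]
      _ = e * (v * (f * f) * vᴴ) * e := by simp only [Matrix.mul_assoc]
      _ = e * ((v * vᴴ) * (v * vᴴ)) * e := by rw [h3, ← h2]; simp only [Matrix.mul_assoc]
      _ = e := by rw [h1, h5, h5, h5]
  · calc (e * v * f)ᴴ * (e * v * f) = f * (vᴴ * e) * (e * v * f) := by
          rw [Matrix.conjTranspose_mul, Matrix.conjTranspose_mul, h4, h6]
      _ = f * (vᴴ * (e * e) * v) * f := by simp only [Matrix.mul_assoc]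
      _ = f * ((vᴴ * v) * (vᴴ * v)) * f := by rw [h5, ← h1]; simp only [Matrix.mul_assoc]
      _ = f := by rw [h2, h3, h3, h3]

theorem trVec_star_mul {n : Type*} [Fintype n] {φ : Fin 2 → tracialStates A} (v : CStarMatrix n n A) :
    trVec φ (CStarMatrix.ofMatrix.symm (star v * v))
      = trVec φ (CStarMatrix.ofMatrix.symm (v * star v)) :=
  funext fun j => congrArg Complex.re (trL_mul_comm (φ j).2.1 (star v) v)

theorem trVec_sum {n ι : Type*} [Fintype n] [Fintype ι] {φ : Fin 2 → tracialStates A}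
    (f : ι → CStarMatrix n n A) :
    trVec φ (CStarMatrix.ofMatrix.symm (∑ i, f i))
      = ∑ i, trVec φ (CStarMatrix.ofMatrix.symm (f i)) := by
  funext j
  rw [Finset.sum_apply]
  change (trL (φ j : A →L[ℂ] ℂ) (∑ i, f i)).re = ∑ i, (trL (φ j : A →L[ℂ] ℂ) (f i)).re
  rw [map_sum, Complex.re_sum]

variable [PartialOrder A] [StarOrderedRing A] {φ : Fin 2 → tracialStates A}
  {B : ℕ → StarSubalgebra ℂ A}

/-- A projection splits according to any decomposition of its vector of traces. -/
theorem IsEmbeddedAF.exists_split (hA : IsEmbeddedAF φ B) {n : Type*} [Fintype n]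
    {q : Matrix n n A} (hq : IsStarProjection q) {ι : Type*} [Fintype ι] {t : ι → Fin 2 → ℝ}
    (ht : ∀ i, IsVal φ (t i)) (hs : ∑ i, t i = trVec φ q) :
    ∃ f : ι → Matrix n n A, (∀ i, IsStarProjection (f i)) ∧ (∀ i j, i ≠ j → f i * f j = 0) ∧
      ∑ i, f i = q ∧ ∀ i, trVec φ (f i) = t i := by
  classical
  choose d e he htr using ht
  have hE := isStarProjection_blockDiagonal' he
  -- The block sum of projections realizing the t_i has the trace vector of q, hence is equivalent
  -- to q. The block columns of the implementing w have orthogonal ranges, and these cut q into the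
  -- desired pieces.
  obtain ⟨w, h1, h2, h3, -⟩ := MvN.exists_mul_eq hq hE
    (hA.mvN hq hE (by rw [trVec_blockDiagonal', ← hs]; simp only [htr]))
  have h4 : ∀ i, q * slice w i = slice w i := fun i => congrArg (fun x => slice x i) h3
  have h5 : ∀ i j, i ≠ j → slice w i * (slice w i)ᴴ * (slice w j * (slice w j)ᴴ) = 0 := by
    intro i j hij
    rw [Matrix.mul_assoc, ← Matrix.mul_assoc _ (slice w j), slice_mul_of_ne h2 hij,
      Matrix.zero_mul, Matrix.mul_zero]
  refine ⟨fun i => slice w i * (slice w i)ᴴ, fun i => ⟨?_, ?_⟩, h5, (sum_slice w).trans h1,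
    fun i => ?_⟩
  · change _ * _ = _
    have h6 : q * (slice w i * (slice w i)ᴴ) = slice w i * (slice w i)ᴴ := by
      rw [← Matrix.mul_assoc, h4]
    rw [← h1, ← sum_slice w, Finset.sum_mul, Finset.sum_eq_single i (fun j _ hj => h5 j i hj)
      (by simp)] at h6
    exact h6
  · change Matrix.conjTranspose _ = _
    rw [Matrix.conjTranspose_mul, Matrix.conjTranspose_conjTranspose]
  · rw [← htr i]
    exact trVec_congr ⟨_, rfl, slice_mul h2 i⟩

/-- A finite-dimensional subalgebra is unitarily equivalent to one in the filtration. -/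
theorem IsSystem.exists_unitary (hA : IsEmbeddedAF φ B) {m : Type*} [Fintype m] [DecidableEq m]
    {ι κ : Type*} [Fintype ι] {r : ι → κ} {v : ι → CStarMatrix m m A}
    {h : κ → CStarMatrix m m A} (S : IsSystem 1 r v h) :
    ∃ (U : CStarMatrix m m A) (k : ℕ), star U * U = 1 ∧ U * star U = 1 ∧
      ∀ x ∈ S.alg, U * x * star U ∈ matSubalgebra (B k) m := by
  classical
  -- Each source projection is replaced by an equivalent one over some stage. Labels not attained by
  -- r receive the projection 0 as a default.
  have hP : ∀ c, ∃ k, ∃ P : Matrix m m A, EntriesIn (B k) P ∧ IsStarProjection P ∧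
      ((∃ i, r i = c) → MvN (CStarMatrix.ofMatrix.symm (h c)) P) := by
    intro c
    by_cases hc : ∃ i, r i = c
    · obtain ⟨i, rfl⟩ := hc
      obtain ⟨k, P, h1, h2, h3⟩ := exists_mvN_entriesIn hA.filtration
        (isStarProjection_ofMatrix (S.isStarProjection_source i))
      exact ⟨k, P, h1, h2, fun _ => h3⟩
    · exact ⟨0, 0, .zero, .zero _, fun h => absurd h hc⟩
  choose k P hPB hPp hPe using hP
  set K := Finset.univ.sup fun i => k (r i)
  have hPB' : ∀ i, EntriesIn (B K) (P (r i)) := fun i =>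
    (hPB (r i)).mono (hA.filtration.mono (Finset.le_sup (f := fun i => k (r i)) (Finset.mem_univ i)))
  have hE := isStarProjection_blockDiagonal' fun i => hPp (r i)
  have hEB : EntriesIn (B K) (Matrix.blockDiagonal' fun i => P (r i)) := by
    rintro ⟨i, a⟩ ⟨j, b⟩
    rw [Matrix.blockDiagonal'_apply]
    split_ifs with hij
    · exact hPB' i a _
    · exact zero_mem _
  have htr : trVec φ (1 : Matrix m m A) = trVec φ (Matrix.blockDiagonal' fun i => P (r i)) := by
    have h1 := trVec_sum (φ := φ) fun i => v i * star (v i)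
    rw [S.sum] at h1
    rw [trVec_blockDiagonal']
    refine h1.trans (Finset.sum_congr rfl fun i _ => ?_)
    rw [← trVec_star_mul, S.source]
    exact trVec_congr (hPe (r i) ⟨i, rfl⟩)
  -- The unit is equivalent, at a finite stage, to the block sum of the P (r i). The block columns
  -- of w then form a system with entries in that stage and of the same shape as S, to which S is
  -- conjugate.
  obtain ⟨k', -, w, hw, hw1, hw2⟩ := exists_entriesIn_of_mvN hA.filtration (k := K)
    (IsStarProjection.one _) hE .one hEB (hA.mvN (IsStarProjection.one _) hE htr)
  let T : IsSystem (1 : CStarMatrix m m A) r (fun i => CStarMatrix.ofMatrix (slice w i))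
      (fun c => CStarMatrix.ofMatrix (P c)) :=
    { source := fun i => slice_mul hw2 i
      orth := fun i j hij => slice_mul_of_ne hw2 hij
      mul_h := fun i => mul_of_star_mul_eq (M := CStarMatrix m m A)
        ⟨(hPp (r i)).isIdempotentElem, (hPp (r i)).isSelfAdjoint⟩ (slice_mul hw2 i)
      sum := (sum_slice w).trans hw1 }
  obtain ⟨U, hU1, hU2, hU3⟩ := S.exists_intertwiner T fun i => by
    obtain ⟨z, h1, h2⟩ := hPe (r i) ⟨i, rfl⟩
    exact ⟨CStarMatrix.ofMatrix z, h1, h2⟩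
  refine ⟨U, k', hU1, hU2, fun x hx => ?_⟩
  rw [IsSystem.mem_alg] at hx
  induction hx using Submodule.span_induction with
  | mem x hx =>
    obtain ⟨i, j, hij, rfl⟩ := hx
    rw [hU3 i j hij]
    have hs : ∀ i, CStarMatrix.ofMatrix (slice w i) ∈ matSubalgebra (B k') m :=
      fun i a b => hw a ⟨i, b⟩
    exact mul_mem (hs i) (star_mem (hs j))
  | zero => rw [mul_zero, zero_mul]; exact zero_mem _
  | add x y _ _ h1 h2 => rw [mul_add, add_mul]; exact add_mem h1 h2
  | smul a x _ h1 => rw [mul_smul_comm, smul_mul_assoc]; exact SMulMemClass.smul_mem a h1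

/-- Local approximation by finite-dimensional subalgebras containing a given one. -/
theorem IsSystem.exists_approximation (hA : IsEmbeddedAF φ B) {m : Type*} [Fintype m]
    [DecidableEq m] {ι κ : Type*} [Fintype ι] {r : ι → κ} {p : CStarMatrix m m A}
    {v : ι → CStarMatrix m m A} {h : κ → CStarMatrix m m A} (S : IsSystem p r v h)
    {x : CStarMatrix m m A} (hx : p * x * p = x) {ε : ℝ} (hε : 0 < ε) :
    ∃ D : NonUnitalStarSubalgebra ℂ (CStarMatrix m m A), FiniteDimensional ℂ D ∧ S.alg ≤ D ∧
      (∀ y ∈ D, p * y = y) ∧ ∃ y ∈ D, ‖y - x‖ < ε := by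
  obtain ⟨U, k₀, hU1, hU2, hU⟩ := S.unitization.exists_unitary hA
  obtain ⟨k₁, y, hy, hyx⟩ := (hA.filtration.matrix m).exists_near (U * x * star U) hε
  set k := max k₀ k₁
  have hmono := (hA.filtration.matrix m).mono
  have hU' : ∀ x ∈ S.alg, U * x * star U ∈ matSubalgebra (B k) m := fun x hx =>
    hmono (le_max_left k₀ k₁) (hU x (S.alg_le_unitization hx))
  have hyk : y ∈ matSubalgebra (B k) m := hmono (le_max_right k₀ k₁) hy
  have hps := S.p_star
  have hpp := S.isStarProjection.isIdempotentElem.eq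
  -- The part of U*M_m(B_k)U inside the corner of p. It contains the given algebra because U moves
  -- that algebra into the filtration, and it contains the compression by p of U*yU, which
  -- approximates x.
  let D : NonUnitalStarSubalgebra ℂ (CStarMatrix m m A) :=
    { carrier := {y | p * y = y ∧ U * y * star U ∈ matSubalgebra (B k) m ∧ y * p = y}
      add_mem' := by
        rintro a b ⟨h1, h2, h3⟩ ⟨h4, h5, h6⟩
        exact ⟨by rw [mul_add, h1, h4], by rw [mul_add, add_mul]; exact add_mem h2 h5,
          by rw [add_mul, h3, h6]⟩
      zero_mem' := ⟨mul_zero _, by rw [mul_zero, zero_mul]; exact zero_mem _, zero_mul _⟩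
      mul_mem' := by
        rintro a b ⟨h1, h2, h3⟩ ⟨h4, h5, h6⟩
        refine ⟨by rw [← mul_assoc, h1], ?_, by rw [mul_assoc, h6]⟩
        have := mul_mem h2 h5
        rwa [show U * a * star U * (U * b * star U) = U * (a * b) * star U by
          rw [mul_assoc (U * a), ← mul_assoc (star U), ← mul_assoc (star U), hU1, one_mul]
          simp only [mul_assoc]] at this
      smul_mem' := by
        rintro c a ⟨h1, h2, h3⟩
        exact ⟨by rw [mul_smul_comm, h1],
          by rw [mul_smul_comm, smul_mul_assoc]; exact SMulMemClass.smul_mem c h2,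
          by rw [smul_mul_assoc, h3]⟩
      star_mem' := by
        rintro a ⟨h1, h2, h3⟩
        refine ⟨?_, ?_, ?_⟩
        · have := congrArg star h3
          rwa [star_mul, hps] at this
        · have := star_mem h2
          rwa [star_mul, star_mul, star_star, ← mul_assoc] at this
        · have := congrArg star h1
          rwa [star_mul, hps] at this }
  refine ⟨D, ?_, ?_, fun y hy => hy.1, p * (star U * y * U) * p, ⟨?_, ?_, ?_⟩, ?_⟩
  · have := hA.filtration.fin k
    have := finiteDimensional_matSubalgebra (B k) m
    let f : D →ₗ[ℂ] matSubalgebra (B k) m :=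
      { toFun := fun y => ⟨U * y * star U, y.2.2.1⟩
        map_add' := fun a b => Subtype.ext (by simp [mul_add, add_mul])
        map_smul' := fun a b => Subtype.ext (by simp) }
    refine FiniteDimensional.of_injective f fun a b hab => ?_
    have h1 : U * (a : CStarMatrix m m A) * star U = U * b * star U := congrArg Subtype.val hab
    have h2 := congrArg (fun t => star U * t * U) h1
    have h3 : ∀ t, star U * (U * t * star U) * U = t := by
      intro t
      rw [← mul_assoc, ← mul_assoc, hU1, one_mul, mul_assoc, hU1, mul_one]
    simp only [h3] at h2
    exact Subtype.ext h2
  · intro a ha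
    exact ⟨S.p_mul_of_mem ha, hU' a ha,
      mul_right_of_unit S.p_star (fun x hx => S.p_mul_of_mem hx) ha⟩
  · simp only [← mul_assoc, hpp]
  · have h1 := hU' p S.p_mem_alg
    have h2 := mul_mem (mul_mem h1 hyk) h1
    simpa only [mul_assoc] using h2
  · rw [mul_assoc, hpp]
  · have hU1' : ‖U‖ ≤ 1 := by
      have : ‖U‖ * ‖U‖ = ‖(1 : CStarMatrix m m A)‖ := by rw [← CStarRing.norm_star_mul_self, hU1]
      nlinarith [norm_isStarProjection_le (IsStarProjection.one (CStarMatrix m m A)), norm_nonneg U]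
    have hp1 := norm_isStarProjection_le S.isStarProjection
    have e1 : p * (star U * y * U) * p - x = p * (star U * (y - U * x * star U) * U) * p := by
      rw [mul_sub, sub_mul, mul_sub, sub_mul]
      congr 1
      rw [show star U * (U * x * star U) * U = x by
        rw [← mul_assoc, ← mul_assoc, hU1, one_mul, mul_assoc, hU1, mul_one], hx]
    rw [e1]
    refine lt_of_le_of_lt ?_ hyx
    calc ‖p * (star U * (y - U * x * star U) * U) * p‖
        ≤ ‖p‖ * (‖star U‖ * ‖y - U * x * star U‖ * ‖U‖) * ‖p‖ := by
          refine (norm_mul_le _ _).trans (mul_le_mul_of_nonneg_right ?_ (norm_nonneg _))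
          refine (norm_mul_le _ _).trans (mul_le_mul_of_nonneg_left ?_ (norm_nonneg _))
          refine (norm_mul_le _ _).trans (mul_le_mul_of_nonneg_right ?_ (norm_nonneg _))
          exact norm_mul_le _ _
      _ ≤ 1 * (1 * ‖y - U * x * star U‖ * 1) * 1 := by
          rw [norm_star]
          gcongr
      _ = ‖y - U * x * star U‖ := by ring

end Slices

end AFAlg

namespace AFAlg

open scoped Matrix ComplexOrder

/-! ### Enlarging a graph -/

section Step

variable {A : Type*} [CStarAlgebra A] {φ : Fin 2 → tracialStates A} {m n : Type*} [Fintype m]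
  [Fintype n] {c : Fin 2 → ℝ} {p : CStarMatrix m m A} {q : CStarMatrix n n A}
  {G : NonUnitalStarSubalgebra ℂ (CStarMatrix m m A × CStarMatrix n n A)}

theorem trL_eq_mul_of_trVec_eq {e : CStarMatrix m m A} {f : CStarMatrix n n A}
    (he : IsStarProjection e) (hf : IsStarProjection f)
    (h : trVec φ (CStarMatrix.ofMatrix.symm f) = c * trVec φ (CStarMatrix.ofMatrix.symm e))
    (j : Fin 2) : trL (φ j : A →L[ℂ] ℂ) f = c j * trL (φ j : A →L[ℂ] ℂ) e := by
  have h1 : trL (φ j : A →L[ℂ] ℂ) f = _ := ampTrace_eq_trVec (isStarProjection_ofMatrix hf) j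
  have h2 : trL (φ j : A →L[ℂ] ℂ) e = _ := ampTrace_eq_trVec (isStarProjection_ofMatrix he) j
  rw [h1, h2, h, Pi.mul_apply, Complex.ofReal_mul]

theorem IsGraph.trVec_eq (hG : IsGraph φ c p q G) {z : CStarMatrix m m A × CStarMatrix n n A}
    (hz : z ∈ G) : trVec φ (CStarMatrix.ofMatrix.symm z.2)
      = c * trVec φ (CStarMatrix.ofMatrix.symm z.1) := by
  funext j
  have := congrArg Complex.re (hG.tr z hz j)
  rw [Complex.re_ofReal_mul] at this
  exact this

variable [PartialOrder A] [StarOrderedRing A] {B : ℕ → StarSubalgebra ℂ A} [DecidableEq m]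
  [DecidableEq n]

theorem IsGraph.eq_of_mem (hA : IsEmbeddedAF φ B) (hG : IsGraph φ c p q G)
    {x x' : CStarMatrix m m A} {y y' : CStarMatrix n n A} (h : (x, y) ∈ G) (h' : (x', y') ∈ G)
    (hx : x = x') : y = y' := by
  subst hx
  have := sub_mem h h'
  rw [Prod.mk_sub_mk, sub_self] at this
  exact sub_eq_zero.1 (hG.eq_zero hA this)

set_option maxHeartbeats 1600000 in
/-- A graph can be enlarged so that its first projection approximates a given element. -/
theorem IsGraph.exists_extension (hA : IsEmbeddedAF φ B) (hc : ∀ t, IsVal φ t → IsVal φ (c * t))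
    (hG : IsGraph φ c p q G) {x : CStarMatrix m m A} (hx : p * x * p = x) {ε : ℝ} (hε : 0 < ε) :
    ∃ G₁, IsGraph φ c p q G₁ ∧ G ≤ G₁ ∧ ∃ z ∈ G₁, ‖z.1 - x‖ < ε := by
  have := hG.fin
  obtain ⟨ι, _, r, V, H, S, hSG, hVG, hHG, -⟩ := exists_system G hG.proj hG.mem hG.unit
  have hHG := fun i => (hHG i).mem
  obtain ⟨D, hD, hSD, hpD, y₀, hy₀, hyx⟩ := S.fst.exists_approximation hA hx hε
  obtain ⟨ι₁, _, r₁, v, h, T, hTD, -, -, -, hrr, -⟩ :=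
    exists_system D S.fst.isStarProjection (hSD S.fst.p_mem_alg) hpD
  have hfst : ∀ z ∈ G, z.1 ∈ T.alg := fun z hz => by
    rw [hTD]
    exact hSD (S.fst_mem (by rwa [hSG]))
  have hq : IsStarProjection q := S.snd.isStarProjection
  -- As c preserves the cone, c times the trace vector of each diagonal unit of D is a value. These
  -- values add up to the trace vector of q, so q splits accordingly.
  obtain ⟨f, hf, hfo, hfs, hft⟩ := hA.exists_split (isStarProjection_ofMatrix hq)
    (t := fun i => c * trVec φ (CStarMatrix.ofMatrix.symm (v i * star (v i))))
    (fun i => hc _ (isVal_trVec (isStarProjection_ofMatrix (T.isStarProjection_range i))))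
    (by rw [← Finset.mul_sum, ← trVec_sum, T.sum]; exact (hG.trVec_eq hG.mem).symm)
  have hvr : ∀ i, trVec φ (CStarMatrix.ofMatrix.symm (v i * star (v i)))
      = trVec φ (CStarMatrix.ofMatrix.symm (v (r₁ i) * star (v (r₁ i)))) := fun i => by
    rw [← trVec_star_mul, T.source, hrr]
  let F : ι₁ → CStarMatrix n n A := fun i => CStarMatrix.ofMatrix (f i)
  have hF : ∀ i, IsStarProjection (F i) := fun i =>
    ⟨(hf i).isIdempotentElem, (hf i).isSelfAdjoint⟩
  have hFt : ∀ i j, trL (φ j : A →L[ℂ] ℂ) (F i)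
      = c j * trL (φ j : A →L[ℂ] ℂ) (v i * star (v i)) := fun i =>
    trL_eq_mul_of_trVec_eq (T.isStarProjection_range i) (hF i) (hft i)
  have hFr : ∀ i j, trL (φ j : A →L[ℂ] ℂ) (F (r₁ i))
      = c j * trL (φ j : A →L[ℂ] ℂ) (v i * star (v i)) := fun i =>
    trL_eq_mul_of_trVec_eq (T.isStarProjection_range i) (hF (r₁ i))
      ((hft (r₁ i)).trans (by rw [hvr i]))
  -- Diagonal units of one block have equal traces, so the corresponding pieces of q are equivalent.
  -- The resulting u_i form a system in the corner of q of the same shape as that of D.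
  have hu : ∀ i, ∃ u, u * star u = F i ∧ star u * u = F (r₁ i) := fun i =>
    hA.exists_equiv (hF i) (hF (r₁ i)) fun j => (hFt i j).trans (hFr i j).symm
  choose u hu1 hu2 using hu
  have hu3 : ∀ i, F i * u i = u i := fun i => mul_of_mul_star_eq (hF i) (hu1 i)
  have T' : IsSystem q r₁ u F :=
    { source := hu2
      orth := fun i j hij => by
        have h1 := congrArg star (hu3 i)
        rw [star_mul, (hF i).isSelfAdjoint.star_eq] at h1
        have h2 : F i * F j = 0 := hfo i j hij
        rw [← h1, ← hu3 j, mul_assoc, ← mul_assoc (F i), h2, zero_mul, mul_zero]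
      mul_h := fun i => mul_of_star_mul_eq (hF (r₁ i)) (hu2 i)
      sum := by simp only [hu1]; exact hfs }
  have hP : IsGraph φ c p q (T.prod T').alg := (T.prod T').isGraph fun i j => by
    rw [hu1, hFt]
  -- The new partial map need not agree with G. It sends the units of G to another system y in the
  -- corner of q, with source projections having the same traces as those of the second coordinates
  -- of G.
  have hy : ∀ i, ∃ y, ((V i).1, y) ∈ (T.prod T').alg := fun i =>
    T.exists_mem_of_fst T' (hfst _ (hVG i))
  have hk : ∀ i, ∃ k, ((H i).1, k) ∈ (T.prod T').alg := fun i =>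
    T.exists_mem_of_fst T' (hfst _ (hHG i))
  choose y hy using hy
  choose k hk using hk
  have Y : IsSystem q r y k :=
    { source := fun i => hP.eq_of_mem hA (mul_mem (star_mem (hy i)) (hy i)) (hk (r i))
        (S.fst.source i)
      orth := fun i j hij => hP.eq_of_mem hA (mul_mem (star_mem (hy i)) (hy j)) (zero_mem _)
        (S.fst.orth i j hij)
      mul_h := fun i => hP.eq_of_mem hA (mul_mem (hy i) (hk (r i))) (hy i) (S.fst.mul_h i)
      sum := by
        have h1 : ∑ i, ((V i).1, y i) * star ((V i).1, y i) ∈ (T.prod T').alg :=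
          sum_mem fun i _ => mul_mem (hy i) (star_mem (hy i))
        have h2 : ∑ i, ((V i).1, y i) * star ((V i).1, y i)
            = (∑ i, (V i).1 * star (V i).1, ∑ i, y i * star (y i)) :=
          Prod.ext (by simp [Prod.fst_sum]) (by simp [Prod.snd_sum])
        rw [h2] at h1
        exact hP.eq_of_mem hA h1 hP.mem S.fst.sum }
  -- Uniqueness: a unitary U of the corner of q carries y to the second coordinates of G, so the
  -- graph corrected by Ad U contains G.
  obtain ⟨U, hU1, hU2, hU⟩ := Y.exists_intertwiner S.snd fun i =>
    hA.exists_equiv (Y.isStarProjection_source i) (S.snd.isStarProjection_source i) fun j => by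
      rw [hG.tr _ (hHG (r i)) j]
      exact hP.tr _ (hk (r i)) j
  refine ⟨(T.prod (T'.conj hU1 hU2)).alg, (T.prod (T'.conj hU1 hU2)).isGraph fun i j => ?_,
    fun z hz => ?_, ?_⟩
  · rw [trL_mul_comm (φ j).2.1]
    exact (congrArg _ ((T'.conj hU1 hU2).source i)).trans (hFr i j)
  · rw [← hSG, IsSystem.mem_alg] at hz
    induction hz using Submodule.span_induction with
    | mem z hz =>
      obtain ⟨i, j, hij, rfl⟩ := hz
      have h1 := T.conj_mem T' hU1 hU2 (mul_mem (hy i) (star_mem (hy j)))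
      convert h1 using 1
      exact Prod.ext rfl (hU i j hij).symm
    | zero => exact zero_mem _
    | add x y _ _ h1 h2 => exact add_mem h1 h2
    | smul a x _ h1 => exact SMulMemClass.smul_mem a h1
  · obtain ⟨y₁, hy₁⟩ := T.exists_mem_of_fst (T'.conj hU1 hU2) (by rw [hTD]; exact hy₀)
    exact ⟨_, hy₁, hyx⟩

/-- The inverse graph. -/
def swapGraph {X Y : Type*} [CStarAlgebra X] [CStarAlgebra Y]
    (G : NonUnitalStarSubalgebra ℂ (X × Y)) : NonUnitalStarSubalgebra ℂ (Y × X) where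
  carrier := {z | z.swap ∈ G}
  add_mem' := fun ha hb => add_mem (S := NonUnitalStarSubalgebra ℂ (X × Y)) ha hb
  zero_mem' := zero_mem G
  mul_mem' := fun ha hb => mul_mem (S := NonUnitalStarSubalgebra ℂ (X × Y)) ha hb
  smul_mem' := fun c _ ha => SMulMemClass.smul_mem (s := G) c ha
  star_mem' := fun ha => star_mem (S := NonUnitalStarSubalgebra ℂ (X × Y)) ha

theorem IsGraph.swap (hc : ∀ j, c j ≠ 0) (hG : IsGraph φ c p q G) :
    IsGraph φ c⁻¹ q p (swapGraph G) where
  fin := by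
    have := hG.fin
    let f : swapGraph G →ₗ[ℂ] G :=
      { toFun := fun z => ⟨z.1.swap, z.2⟩
        map_add' := fun _ _ => rfl
        map_smul' := fun _ _ => rfl }
    exact FiniteDimensional.of_injective f fun a b hab =>
      Subtype.ext (Prod.swap_injective (congrArg Subtype.val hab))
  proj := ⟨congrArg Prod.swap hG.proj.isIdempotentElem, congrArg Prod.swap hG.proj.isSelfAdjoint⟩
  mem := hG.mem
  unit z hz := congrArg Prod.swap (hG.unit z.swap hz)
  tr z hz j := by
    have h1 := hG.tr z.swap hz j
    have h2 : (c j : ℂ) ≠ 0 := by exact_mod_cast hc j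
    rw [Prod.snd_swap, Prod.fst_swap] at h1
    rw [h1, Pi.inv_apply, Complex.ofReal_inv, inv_mul_cancel_left₀ h2]

/-- The back half of the back-and-forth: the forward step for the inverse graph, which scales traces
by the inverse of c. -/
theorem IsGraph.exists_extension_snd (hA : IsEmbeddedAF φ B) (hc0 : ∀ j, c j ≠ 0)
    (hc : ∀ t, IsVal φ t → IsVal φ (c⁻¹ * t)) (hG : IsGraph φ c p q G)
    {y : CStarMatrix n n A} (hy : q * y * q = y) {ε : ℝ} (hε : 0 < ε) :
    ∃ G₁, IsGraph φ c p q G₁ ∧ G ≤ G₁ ∧ ∃ z ∈ G₁, ‖z.2 - y‖ < ε := by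
  obtain ⟨G₁, h1, h2, z, hz, hzy⟩ := (hG.swap hc0).exists_extension hA hc hy hε
  have h3 := h1.swap (c := c⁻¹) fun j => inv_ne_zero (hc0 j)
  rw [inv_inv] at h3
  exact ⟨swapGraph G₁, h3, fun w hw => h2 (show w.swap.swap ∈ G from hw), z.swap,
    (show z.swap.swap ∈ G₁ from hz), hzy⟩

end Step

end AFAlg

namespace AFAlg

open scoped Matrix ComplexOrder

/-! ### The back-and-forth construction -/

section Intertwining

/-- The hypothesis says that the first projection is injective on D, and an injective *-homomorphism
of C*-algebras is isometric. -/
theorem norm_fst_eq {X Y : Type*} [CStarAlgebra X] [CStarAlgebra Y]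
    {D : NonUnitalStarSubalgebra ℂ (X × Y)} (hD : IsClosed (D : Set (X × Y)))
    (h : ∀ y, ((0 : X), y) ∈ D → y = 0) {z : X × Y} (hz : z ∈ D) : ‖z.1‖ = ‖z‖ := by
  let f : D →⋆ₙₐ[ℂ] X := (NonUnitalStarAlgHom.fst ℂ X Y).comp
    (NonUnitalStarSubalgebraClass.subtype D)
  have hf : Function.Injective f := by
    intro a b hab
    have h1 : (a : X × Y).1 = (b : X × Y).1 := hab
    have h2 : ((0 : X), (a : X × Y).2 - (b : X × Y).2) ∈ D := by
      have h3 : ((0 : X), (a : X × Y).2 - (b : X × Y).2) = (a : X × Y) - (b : X × Y) :=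
        Prod.ext (by rw [Prod.fst_sub, h1, sub_self]) rfl
      rw [h3]
      exact sub_mem a.2 b.2
    exact Subtype.ext (Prod.ext h1 (sub_eq_zero.1 (h _ h2)))
  have := hD
  exact NonUnitalStarAlgHom.norm_map f hf ⟨z, hz⟩

theorem separableSpace_of_isFiltration {M : Type*} [CStarAlgebra M]
    {D : ℕ → StarSubalgebra ℂ M} (hD : IsFiltration D) : TopologicalSpace.SeparableSpace M := by
  rw [← TopologicalSpace.isSeparable_univ_iff, ← hD.dense.closure_eq]
  refine (TopologicalSpace.IsSeparable.iUnion fun n => ?_).closure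
  have := hD.fin n
  have : ProperSpace (D n) := FiniteDimensional.proper ℂ (D n)
  have h := TopologicalSpace.isSeparable_range (continuous_subtype_val (p := fun x => x ∈ D n))
  rwa [Subtype.range_coe] at h

variable {A : Type*} [CStarAlgebra A] [PartialOrder A] [StarOrderedRing A]
  {φ : Fin 2 → tracialStates A} {B : ℕ → StarSubalgebra ℂ A} {m n : Type*} [Fintype m] [Fintype n]
  [DecidableEq m] [DecidableEq n] {c : Fin 2 → ℝ} {p : CStarMatrix m m A} {q : CStarMatrix n n A}

theorem IsGraph.norm_eq (hA : IsEmbeddedAF φ B) (hc0 : ∀ j, c j ≠ 0)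
    {G : NonUnitalStarSubalgebra ℂ (CStarMatrix m m A × CStarMatrix n n A)}
    (hG : IsGraph φ c p q G) {z : CStarMatrix m m A × CStarMatrix n n A} (hz : z ∈ G) :
    ‖z.1‖ = ‖z.2‖ := by
  have hG' := hG.swap hc0
  have h1 := hG.fin
  have h2 := hG'.fin
  rw [norm_fst_eq (isClosed_of_finiteDimensional G) (fun y hy => hG.eq_zero hA hy) hz]
  have h3 := norm_fst_eq (isClosed_of_finiteDimensional (swapGraph G))
    (fun y hy => hG'.eq_zero hA hy) (z := z.swap) hz
  rw [Prod.fst_swap] at h3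
  rw [h3, Prod.norm_def, Prod.norm_def, max_comm]
  rfl

/-- The span of (p, q) starts the construction. -/
theorem exists_isGraph (hp : IsStarProjection p) (hq : IsStarProjection q)
    (h : ∀ j, trL (φ j : A →L[ℂ] ℂ) q = c j * trL (φ j : A →L[ℂ] ℂ) p) :
    ∃ G, IsGraph φ c p q G := by
  have S : IsSystem (p, q) (id : Unit → Unit) (fun _ => (p, q)) (fun _ => (p, q)) :=
    { source := fun _ => Prod.ext
        (by change star p * p = p; rw [hp.isSelfAdjoint.star_eq, hp.isIdempotentElem.eq])
        (by change star q * q = q; rw [hq.isSelfAdjoint.star_eq, hq.isIdempotentElem.eq])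
      orth := fun i j hij => absurd (Subsingleton.elim i j) hij
      mul_h := fun _ => Prod.ext hp.isIdempotentElem hq.isIdempotentElem
      sum := by
        rw [Fintype.sum_unique]
        exact Prod.ext
          (by change p * star p = p; rw [hp.isSelfAdjoint.star_eq, hp.isIdempotentElem.eq])
          (by change q * star q = q; rw [hq.isSelfAdjoint.star_eq, hq.isIdempotentElem.eq]) }
  exact ⟨_, S.isGraph fun _ j => by
    change trL _ (q * star q) = _ * trL _ (p * star p)
    rw [hp.isSelfAdjoint.star_eq, hp.isIdempotentElem.eq, hq.isSelfAdjoint.star_eq,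
      hq.isIdempotentElem.eq, h]⟩

/-- Reduces the approximation of all elements of a corner to countably many tasks (i, N): the i-th
member of a dense sequence, compressed to the corner, with tolerance 1/(N + 1). -/
theorem exists_denseSeq_near {X : Type*} [CStarAlgebra X] [TopologicalSpace.SeparableSpace X]
    {r : X} (hr : IsStarProjection r) {x : X} (hx : r * x * r = x) {ε : ℝ} (hε : 0 < ε) :
    ∃ i N : ℕ, ∀ z : X,
      ‖z - r * TopologicalSpace.denseSeq X i * r‖ < 1 / ((N : ℝ) + 1) → ‖z - x‖ < ε := by
  obtain ⟨i, hi⟩ := (TopologicalSpace.denseRange_denseSeq X).exists_dist_lt x (half_pos hε)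
  obtain ⟨N, hN⟩ := exists_nat_one_div_lt (half_pos hε)
  refine ⟨i, N, fun z hz => ?_⟩
  have hr1 := norm_isStarProjection_le hr
  have h1 : ‖r * TopologicalSpace.denseSeq X i * r - x‖ < ε / 2 := by
    have e1 : r * TopologicalSpace.denseSeq X i * r - x
        = r * (TopologicalSpace.denseSeq X i - x) * r := by rw [mul_sub, sub_mul, hx]
    rw [e1]
    rw [dist_comm, dist_eq_norm] at hi
    refine lt_of_le_of_lt ?_ hi
    calc ‖r * (TopologicalSpace.denseSeq X i - x) * r‖
        ≤ ‖r‖ * ‖TopologicalSpace.denseSeq X i - x‖ * ‖r‖ :=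
          (norm_mul_le _ _).trans (mul_le_mul_of_nonneg_right (norm_mul_le _ _) (norm_nonneg _))
      _ ≤ 1 * ‖TopologicalSpace.denseSeq X i - x‖ * 1 := by gcongr
      _ = _ := by ring
  calc ‖z - x‖ = ‖(z - r * TopologicalSpace.denseSeq X i * r)
        + (r * TopologicalSpace.denseSeq X i * r - x)‖ := by rw [sub_add_sub_cancel]
    _ ≤ _ := norm_add_le _ _
    _ < ε / 2 + ε / 2 := add_lt_add (hz.trans hN) h1
    _ = ε := add_halves ε

/-- An increasing sequence of graphs whose projections have dense unions. -/
theorem IsEmbeddedAF.exists_sequence (hA : IsEmbeddedAF φ B) (hc0 : ∀ j, c j ≠ 0)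
    (hc : ∀ t, IsVal φ t → IsVal φ (c * t)) (hc' : ∀ t, IsVal φ t → IsVal φ (c⁻¹ * t))
    (hp : IsStarProjection p) (hq : IsStarProjection q)
    (h : ∀ j, trL (φ j : A →L[ℂ] ℂ) q = c j * trL (φ j : A →L[ℂ] ℂ) p) :
    ∃ G : ℕ → NonUnitalStarSubalgebra ℂ (CStarMatrix m m A × CStarMatrix n n A),
      (∀ k, IsGraph φ c p q (G k)) ∧ Monotone G ∧
      (∀ x, p * x * p = x → ∀ ε > 0, ∃ k, ∃ z ∈ G k, ‖z.1 - x‖ < ε) ∧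
      (∀ y, q * y * q = y → ∀ ε > 0, ∃ k, ∃ z ∈ G k, ‖z.2 - y‖ < ε) := by
  obtain ⟨G₀, hG₀⟩ := exists_isGraph hp hq h
  have := separableSpace_of_isFiltration (hA.filtration.matrix m)
  have := separableSpace_of_isFiltration (hA.filtration.matrix n)
  set d := TopologicalSpace.denseSeq (CStarMatrix m m A) with hd
  set e := TopologicalSpace.denseSeq (CStarMatrix n n A) with he
  -- The number k codes a task (i, N) by `Nat.unpair`; each step carries out the task on both sides.
  have hstep : ∀ (G : {G // IsGraph φ c p q G}) (k : ℕ), ∃ G' : {G // IsGraph φ c p q G},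
      G.1 ≤ G'.1 ∧
      (∃ z ∈ G'.1, ‖z.1 - p * d k.unpair.1 * p‖ < 1 / ((k.unpair.2 : ℝ) + 1)) ∧
      (∃ z ∈ G'.1, ‖z.2 - q * e k.unpair.1 * q‖ < 1 / ((k.unpair.2 : ℝ) + 1)) := by
    rintro ⟨G, hG⟩ k
    have hε : 0 < 1 / ((k.unpair.2 : ℝ) + 1) := by positivity
    have hpp := hp.isIdempotentElem.eq
    have hqq := hq.isIdempotentElem.eq
    obtain ⟨G₁, h1, h2, z, hz, hz'⟩ := hG.exists_extension hA hc
      (x := p * d k.unpair.1 * p)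
      (by rw [mul_assoc, mul_assoc, hpp, ← mul_assoc, ← mul_assoc, hpp]) hε
    obtain ⟨G₂, h3, h4, w, hw, hw'⟩ := h1.exists_extension_snd hA hc0 hc'
      (y := q * e k.unpair.1 * q)
      (by rw [mul_assoc, mul_assoc, hqq, ← mul_assoc, ← mul_assoc, hqq]) hε
    exact ⟨⟨G₂, h3⟩, h2.trans h4, ⟨z, h4 hz, hz'⟩, ⟨w, hw, hw'⟩⟩
  choose next hn1 hn2 hn3 using hstep
  let s : ℕ → {G // IsGraph φ c p q G} := fun k => Nat.rec ⟨G₀, hG₀⟩ (fun k G => next G k) k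
  have hs : ∀ k, s (k + 1) = next (s k) k := fun k => rfl
  refine ⟨fun k => (s k).1, fun k => (s k).2, monotone_nat_of_le_succ fun k => ?_, ?_, ?_⟩
  · rw [hs]; exact hn1 _ _
  · intro x hx ε hε
    obtain ⟨i, N, hiN⟩ := exists_denseSeq_near hp hx hε
    obtain ⟨z, hz, hz'⟩ := hn2 (s (Nat.pair i N)) (Nat.pair i N)
    rw [Nat.unpair_pair] at hz'
    exact ⟨Nat.pair i N + 1, z, hz, hiN _ hz'⟩
  · intro x hx ε hε
    obtain ⟨i, N, hiN⟩ := exists_denseSeq_near hq hx hε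
    obtain ⟨z, hz, hz'⟩ := hn3 (s (Nat.pair i N)) (Nat.pair i N)
    rw [Nat.unpair_pair] at hz'
    exact ⟨Nat.pair i N + 1, z, hz, hiN _ hz'⟩

theorem mem_range_of_isometry {X Y : Type*} [MetricSpace X] [CompleteSpace X] [MetricSpace Y]
    {f : X → Y} (hf : Isometry f) {y : Y} (h : ∀ ε > 0, ∃ x, dist (f x) y < ε) :
    y ∈ Set.range f := by
  have h1 : IsClosed (Set.range f) := hf.isClosedEmbedding.isClosed_range
  rw [← h1.closure_eq, Metric.mem_closure_iff]
  intro ε hε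
  obtain ⟨x, hx⟩ := h ε hε
  exact ⟨f x, ⟨x, rfl⟩, by rwa [dist_comm]⟩

/-- The graph of a *-isomorphism between the corners cut out by `p` and `q`. -/
theorem IsEmbeddedAF.exists_graph (hA : IsEmbeddedAF φ B) (hc0 : ∀ j, c j ≠ 0)
    (hc : ∀ t, IsVal φ t → IsVal φ (c * t)) (hc' : ∀ t, IsVal φ t → IsVal φ (c⁻¹ * t))
    (hp : IsStarProjection p) (hq : IsStarProjection q)
    (h : ∀ j, trL (φ j : A →L[ℂ] ℂ) q = c j * trL (φ j : A →L[ℂ] ℂ) p) :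
    ∃ Γ : NonUnitalStarSubalgebra ℂ (CStarMatrix m m A × CStarMatrix n n A),
      (∀ z ∈ Γ, ‖z.1‖ = ‖z.2‖) ∧ (∀ z ∈ Γ, (p, q) * z = z) ∧
      (∀ z ∈ Γ, ∀ j, trL (φ j : A →L[ℂ] ℂ) z.2 = c j * trL (φ j : A →L[ℂ] ℂ) z.1) ∧
      (∀ x, p * x * p = x → ∃ y, (x, y) ∈ Γ) ∧ (∀ y, q * y * q = y → ∃ x, (x, y) ∈ Γ) := by
  obtain ⟨G, hG, hmono, h1, h2⟩ := hA.exists_sequence hc0 hc hc' hp hq h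
  have hU : ∀ z, z ∈ ⨆ k, G k ↔ ∃ k, z ∈ G k := by
    intro z
    rw [← SetLike.mem_coe, NonUnitalStarSubalgebra.coe_iSup_of_directed hmono.directed_le]
    simp
  -- Equality of the norms of the two coordinates passes to the closure. Both coordinate projections
  -- of Γ are therefore isometric with closed range, and approximability makes each onto its corner.
  set Γ := (⨆ k, G k).topologicalClosure with hΓ
  have hcl : IsClosed (Γ : Set (CStarMatrix m m A × CStarMatrix n n A)) :=
    NonUnitalStarSubalgebra.isClosed_topologicalClosure _
  have hsub : ∀ k, ∀ z ∈ G k, z ∈ Γ := fun k z hz =>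
    NonUnitalStarSubalgebra.le_topologicalClosure _ ((hU z).2 ⟨k, hz⟩)
  have hind : ∀ {P : CStarMatrix m m A × CStarMatrix n n A → Prop}, IsClosed {z | P z} →
      (∀ k, ∀ z ∈ G k, P z) → ∀ z ∈ Γ, P z := by
    intro P hP hPG z hz
    have hz' : z ∈ closure ((⨆ k, G k : NonUnitalStarSubalgebra ℂ
      (CStarMatrix m m A × CStarMatrix n n A)) : Set (CStarMatrix m m A × CStarMatrix n n A)) := hz
    exact closure_minimal (fun w hw => by
      obtain ⟨k, hk⟩ := (hU w).1 hw
      exact hPG k w hk) hP hz'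
  have hnorm : ∀ z ∈ Γ, ‖z.1‖ = ‖z.2‖ :=
    hind (isClosed_eq continuous_fst.norm continuous_snd.norm) fun k z hz => (hG k).norm_eq hA hc0 hz
  have hcomp : CompleteSpace Γ := hcl.completeSpace_coe
  have hiso1 : Isometry fun z : Γ => (z : CStarMatrix m m A × CStarMatrix n n A).1 := by
    refine Isometry.of_dist_eq fun a b => ?_
    have := hnorm _ (sub_mem a.2 b.2)
    rw [Subtype.dist_eq, dist_eq_norm, dist_eq_norm, Prod.norm_def, ← this, max_self, Prod.fst_sub]
  have hiso2 : Isometry fun z : Γ => (z : CStarMatrix m m A × CStarMatrix n n A).2 := by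
    refine Isometry.of_dist_eq fun a b => ?_
    have := hnorm _ (sub_mem a.2 b.2)
    rw [Subtype.dist_eq, dist_eq_norm, dist_eq_norm, Prod.norm_def, this, max_self, Prod.snd_sub]
  refine ⟨Γ, hnorm, ?_, ?_, ?_, ?_⟩
  · exact hind (isClosed_eq (continuous_const.mul continuous_id) continuous_id)
      fun k z hz => (hG k).unit z hz
  · intro z hz j
    exact hind (P := fun z => trL (φ j : A →L[ℂ] ℂ) z.2 = c j * trL (φ j : A →L[ℂ] ℂ) z.1)
      (isClosed_eq ((continuous_trL _).comp continuous_snd)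
        (continuous_const.mul ((continuous_trL _).comp continuous_fst)))
      (fun k z hz => (hG k).tr z hz j) z hz
  · intro x hx
    obtain ⟨z, rfl⟩ := mem_range_of_isometry hiso1 (y := x) fun ε hε => by
      obtain ⟨k, z, hz, hzx⟩ := h1 x hx ε hε
      exact ⟨⟨z, hsub k z hz⟩, by rwa [dist_eq_norm]⟩
    exact ⟨_, z.2⟩
  · intro y hy
    obtain ⟨z, rfl⟩ := mem_range_of_isometry hiso2 (y := y) fun ε hε => by
      obtain ⟨k, z, hz, hzx⟩ := h2 y hy ε hε
      exact ⟨⟨z, hsub k z hz⟩, by rwa [dist_eq_norm]⟩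
    exact ⟨_, z.2⟩

end Intertwining

end AFAlg

namespace AFAlg

open scoped Matrix ComplexOrder

/-! ### From multipliers to the fundamental group -/

section Realization

variable {A : Type*} [CStarAlgebra A]

theorem slice_mul_blockDiagonal' {m ι : Type*} [Fintype m] [Fintype ι] [DecidableEq ι]
    {n : ι → Type*} [∀ i, Fintype (n i)] (w : Matrix m (Σ i, n i) A)
    (e : ∀ i, Matrix (n i) (n i) A) (i : ι) :
    slice (w * Matrix.blockDiagonal' e) i = slice w i * e i := by
  ext a b
  change (w * Matrix.blockDiagonal' e) a ⟨i, b⟩ = _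
  rw [Matrix.mul_apply, Fintype.sum_sigma, Finset.sum_eq_single i, Matrix.mul_apply]
  · simp [slice]
  · intro j _ hj
    refine Finset.sum_eq_zero fun l _ => ?_
    rw [Matrix.blockDiagonal'_apply_ne _ _ _ hj, mul_zero]
  · simp

theorem snd_eq_of_graph {X Y : Type*} [CStarAlgebra X] [CStarAlgebra Y]
    {Γ : NonUnitalStarSubalgebra ℂ (X × Y)} (hΓ : ∀ z ∈ Γ, ‖z.1‖ = ‖z.2‖) {x : X} {y y' : Y}
    (h : (x, y) ∈ Γ) (h' : (x, y') ∈ Γ) : y = y' := by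
  have h2 := hΓ _ (sub_mem h h')
  rw [Prod.mk_sub_mk, sub_self, norm_zero] at h2
  exact sub_eq_zero.1 (norm_eq_zero.1 h2.symm)

theorem fst_eq_of_graph {X Y : Type*} [CStarAlgebra X] [CStarAlgebra Y]
    {Γ : NonUnitalStarSubalgebra ℂ (X × Y)} (hΓ : ∀ z ∈ Γ, ‖z.1‖ = ‖z.2‖) {x x' : X} {y : Y}
    (h : (x, y) ∈ Γ) (h' : (x', y) ∈ Γ) : x = x' := by
  have h2 := hΓ _ (sub_mem h h')
  rw [Prod.mk_sub_mk, sub_self, norm_zero] at h2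
  exact sub_eq_zero.1 (norm_eq_zero.1 h2)

/-- Equality of norms makes Γ single-valued, so pointwise choices automatically respect all the
operations under which Γ is closed. -/
theorem exists_hom_of_graph {X Y : Type*} [CStarAlgebra X] [CStarAlgebra Y]
    {Γ : NonUnitalStarSubalgebra ℂ (X × Y)} (hΓ : ∀ z ∈ Γ, ‖z.1‖ = ‖z.2‖) (f : A →⋆ₙₐ[ℂ] X)
    (hf : ∀ x, ∃ y, (f x, y) ∈ Γ) : ∃ F : A →⋆ₙₐ[ℂ] Y, ∀ x, (f x, F x) ∈ Γ := by
  choose F hF using hf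
  exact ⟨{
    toFun := F
    map_smul' := fun a x => snd_eq_of_graph hΓ (hF _) (by
      rw [map_smul]
      exact SMulMemClass.smul_mem a (hF x))
    map_zero' := snd_eq_of_graph hΓ (hF _) (by
      rw [map_zero]
      exact zero_mem Γ)
    map_add' := fun x y => snd_eq_of_graph hΓ (hF _) (by
      rw [map_add]
      exact add_mem (hF x) (hF y))
    map_mul' := fun x y => snd_eq_of_graph hΓ (hF _) (by
      rw [map_mul]
      exact mul_mem (hF x) (hF y))
    map_star' := fun x => snd_eq_of_graph hΓ (hF _) (by
      rw [map_star]
      exact star_mem (hF x)) }, hF⟩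

variable [PartialOrder A] [StarOrderedRing A]
  {φ : Fin 2 → tracialStates A} {B : ℕ → StarSubalgebra ℂ A} {c : Fin 2 → ℝ}

theorem diagHom_apply_zero (x : CStarMatrix (Fin 1) (Fin 1) A) :
    diagHom A (Fin 1) (x 0 0) = x := by
  refine CStarMatrix.ext fun i j => ?_
  rw [Subsingleton.elim i 0, Subsingleton.elim j 0]
  exact Matrix.diagonal_apply_eq (fun _ => x 0 0) 0

theorem diagHom_injective : Function.Injective (diagHom A (Fin 1)) := fun x y hxy =>
  ((Matrix.diagonal_apply_eq (fun _ => x) (0 : Fin 1)).symm.trans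
    (congrFun (congrFun (congrArg CStarMatrix.ofMatrix.symm hxy) 0) 0)).trans
    (Matrix.diagonal_apply_eq (fun _ => y) (0 : Fin 1))

theorem trL_diagHom (τ : A →L[ℂ] ℂ) (x : A) : trL τ (diagHom A (Fin 1) x) = τ x :=
  (Fin.sum_univ_one fun i => τ (Matrix.diagonal (fun _ => x) i i)).trans
    (congrArg τ (Matrix.diagonal_apply_eq (fun _ => x) (0 : Fin 1)))

/-- A projection with nonzero traces is full. -/
theorem IsEmbeddedAF.span_eq_top (hA : IsEmbeddedAF φ B) {k : ℕ} {q : Matrix (Fin k) (Fin k) A}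
    (hq : IsStarProjection q) (h : ∀ j, 0 < trVec φ q j) : TwoSidedIdeal.span {q} = ⊤ := by
  classical
  -- For N copies of q with traces exceeding k, strict comparison puts the unit of M_k(A) below
  -- their block sum. The rows w belonging to the unit satisfy ww* = 1 and w = w diag(q,…,q), which
  -- expresses 1 as a sum of elements of the ideal of q.
  obtain ⟨N, hN⟩ : ∃ N : ℕ, ∀ j, (k : ℝ) < N * trVec φ q j := by
    have : ∀ j, ∃ N : ℕ, ∀ N' ≥ N, (k : ℝ) < N' * trVec φ q j := fun j => by
      obtain ⟨N, hN⟩ := exists_nat_gt ((k : ℝ) / trVec φ q j)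
      refine ⟨N, fun N' hN' => (div_lt_iff₀ (h j)).1 (hN.trans_le ?_)⟩
      exact_mod_cast hN'
    choose N hN using this
    refine ⟨max (N 0) (N 1), fun j => hN j _ ?_⟩
    fin_cases j
    exacts [le_max_left _ _, le_max_right _ _]
  have hE : IsStarProjection (Matrix.blockDiagonal' fun _ : Fin N => q) :=
    isStarProjection_blockDiagonal' fun _ => hq
  have htr : trVec φ (Matrix.blockDiagonal' fun _ : Fin N => q) = N • trVec φ q := by
    rw [trVec_blockDiagonal', Finset.sum_const, Finset.card_fin]
  have h1 : IsStarProjection (1 : Matrix (Fin k) (Fin k) A) := .one _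
  obtain ⟨l, r, hr, hrt⟩ := hA.isVal_sub_of_lt (isVal_trVec h1) (isVal_trVec hE) fun j => by
    rw [trVec_one, htr, Fintype.card_fin, Pi.smul_apply, nsmul_eq_mul]
    exact hN j
  have hF := isStarProjection_fromBlocks h1 hr
  obtain ⟨v, hv1, -, -, hv2⟩ := MvN.exists_mul_eq hF hE (hA.mvN hF hE (by
    rw [trVec_blocks, hrt, add_sub_cancel]))
  set w : Matrix (Fin k) (Σ _ : Fin N, Fin k) A := v.submatrix Sum.inl id with hw
  have hw1 : w * wᴴ = 1 := by
    have := congrArg Matrix.toBlocks₁₁ hv1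
    rw [Matrix.toBlocks_fromBlocks₁₁] at this
    exact this
  have hw2 : w * (Matrix.blockDiagonal' fun _ : Fin N => q) = w :=
    congrArg (fun x => x.submatrix Sum.inl id) hv2
  rw [← TwoSidedIdeal.one_mem_iff, ← hw1, ← sum_slice]
  refine TwoSidedIdeal.finsetSum_mem _ _ _ fun i _ => TwoSidedIdeal.mul_mem_right _ _ _ ?_
  rw [← hw2, slice_mul_blockDiagonal']
  exact TwoSidedIdeal.mul_mem_left _ _ _ (TwoSidedIdeal.subset_span rfl)

/-- Multipliers preserving the positive cone are realized by the fundamental group. -/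
theorem IsEmbeddedAF.diagonal_mem_fundamentalGroup (hA : IsEmbeddedAF φ B) (hc0 : ∀ j, 0 < c j)
    (hc : ∀ t, IsVal φ t → IsVal φ (c * t)) (hc' : ∀ t, IsVal φ t → IsVal φ (c⁻¹ * t)) :
    Matrix.diagonal (fun j => (c j : ℂ)) ∈ fundamentalGroup φ := by
  classical
  have h1 : IsStarProjection (1 : Matrix (Fin 1) (Fin 1) A) := .one _
  -- The unit has trace vector (1, 1), so q has trace vector c: it is the projection whose corner
  -- should be isomorphic to the algebra.
  obtain ⟨k, q, hq, hqt⟩ := hc _ (isVal_trVec h1)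
  have hqc : ∀ j, trVec φ q j = c j := fun j => by
    rw [hqt, trVec_one]
    simp
  have hone : IsStarProjection (1 : CStarMatrix (Fin 1) (Fin 1) A) := .one _
  have hq' : IsStarProjection (CStarMatrix.ofMatrix q) := ⟨hq.isIdempotentElem, hq.isSelfAdjoint⟩
  obtain ⟨Γ, hΓ1, hΓ2, hΓ3, hΓ4, hΓ5⟩ := hA.exists_graph (fun j => (hc0 j).ne') hc hc' hone hq'
    (trL_eq_mul_of_trVec_eq hone hq' hqt)
  obtain ⟨F, hF⟩ := exists_hom_of_graph hΓ1 (diagHom A (Fin 1)) fun x => hΓ4 _ (by simp)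
  let Φ : A →⋆ₙₐ[ℂ] Matrix (Fin k) (Fin k) A :=
    { toFun := fun x => CStarMatrix.ofMatrix.symm (F x)
      map_smul' := fun a x => map_smul F a x
      map_zero' := map_zero F
      map_add' := fun x y => map_add F x y
      map_mul' := fun x y => map_mul F x y
      map_star' := fun x => map_star F x }
  refine ⟨k, q, Φ, hq, hA.span_eq_top hq fun j => by rw [hqc]; exact hc0 j, ?_, ?_, ?_⟩
  · intro x y hxy
    have h2 : F x = F y := hxy
    exact diagHom_injective (fst_eq_of_graph hΓ1 (hF x) (h2 ▸ hF y))
  · ext y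
    constructor
    · rintro ⟨x, rfl⟩
      have h2 : CStarMatrix.ofMatrix q * F x = F x := congrArg Prod.snd (hΓ2 _ (hF x))
      have h3 : CStarMatrix.ofMatrix q * star (F x) = star (F x) :=
        congrArg Prod.snd (hΓ2 _ (star_mem (hF x)))
      have h4 := congrArg star h3
      rw [star_mul, star_star, hq'.isSelfAdjoint.star_eq] at h4
      have h5 : CStarMatrix.ofMatrix q * F x * CStarMatrix.ofMatrix q = F x := by rw [h2, h4]
      exact h5
    · intro hy
      obtain ⟨x, hx⟩ := hΓ5 (CStarMatrix.ofMatrix y) hy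
      refine ⟨x 0 0, snd_eq_of_graph hΓ1 (hF _) ?_⟩
      rw [diagHom_apply_zero]
      exact hx
  · intro j x
    have h2 := hΓ3 _ (hF x) j
    rw [trL_diagHom] at h2
    refine Eq.trans h2 ?_
    rw [Finset.sum_eq_single j (fun l _ hl => by simp [Matrix.diagonal_apply_ne _ hl]) (by simp)]
    simp

end Realization

end AFAlg

namespace AFAlg

/-! ### A unit outside the powers of (a, b) -/

section NumberTheory

open Polynomial

theorem exists_aeval_of_mem_adjoin {b : ℝ} (hb : b ≠ 0) {y : ℝ}
    (hy : y ∈ Algebra.adjoin ℤ ({b, b⁻¹} : Set ℝ)) :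
    ∃ (f : ℤ[X]) (k : ℕ), y * b ^ k = aeval b f := by
  induction hy using Algebra.adjoin_induction with
  | mem x hx =>
    rcases hx with rfl | rfl
    · exact ⟨X, 0, by simp⟩
    · exact ⟨1, 1, by simp [hb]⟩
  | algebraMap n => exact ⟨C n, 0, by simp⟩
  | add x y _ _ h1 h2 =>
    obtain ⟨f, k, hf⟩ := h1
    obtain ⟨g, l, hg⟩ := h2
    refine ⟨X ^ l * f + X ^ k * g, k + l, ?_⟩
    simp only [map_add, map_mul, map_pow, aeval_X, ← hf, ← hg]
    ring
  | mul x y _ _ h1 h2 =>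
    obtain ⟨f, k, hf⟩ := h1
    obtain ⟨g, l, hg⟩ := h2
    refine ⟨f * g, k + l, ?_⟩
    rw [map_mul, ← hf, ← hg]
    ring

theorem aeval_mem_subring {M : Subring (Fin 2 → ℝ)} {v : Fin 2 → ℝ} (hv : v ∈ M) (f : ℤ[X]) :
    (fun j => aeval (v j) f) ∈ M := by
  induction f using Polynomial.induction_on' with
  | add f g hf hg =>
    have := add_mem hf hg
    convert this using 1
    funext j
    simp
  | monomial k n =>
    have := mul_mem (intCast_mem M n) (pow_mem hv k)
    convert this using 1
    funext j
    simp [aeval_monomial]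

/-- Distinct minimal polynomials are coprime, so s·m_a + t·m_b = 1. The polynomial s·m_a vanishes at
a and is 1 at b; N clears its denominators. -/
theorem exists_aeval_eq_zero_and_intCast {a b : ℝ} (ha : IsAlgebraic ℚ a) (hb : IsAlgebraic ℚ b)
    (h : minpoly ℚ a ≠ minpoly ℚ b) :
    ∃ (f : ℤ[X]) (N : ℤ), N ≠ 0 ∧ aeval a f = 0 ∧ aeval b f = N := by
  have hco : IsCoprime (minpoly ℚ a) (minpoly ℚ b) := by
    refine ((minpoly.irreducible ha.isIntegral).coprime_iff_not_dvd).2 fun hd => h ?_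
    exact eq_of_monic_of_associated (minpoly.monic ha.isIntegral) (minpoly.monic hb.isIntegral)
      ((minpoly.irreducible ha.isIntegral).associated_of_dvd (minpoly.irreducible hb.isIntegral) hd)
  obtain ⟨s, t, hst⟩ := hco
  obtain ⟨N, hN, h1⟩ := IsLocalization.integerNormalization_spec (nonZeroDivisors ℤ)
    (s * minpoly ℚ a)
  refine ⟨IsLocalization.integerNormalization (nonZeroDivisors ℤ) (s * minpoly ℚ a), N,
    nonZeroDivisors.ne_zero hN, ?_, ?_⟩
  · rw [← aeval_map_algebraMap ℚ, h1, map_zsmul, map_mul, minpoly.aeval, mul_zero, smul_zero]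
  · rw [← aeval_map_algebraMap ℚ, h1, map_zsmul, eq_sub_of_add_eq hst, map_sub, map_mul,
      minpoly.aeval, mul_zero, map_one, sub_zero, zsmul_one]

/-- Pigeonhole: two powers of e agree modulo N. No coprimality of e and N is assumed, whence the
factor e^l. -/
theorem exists_dvd_pow_sub_one {N : ℤ} (hN : N ≠ 0) (e : ℤ) :
    ∃ l k : ℕ, 0 < k ∧ N ∣ e ^ l * (e ^ k - 1) := by
  have : NeZero N.natAbs := ⟨Int.natAbs_ne_zero.2 hN⟩
  obtain ⟨i, j, hij, h⟩ := Finite.exists_ne_map_eq_of_infinite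
    fun i : ℕ => ((e : ZMod N.natAbs) ^ i)
  wlog hlt : i < j generalizing i j
  · exact this j i hij.symm h.symm (lt_of_le_of_ne (not_lt.1 hlt) hij.symm)
  refine ⟨i, j - i, Nat.sub_pos_of_lt hlt, ?_⟩
  rw [mul_sub, ← pow_add, Nat.add_sub_cancel' hlt.le, mul_one, ← Int.natAbs_dvd,
    ← ZMod.intCast_zmod_eq_zero_iff_dvd]
  simp only [Int.cast_sub, Int.cast_pow]
  rw [sub_eq_zero]
  exact h.symm

/-- A subring of `ℝ²` containing `(a, b)` and its inverse has a rational unit which is not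
a power of `(a, b)`. -/
theorem exists_rational_unit {a b : ℝ} (ha : 0 < a) (hb : 0 < b)
    (ha_alg : IsAlgebraic ℚ a) (hb_alg : IsAlgebraic ℚ b) (hab : a ≠ b)
    {p q : ℤ} (hq0 : q ≠ 0) (hq1 : q ≠ 1) (hq2 : q ≠ -1) (hpq : IsCoprime p q)
    (hmem : (p : ℝ) / (q : ℝ) ∈ Algebra.adjoin ℤ ({b, b⁻¹} : Set ℝ))
    (hex : a ≠ 1 ∨ ∀ k n : ℤ, k ≠ 0 → n ≠ 0 → b ^ k ≠ |(q : ℝ)| ^ n)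
    {M : Subring (Fin 2 → ℝ)} (h1 : ![a, b] ∈ M) (h2 : ![a⁻¹, b⁻¹] ∈ M) :
    ∃ c : Fin 2 → ℚ, (∀ j, 0 < c j) ∧ (fun j => (c j : ℝ)) ∈ M ∧
      (fun j => ((c j)⁻¹ : ℝ)) ∈ M ∧ ∀ n : ℤ, ¬ (a ^ n = c 0 ∧ b ^ n = c 1) := by
  have hq : (q : ℝ) ≠ 0 := by exact_mod_cast hq0
  have hE : (1 : ℤ) < q ^ 2 := by
    have : 1 < |q| := by
      rcases abs_cases q with ⟨h, _⟩ | ⟨h, _⟩ <;> omega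
    rw [← sq_abs]
    nlinarith
  obtain ⟨f, k, hf⟩ := exists_aeval_of_mem_adjoin hb.ne' hmem
  obtain ⟨u, w, huw⟩ := hpq
  have huw' : (u : ℝ) * p + w * q = 1 := by exact_mod_cast huw
  have hfM := mul_mem (aeval_mem_subring h1 f) (pow_mem h2 k)
  -- With u p + w q = 1, the second coordinate is u(p/q) + w = 1/q.
  have hM : ![u * (aeval a f * a⁻¹ ^ k) + w, (q : ℝ)⁻¹] ∈ M := by
    have := add_mem (mul_mem (intCast_mem M u) hfM) (intCast_mem M w)
    convert this using 1
    funext j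
    fin_cases j
    · simp
    · have : (aeval b f) * b⁻¹ ^ k = p / q := by
        rw [← hf, mul_assoc, ← mul_pow, mul_inv_cancel₀ hb.ne', one_pow, mul_one]
      simp only [Fin.mk_one, Matrix.cons_val_one, Pi.add_apply, Pi.mul_apply, Pi.pow_apply,
        Pi.intCast_apply]
      simp only [Matrix.cons_val_fin_one]
      rw [this]
      field_simp
      linarith
  by_cases hmin : minpoly ℚ a = minpoly ℚ b
  · have hga : aeval a f * a⁻¹ ^ k = p / q := by
      -- This polynomial expresses f(b)/b^k = p/q. Since a is conjugate to b it also vanishes at a,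
      -- so the first coordinate agrees with the second.
      let g : ℤ[X] := C p * X ^ k - C q * f
      have hgb : aeval b g = 0 := by
        simp only [g, map_sub, map_mul, map_pow, aeval_X, ← hf, eq_intCast, map_intCast]
        field_simp
        ring
      have hgb' : aeval b (g.map (Int.castRingHom ℚ)) = 0 := by
        rwa [← algebraMap_int_eq, aeval_map_algebraMap]
      have hga' : aeval a (g.map (Int.castRingHom ℚ)) = 0 := by
        have := minpoly.dvd ℚ b hgb'
        rw [← hmin] at this
        exact aeval_eq_zero_of_dvd_aeval_eq_zero this (minpoly.aeval ℚ a)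
      rw [← algebraMap_int_eq, aeval_map_algebraMap] at hga'
      simp only [g, map_sub, map_mul, map_pow, aeval_X, eq_intCast, map_intCast] at hga'
      have hak := pow_pos ha k
      rw [inv_pow, eq_div_iff hq, mul_right_comm, mul_inv_eq_iff_eq_mul₀ hak.ne']
      linarith
    have hinv : u * (aeval a f * a⁻¹ ^ k) + w = (q : ℝ)⁻¹ := by
      rw [hga]
      field_simp
      linarith
    rw [hinv] at hM
    -- The square ensures positivity, as q may be negative.
    refine ⟨fun _ => (q : ℚ) ^ 2, fun _ => by positivity, ?_, ?_, ?_⟩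
    · convert pow_mem (intCast_mem M q) 2 using 1
      funext j
      simp
    · convert pow_mem hM 2 using 1
      funext j
      fin_cases j <;> simp
    · rintro n ⟨hn1, hn2⟩
      have hn0 : n ≠ 0 := by
        rintro rfl
        rw [zpow_zero] at hn1
        have h3 : (1 : ℝ) = ((q : ℚ) ^ 2 : ℚ) := hn1
        have : (1 : ℤ) = q ^ 2 := by exact_mod_cast h3
        omega
      exact hab ((zpow_left_inj₀ ha.le hb.le hn0).1 (hn1.trans hn2.symm))
  · obtain ⟨g, N, hN, hga, hgb⟩ := exists_aeval_eq_zero_and_intCast ha_alg hb_alg hmin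
    have h0N : ![0, (N : ℝ)] ∈ M := by
      convert aeval_mem_subring h1 g using 1
      funext j
      fin_cases j
      exacts [hga.symm, hgb.symm]
    obtain ⟨l, k, hk, d, hd⟩ := exists_dvd_pow_sub_one hN (q ^ 2)
    have hd' : ((q : ℝ) ^ 2) ^ l * (((q : ℝ) ^ 2) ^ k - 1) = N * d := by exact_mod_cast hd
    have hql : ((q : ℝ) ^ 2) ^ l ≠ 0 := by positivity
    have hqk : ((q : ℝ) ^ 2) ^ k ≠ 0 := by positivity
    -- From (0, N)·d = (0, q^(2l)(q^(2k) - 1)); the factor q^(2l) is removed by powers of the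
    -- multiplier with second coordinate 1/q.
    have h3 : ![0, ((q : ℝ) ^ 2) ^ k - 1] ∈ M := by
      convert mul_mem (mul_mem h0N (intCast_mem M d)) (pow_mem (pow_mem hM 2) l) using 1
      funext j
      fin_cases j
      · simp
      · simp only [Fin.mk_one, Matrix.cons_val_one, Matrix.cons_val_fin_one, Pi.mul_apply,
          Pi.pow_apply, Pi.intCast_apply]
        rw [← hd', inv_pow, inv_pow]
        field_simp
    refine ⟨![1, ((q : ℚ) ^ 2) ^ k], ?_, ?_, ?_, ?_⟩
    · intro j
      fin_cases j
      · simp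
      · simp only [Fin.mk_one, Matrix.cons_val_one, Matrix.cons_val_fin_one]
        positivity
    · convert add_mem (one_mem M) h3 using 1
      funext j
      fin_cases j <;> simp
    -- The inverse arises from 1 - (E^k - 1)E^(-k) = E^(-k) with E = q². The zero first coordinate
    -- hides the unknown first coordinate of the multiplier used.
    · convert sub_mem (one_mem M) (mul_mem h3 (pow_mem (pow_mem hM 2) k)) using 1
      funext j
      fin_cases j
      · simp
      · simp only [Fin.mk_one, Matrix.cons_val_one, Matrix.cons_val_fin_one, Pi.mul_apply,
          Pi.pow_apply, Pi.sub_apply, Pi.one_apply]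
        push_cast
        rw [inv_pow, inv_pow]
        field_simp
        ring
    · rintro n ⟨hn1, hn2⟩
      simp only [Matrix.cons_val_zero, Matrix.cons_val_one, Matrix.cons_val_fin_one] at hn1 hn2
      push_cast at hn1 hn2
      have hn0 : n ≠ 0 := by
        rintro rfl
        rw [zpow_zero] at hn2
        have h4 : (1 : ℤ) = (q ^ 2) ^ k := by exact_mod_cast hn2
        have := one_lt_pow₀ hE hk.ne'
        omega
      have ha1 : a = 1 := by
        have := (zpow_left_inj₀ ha.le zero_le_one hn0).1 (hn1.trans (one_zpow n).symm)
        exact this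
      refine hex.resolve_left (not_not.2 ha1) n (2 * k : ℕ) hn0 (by omega) ?_
      rw [hn2, zpow_natCast, pow_mul, sq_abs]

end NumberTheory

end AFAlg
-- The contradiction
theorem mainTheorem6 (a b : ℝ) (ha : 0 < a) (hb : 0 < b)
    (ha_alg : IsAlgebraic ℚ a) (hb_alg : IsAlgebraic ℚ b) (hab : a ≠ b)
    (p q : ℤ) (hp : p ≠ 0) (hq0 : q ≠ 0) (hq1 : q ≠ 1) (hq2 : q ≠ -1) (hpq : IsCoprime p q)
    (hmem : (p : ℝ) / (q : ℝ) ∈ Algebra.adjoin ℤ ({b, b⁻¹} : Set ℝ))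
    (hex : a ≠ 1 ∨ ∀ k n : ℤ, k ≠ 0 → n ≠ 0 → b ^ k ≠ |(q : ℝ)| ^ n) :
    ¬ ∃ (𝒜 : Type*) (_ : CStarAlgebra 𝒜) (φ : Fin 2 → AFAlg.tracialStates 𝒜),
      AFAlg.IsAF 𝒜 ∧
      Module.finrank ℂ (AFAlg.traceSpace 𝒜) = 2 ∧
      AFAlg.EnumeratesExtremeTraces φ ∧
      AFAlg.EmbedsK0 φ ∧
      AFAlg.fundamentalGroup φ =
        Set.range fun n : ℤ => Matrix.diagonal ![((a : ℂ) ^ n), ((b : ℂ) ^ n)] := by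
  rintro ⟨𝒜, _, φ, ⟨B, hBm, hBf, hBd⟩, hfr, hen, hemb, hF⟩
  have hfd : FiniteDimensional ℂ (AFAlg.traceSpace 𝒜) :=
    FiniteDimensional.of_finrank_pos (by rw [hfr]; exact two_pos)
  let _ := CStarAlgebra.spectralOrder 𝒜
  let _ := CStarAlgebra.spectralOrderedRing 𝒜
  have hA : AFAlg.IsEmbeddedAF φ B :=
    ⟨⟨hBm, hBf, hBd⟩, hfd, hen, hemb.1⟩
  have hdiag : ∀ n : ℤ, Matrix.diagonal (fun j => ((![a ^ n, b ^ n] j : ℝ) : ℂ))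
      = Matrix.diagonal ![((a : ℂ) ^ n), ((b : ℂ) ^ n)] := fun n => by
    congr 1
    funext j
    fin_cases j <;> simp
  have hmult : ∀ n : ℤ, ![a ^ n, b ^ n] ∈ AFAlg.multipliers φ := fun n =>
    AFAlg.mem_multipliers_of_mem_fundamentalGroup (by rw [hF, hdiag]; exact ⟨n, rfl⟩)
  have h1 := hmult 1
  have h2 := hmult (-1)
  rw [zpow_one, zpow_one] at h1
  rw [zpow_neg_one, zpow_neg_one] at h2
  obtain ⟨c, hc0, hc, hc', hn⟩ := AFAlg.exists_rational_unit ha hb ha_alg hb_alg hab hq0 hq1 hq2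
    hpq hmem hex h1 h2
  -- Both c and its inverse are positive rational multipliers, so both preserve the cone and diag(c)
  -- belongs to the fundamental group, although c is no power of (a, b).
  have hmem := hA.diagonal_mem_fundamentalGroup (c := fun j => (c j : ℝ))
    (fun j => by exact_mod_cast hc0 j) (fun t ht => hA.isVal_mul hc0 hc ht) fun t ht => by
      have h3 := hA.isVal_mul (c := fun j => (c j)⁻¹) (fun j => inv_pos.2 (hc0 j))
        (by simpa only [Rat.cast_inv] using hc') ht
      simp only [Rat.cast_inv] at h3
      exact h3
  rw [hF] at hmem
  obtain ⟨n, h3⟩ := hmem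
  have h4 := Matrix.diagonal_injective ((hdiag n).trans h3)
  exact hn n ⟨Complex.ofReal_injective (congrFun h4 0), Complex.ofReal_injective (congrFun h4 1)⟩
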